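/- **Setting.** Let $n\ge 3$, let $s_i=(i,i+1)$, $1\le i\le n-1$, be the nearest-neighbour transpositions of $S_n$, and let $\mathbb{C}[S_n]$ be the group algebra with its usual $*$-structure and cocommutative Hopf algebra structure. Let $D$ be the operator of multiplication by the word length with respect to $s_1,\dots,s_{n-1}$ (on $\ell^2(S_n)$, and equally on $\mathbb{C}[S_n]$), and let $\boldsymbol\tau$ be the canonical trace of $\mathbb{C}[S_n]$ (evaluation at the neutral element). A *compact quantum group* $\mathbb{G}=(A,\Delta_A)$ is a unital C*-algebra $A$ with a coassociative unital $*$-homomorphism $\Delta_A\colon A\to A\otimes A$ (minimal tensor product) such that $\Delta_A(A)(A\otimes \mathbb{1})$ and $\Delta_A(A)(\mathbb{1}\otimes A)$ span dense subspaces of $A\otimes A$. A *coaction* of $\mathbb{G}$ on $\mathbb{C}[S_n]$ is a unital $*$-homomorphism $\alpha\colon\mathbb{C}[S_n]\to\mathbb{C}[S_n]\otimes A$ with $(\alpha\otimes\mathrm{id})\alpha=(\mathrm{id}\otimes\Delta_A)\alpha$ such that the linear span of $\alpha(\mathbb{C}[S_n])(\mathbb{1}\otimes A)$ is dense in $\mathbb{C}[S_n]\otimes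 A$ (the Podleś condition). It is *isometric* if $(\boldsymbol\tau\otimes\mathrm{id})\alpha(x)=\boldsymbol\tau(x)\mathbb{1}$ for all $x$ and $\alpha\circ D=(D\otimes\mathrm{id})\circ\alpha$. The *quantum isometry group* $\mathrm{QISO}=\mathrm{QISO}(\mathbb{C}[S_n],\ell^2(S_n),D)$ is the universal compact quantum group coacting isometrically: a compact quantum group with an isometric coaction $\boldsymbol\alpha$ such that for each isometric coaction $\beta$ of a compact quantum group $\mathbb{H}=(B,\Delta_B)$ on $\mathbb{C}[S_n]$ there is exactly one unital $*$-homomorphism $\Phi\colon C(\mathrm{QISO})\to B$ with $(\Phi\otimes\Phi)\Delta=\Delta_B\Phi$ and $\beta=(\mathrm{id}\otimes\Phi)\boldsymbol\alpha$; here $C(\mathrm{QISO})$ denotes its C*-algebra and $\Delta$ its comultiplication. For a finite-dimensional Hopf $*$-algebra $H$ with an automorphism $\theta$ of order two, let $\hat H$ be the dual Hopf $*$-algebra and $\hat\theta(f)=f\circ\theta$. The *doubling* of $(H,\theta)$ is the dual Hopf $*$-algebra of the crossed product $\hat H\rtimes_{\hat\theta}\mathbb{Z}_2=\hat H\oplus\hat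 H U$, where $U=U^*$, $U^2=\mathbb{1}$, $UfU=\hat\theta(f)$, the comultiplication extends that of $\hat H$, and $U\mapsto U\otimes U$. **Theorem.** Let $n\geq 3$. 1. The quantum isometry group $\mathrm{QISO}(\mathbb{C}[S_n],\ell^2(S_n),D)$ exists. 2. It is isomorphic, as a quantum group, to the finite quantum group obtained as the doubling of $\mathbb{C}[S_n]$ with respect to the automorphism of order two $\theta(s_i)=s_{n-i}$. In particular $C(\mathrm{QISO})$ is isomorphic to $\mathbb{C}[S_n]\oplus\mathbb{C}[S_n]$. The isomorphism $C(\mathrm{QISO})\cong\mathbb{C}[S_n]\oplus\mathbb{C}[S_n]$ can be chosen so that, with $\sigma_i$ and $\tau_i$ denoting $s_i$ in the first and in the second copy of $\mathbb{C}[S_n]$, for all $1\le i\le n-1$, $$\Delta(\sigma_i)=\sigma_i\otimes\sigma_i+\tau_i\otimes\tau_{n-i},\qquad \Delta(\tau_i)=\sigma_i\otimes\tau_i+\tau_i\otimes\sigma_{n-i},$$ and the universal isometric coaction is $\boldsymbol\alpha(s_i)=s_i\otimes\sigma_i+s_{n-i}\otimes\tau_{n-i}$. 3. Let $\alpha$ be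 any coaction of a compact quantum group $(A,\Delta_A)$ on $\mathbb{C}[S_n]$ (satisfying the Podleś condition) such that $\alpha(s_j)\in\operatorname{span}\{s_1,\dots,s_{n-1}\}\otimes A$ for all $j$, and, for all $k,l$, $(\boldsymbol\tau\otimes\mathrm{id})\alpha(s_ks_l)$ equals $\mathbb{1}$ if $k=l$ and $0$ otherwise. Then $\alpha$ is isometric. -/

import Mathlib

open scoped TensorProduct ComplexOrder InnerProductSpace ENNReal

universe u

noncomputable section

namespace QIso

section HilbertTensor

variable (H K : Type*) [NormedAddCommGroup H] [InnerProductSpace ℂ H]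
  [NormedAddCommGroup K] [InnerProductSpace ℂ K]

/-- The tensor product of two Hilbert spaces. -/
abbrev HilbertTensor : Type _ := UniformSpace.Completion (H ⊗[ℂ] K)

variable {H K}

/-- Elementary tensors in the Hilbert space tensor product. -/
def htmul (x : H) (y : K) : HilbertTensor H K := ((x ⊗ₜ[ℂ] y : H ⊗[ℂ] K) : HilbertTensor H K)

theorem norm_htmul (x : H) (y : K) : ‖htmul x y‖ = ‖x‖ * ‖y‖ := by
  rw [htmul, UniformSpace.Completion.norm_coe, TensorProduct.norm_tmul]

theorem add_htmul (x x' : H) (y : K) : htmul (x + x') y = htmul x y + htmul x' y := by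
  simp only [htmul, TensorProduct.add_tmul, UniformSpace.Completion.coe_add]

theorem htmul_add (x : H) (y y' : K) : htmul x (y + y') = htmul x y + htmul x y' := by
  simp only [htmul, TensorProduct.tmul_add, UniformSpace.Completion.coe_add]

theorem zero_htmul (y : K) : htmul (0 : H) y = 0 := by
  simp only [htmul, TensorProduct.zero_tmul, UniformSpace.Completion.coe_zero]

theorem htmul_zero (x : H) : htmul x (0 : K) = 0 := by
  simp only [htmul, TensorProduct.tmul_zero, UniformSpace.Completion.coe_zero]

theorem smul_htmul (r : ℂ) (x : H) (y : K) : htmul (r • x) y = r • htmul x y := by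
  simp only [htmul, ← TensorProduct.smul_tmul', UniformSpace.Completion.coe_smul]

theorem htmul_smul (r : ℂ) (x : H) (y : K) : htmul x (r • y) = r • htmul x y := by
  simp only [htmul, TensorProduct.tmul_smul, UniformSpace.Completion.coe_smul]

theorem inner_htmul (x x' : H) (y y' : K) :
    ⟪htmul x y, htmul x' y'⟫_ℂ = ⟪x, x'⟫_ℂ * ⟪y, y'⟫_ℂ := by
  simp only [htmul, UniformSpace.Completion.inner_coe, TensorProduct.inner_tmul]

/-- The operator `S ⊗ T` on the tensor product of two Hilbert spaces. -/
def opTensor (S : H →L[ℂ] H) (T : K →L[ℂ] K) : HilbertTensor H K →L[ℂ] HilbertTensor H K :=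
  (TensorProduct.mapL S T).completion

theorem opTensor_htmul (S : H →L[ℂ] H) (T : K →L[ℂ] K) (x : H) (y : K) :
    opTensor S T (htmul x y) = htmul (S x) (T y) := by
  simp only [opTensor, htmul, ContinuousLinearMap.completion_apply_coe, TensorProduct.mapL_tmul]

theorem opTensor_ext {S T : HilbertTensor H K →L[ℂ] HilbertTensor H K}
    (h : ∀ x y, S (htmul x y) = T (htmul x y)) : S = T := by
  ext z
  induction z using UniformSpace.Completion.induction_on with
  | hp => exact isClosed_eq S.continuous T.continuous
  | ih z =>
    induction z using TensorProduct.induction_on with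
    | zero => rw [UniformSpace.Completion.coe_zero, map_zero, map_zero]
    | tmul x y => exact h x y
    | add x y hx hy => rw [UniformSpace.Completion.coe_add, map_add, map_add, hx, hy]

theorem opTensor_star [CompleteSpace H] [CompleteSpace K] (S : H →L[ℂ] H) (T : K →L[ℂ] K) :
    opTensor (star S) (star T) = star (opTensor S T) := by
  refine opTensor_ext fun x y => ?_
  refine ext_inner_right ℂ fun z => ?_
  rw [ContinuousLinearMap.star_eq_adjoint (opTensor S T), ContinuousLinearMap.adjoint_inner_left]
  induction z using UniformSpace.Completion.induction_on with
  | hp => apply isClosed_eq <;> fun_prop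
  | ih z =>
    induction z using TensorProduct.induction_on with
    | zero => rw [UniformSpace.Completion.coe_zero, map_zero, inner_zero_right, inner_zero_right]
    | add x x' hx hx' =>
      rw [UniformSpace.Completion.coe_add, map_add, inner_add_right, inner_add_right, hx, hx']
    | tmul a b =>
      change ⟪_, htmul a b⟫_ℂ = ⟪_, opTensor S T (htmul a b)⟫_ℂ
      simp only [opTensor_htmul, inner_htmul, ContinuousLinearMap.star_eq_adjoint,
        ContinuousLinearMap.adjoint_inner_left]

/-- The amplification `S ↦ S ⊗ 1`. -/
def ampLeft (H K : Type*) [NormedAddCommGroup H] [InnerProductSpace ℂ H]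
    [NormedAddCommGroup K] [InnerProductSpace ℂ K] [CompleteSpace H] [CompleteSpace K] :
    (H →L[ℂ] H) →⋆ₐ[ℂ] (HilbertTensor H K →L[ℂ] HilbertTensor H K) where
  toFun S := opTensor S 1
  map_one' := opTensor_ext fun x y => by simp [opTensor_htmul]
  map_mul' a b := opTensor_ext fun x y => by simp [opTensor_htmul]
  map_zero' := opTensor_ext fun x y => by simp [opTensor_htmul, zero_htmul]
  map_add' a b := opTensor_ext fun x y => by simp [opTensor_htmul, add_htmul]
  commutes' r := opTensor_ext fun x y => by
    simp [opTensor_htmul, Algebra.algebraMap_eq_smul_one, smul_htmul]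
  map_star' S := by rw [← opTensor_star, star_one]

/-- The amplification `T ↦ 1 ⊗ T`. -/
def ampRight (H K : Type*) [NormedAddCommGroup H] [InnerProductSpace ℂ H]
    [NormedAddCommGroup K] [InnerProductSpace ℂ K] [CompleteSpace H] [CompleteSpace K] :
    (K →L[ℂ] K) →⋆ₐ[ℂ] (HilbertTensor H K →L[ℂ] HilbertTensor H K) where
  toFun T := opTensor 1 T
  map_one' := opTensor_ext fun x y => by simp [opTensor_htmul]
  map_mul' a b := opTensor_ext fun x y => by simp [opTensor_htmul]
  map_zero' := opTensor_ext fun x y => by simp [opTensor_htmul, htmul_zero]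
  map_add' a b := opTensor_ext fun x y => by simp [opTensor_htmul, htmul_add]
  commutes' r := opTensor_ext fun x y => by
    simp [opTensor_htmul, Algebra.algebraMap_eq_smul_one, htmul_smul]
  map_star' S := by rw [← opTensor_star, star_one]

theorem ampLeft_comm_ampRight [CompleteSpace H] [CompleteSpace K] (S : H →L[ℂ] H) (T : K →L[ℂ] K) :
    Commute (ampLeft H K S) (ampRight H K T) :=
  opTensor_ext fun x y => by
    change opTensor _ _ (opTensor _ _ _) = opTensor _ _ (opTensor _ _ _)
    simp only [opTensor_htmul]
    rfl

instance [Nontrivial H] [Nontrivial K] : Nontrivial (HilbertTensor H K) := by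
  obtain ⟨x, hx⟩ := exists_ne (0 : H)
  obtain ⟨y, hy⟩ := exists_ne (0 : K)
  refine ⟨htmul x y, 0, fun h => ?_⟩
  have := norm_htmul x y
  rw [h, norm_zero] at this
  simp_all

end HilbertTensor

/-- The functional `T ↦ ⟪x, T x⟫` on the bounded operators of a Hilbert space. -/
def vectorFun {L : Type*} [NormedAddCommGroup L] [InnerProductSpace ℂ L] (x : L) :
    (L →L[ℂ] L) →ₗ[ℂ] ℂ where
  toFun T := ⟪x, T x⟫_ℂ
  map_add' _ _ := inner_add_right _ _ _
  map_smul' _ _ := inner_smul_right _ _ _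

theorem vectorFun_nonneg {L : Type*} [NormedAddCommGroup L] [InnerProductSpace ℂ L]
    [CompleteSpace L] (x : L) (T : L →L[ℂ] L) : 0 ≤ vectorFun x (star T * T) := by
  change 0 ≤ ⟪x, star T (T x)⟫_ℂ
  rw [ContinuousLinearMap.star_eq_adjoint, ContinuousLinearMap.adjoint_inner_right]
  rw [inner_self_eq_norm_sq_to_K, ← RCLike.ofReal_pow]
  exact Complex.zero_le_real.mpr (sq_nonneg ‖T x‖)

section BoundedFamilies

variable {ι : Type*} {E : ι → Type*} [∀ i, Nontrivial (E i)] [∀ i, CStarAlgebra (E i)]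

instance instCStarAlgebraLp : CStarAlgebra (lp E ∞) where

/-- A family of representations, as a map to bounded families. -/
def familyRep {C : Type*} [CStarAlgebra C] (π : ∀ i, C →⋆ₐ[ℂ] E i) : C →⋆ₐ[ℂ] lp E ∞ where
  toFun c := ⟨fun i => π i c, memℓp_infty ⟨‖c‖, by
    rintro _ ⟨p, rfl⟩
    exact NonUnitalStarAlgHom.norm_apply_le (π p) c⟩⟩
  map_one' := by ext1; funext p; exact map_one (π p)
  map_mul' a b := by ext1; funext p; exact map_mul (π p) a b
  map_zero' := by ext1; funext p; exact map_zero (π p)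
  map_add' a b := by ext1; funext p; exact map_add (π p) a b
  commutes' r := by ext1; funext p; exact (π p).commutes' r
  map_star' a := by ext1; funext p; exact map_star (π p) a

variable {A B : Type*} [CStarAlgebra A] [CStarAlgebra B]

/-- The representation `a ⊗ b ↦ (π_i(a) ρ_i(b))_i` of the algebraic tensor product given by families
of representations with commuting ranges. -/
def tensorRep (π : ∀ i, A →⋆ₐ[ℂ] E i) (ρ : ∀ i, B →⋆ₐ[ℂ] E i)
    (h : ∀ i a b, Commute (π i a) (ρ i b)) : A ⊗[ℂ] B →⋆ₐ[ℂ] lp E ∞ where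
  __ := Algebra.TensorProduct.lift (familyRep π).toAlgHom (familyRep ρ).toAlgHom
    (fun a b => by ext1; funext i; exact h i a b)
  map_star' x := by
    induction x using TensorProduct.induction_on with
    | zero => simp
    | add x y hx hy => simp_all
    | tmul a b =>
      simp only [TensorProduct.star_tmul]
      ext1; funext i
      change π i (star a) * ρ i (star b) = star (π i a * ρ i b)
      rw [star_mul, ← map_star, ← map_star, (h i (star a) (star b)).eq]

/-- Evaluation of bounded families. -/
def evalRep (i : ι) : lp E ∞ →⋆ₐ[ℂ] E i where
  toFun t := t i
  map_one' := rfl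
  map_mul' _ _ := rfl
  map_zero' := rfl
  map_add' _ _ := rfl
  commutes' _ := rfl
  map_star' _ := rfl

theorem evalRep_tensorRep (π : ∀ i, A →⋆ₐ[ℂ] E i) (ρ : ∀ i, B →⋆ₐ[ℂ] E i)
    (h : ∀ i a b, Commute (π i a) (ρ i b)) (i : ι) (a : A) (b : B) :
    evalRep i (tensorRep π ρ h (a ⊗ₜ b)) = π i a * ρ i b := rfl

end BoundedFamilies

section MinTensor

/-- States of a unital C⋆-algebra: positive linear functionals taking the value `1` at `1`. -/
abbrev CState (A : Type*) [CStarAlgebra A] [PartialOrder A] : Type _ := {f : A →ₚ[ℂ] ℂ // f 1 = 1}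

variable {A : Type*} [CStarAlgebra A] [PartialOrder A] [StarOrderedRing A]
variable {B : Type*} [CStarAlgebra B] [PartialOrder B] [StarOrderedRing B]

/-- The cyclic vector of the GNS representation of a state. -/
def gnsVector (φ : CState A) : φ.1.GNS := ((φ.1.toPreGNS 1 : φ.1.PreGNS) : φ.1.GNS)

theorem norm_gnsVector (φ : CState A) : ‖gnsVector φ‖ = 1 := by
  rw [gnsVector, UniformSpace.Completion.norm_coe, PositiveLinearMap.preGNS_norm_def]
  simp [φ.2]

instance (φ : CState A) : Nontrivial φ.1.GNS :=
  ⟨gnsVector φ, 0, fun h => by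
    have := norm_gnsVector φ
    rw [h, norm_zero] at this
    exact zero_ne_one this⟩

/-- The C⋆-algebra of bounded operators on the Hilbert space tensor product of the GNS spaces of two
states. -/
def GNSOp (φ : CState A) (ψ : CState B) : Type _ :=
  HilbertTensor φ.1.GNS ψ.1.GNS →L[ℂ] HilbertTensor φ.1.GNS ψ.1.GNS

instance (φ : CState A) (ψ : CState B) : CStarAlgebra (GNSOp φ ψ) :=
  inferInstanceAs (CStarAlgebra (HilbertTensor φ.1.GNS ψ.1.GNS →L[ℂ] HilbertTensor φ.1.GNS ψ.1.GNS))

instance (φ : CState A) (ψ : CState B) : Nontrivial (GNSOp φ ψ) :=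
  inferInstanceAs (Nontrivial (HilbertTensor φ.1.GNS ψ.1.GNS →L[ℂ] HilbertTensor φ.1.GNS ψ.1.GNS))

/-- `a ↦ π_φ(a) ⊗ 1`. -/
def leftRep (φ : CState A) (ψ : CState B) : A →⋆ₐ[ℂ] GNSOp φ ψ :=
  (ampLeft φ.1.GNS ψ.1.GNS).comp φ.1.gnsStarAlgHom

/-- `b ↦ 1 ⊗ π_ψ(b)`. -/
def rightRep (φ : CState A) (ψ : CState B) : B →⋆ₐ[ℂ] GNSOp φ ψ :=
  (ampRight φ.1.GNS ψ.1.GNS).comp ψ.1.gnsStarAlgHom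

theorem leftRep_comm_rightRep (φ : CState A) (ψ : CState B) (a : A) (b : B) :
    Commute (leftRep φ ψ a) (rightRep φ ψ b) :=
  ampLeft_comm_ampRight _ _

variable (A B)

/-- The C⋆-algebra of bounded families of operators on the spaces `H_φ ⊗ H_ψ`, where `(φ, ψ)` runs
through all pairs of states: the block-diagonal operators on `(⨁ H_φ) ⊗ (⨁ H_ψ)`. -/
abbrev BlockOps : Type _ := lp (fun p : CState A × CState B => GNSOp p.1 p.2) ∞

/-- The representation `⨁ π_φ ⊗ π_ψ` of the algebraic tensor product `A ⊗ B`, that is, the tensor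
product of the universal representations of `A` and of `B`. -/
def spatialRep : A ⊗[ℂ] B →⋆ₐ[ℂ] BlockOps A B :=
  tensorRep (fun p : CState A × CState B => leftRep p.1 p.2) (fun p => rightRep p.1 p.2)
    (fun p => leftRep_comm_rightRep p.1 p.2)

/-- The minimal (spatial) tensor product of two unital C⋆-algebras: the norm closure of `A ⊗ B` in
the tensor product of the universal representations of `A` and of `B`. -/
def MinTensor : Type _ := (spatialRep A B).range.topologicalClosure

instance : CStarAlgebra (MinTensor A B) :=
  haveI : IsClosed ((spatialRep A B).range.topologicalClosure : Set (BlockOps A B)) :=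
    StarSubalgebra.isClosed_topologicalClosure _
  inferInstanceAs (CStarAlgebra (spatialRep A B).range.topologicalClosure)

/-- The canonical map from the algebraic to the minimal tensor product. -/
def toMin : A ⊗[ℂ] B →⋆ₐ[ℂ] MinTensor A B :=
  (StarSubalgebra.inclusion (StarSubalgebra.le_topologicalClosure _)).comp
    (spatialRep A B).rangeRestrict

variable {A B}

/-- The component of an element of the minimal tensor product in `B(H_φ ⊗ H_ψ)`. -/
def component (φ : CState A) (ψ : CState B) : MinTensor A B →⋆ₐ[ℂ] GNSOp φ ψ :=
  (evalRep (E := fun p : CState A × CState B => GNSOp p.1 p.2) (φ, ψ)).comp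
    (StarSubalgebra.subtype (spatialRep A B).range.topologicalClosure)

/-- The vector functional of `B(H_φ ⊗ H_ψ)` given by the tensor product of the cyclic vectors. -/
def vectorFunctional (φ : CState A) (ψ : CState B) : GNSOp φ ψ →ₗ[ℂ] ℂ :=
  vectorFun (htmul (gnsVector φ) (gnsVector ψ))

/-- The product state `φ ⊗ ψ` on the minimal tensor product. -/
def prodFunctional (φ : CState A) (ψ : CState B) : MinTensor A B →ₗ[ℂ] ℂ :=
  vectorFunctional φ ψ ∘ₗ (component φ ψ).toAlgHom.toLinearMap

theorem gnsVector_inner (φ : CState A) (a : A) :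
    ⟪gnsVector φ, φ.1.gnsStarAlgHom a (gnsVector φ)⟫_ℂ = φ.1 a := by
  change ⟪gnsVector φ, φ.1.gnsNonUnitalStarAlgHom a (gnsVector φ)⟫_ℂ = φ.1 a
  rw [gnsVector, PositiveLinearMap.gnsNonUnitalStarAlgHom_apply_coe,
    UniformSpace.Completion.inner_coe]
  simp [PositiveLinearMap.preGNS_inner_def]

theorem component_toMin (φ : CState A) (ψ : CState B) (a : A) (b : B) :
    component φ ψ (toMin A B (a ⊗ₜ b)) = leftRep φ ψ a * rightRep φ ψ b :=
  evalRep_tensorRep (fun p : CState A × CState B => leftRep p.1 p.2) (fun p => rightRep p.1 p.2)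
    (fun p => leftRep_comm_rightRep p.1 p.2) (φ, ψ) a b

theorem vectorFun_opTensor {H K : Type*} [NormedAddCommGroup H] [InnerProductSpace ℂ H]
    [NormedAddCommGroup K] [InnerProductSpace ℂ K] [CompleteSpace H] [CompleteSpace K]
    (x : H) (y : K) (S : H →L[ℂ] H) (T : K →L[ℂ] K) :
    vectorFun (htmul x y) (ampLeft H K S * ampRight H K T) = ⟪x, S x⟫_ℂ * ⟪y, T y⟫_ℂ := by
  change ⟪htmul x y, opTensor S 1 (opTensor 1 T (htmul x y))⟫_ℂ = _
  rw [opTensor_htmul, opTensor_htmul, inner_htmul]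
  rfl

theorem prodFunctional_toMin (φ : CState A) (ψ : CState B) (a : A) (b : B) :
    prodFunctional φ ψ (toMin A B (a ⊗ₜ b)) = φ.1 a * ψ.1 b := by
  change vectorFunctional φ ψ (component φ ψ (toMin A B (a ⊗ₜ b))) = _
  rw [component_toMin, ← gnsVector_inner, ← gnsVector_inner]
  exact vectorFun_opTensor (gnsVector φ) (gnsVector ψ) (φ.1.gnsStarAlgHom a)
    (ψ.1.gnsStarAlgHom b)

theorem norm_component_le (φ : CState A) (ψ : CState B) (t : MinTensor A B) :
    ‖component φ ψ t‖ ≤ ‖t‖ := NonUnitalStarAlgHom.norm_apply_le _ t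

theorem prodFunctional_nonneg (φ : CState A) (ψ : CState B) (t : MinTensor A B) :
    0 ≤ prodFunctional φ ψ (star t * t) := by
  change 0 ≤ vectorFunctional φ ψ (component φ ψ (star t * t))
  rw [map_mul, map_star]
  exact vectorFun_nonneg _ (component φ ψ t)

theorem prodFunctional_one (φ : CState A) (ψ : CState B) :
    prodFunctional φ ψ (1 : MinTensor A B) = 1 := by
  rw [← map_one (toMin A B), Algebra.TensorProduct.one_def, prodFunctional_toMin, φ.2, ψ.2, one_mul]

theorem denseRange_toMin : DenseRange (toMin A B) := by
  intro t
  rw [Metric.mem_closure_range_iff]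
  intro ε hε
  obtain ⟨x, hx, hd⟩ := Metric.mem_closure_iff.mp
    (show t.1 ∈ closure ((spatialRep A B).range : Set (BlockOps A B)) from t.2) ε hε
  obtain ⟨y, rfl⟩ := hx
  exact ⟨y, hd⟩

end MinTensor
section CompactQuantumGroup

variable {A : Type*} [CStarAlgebra A] [PartialOrder A] [StarOrderedRing A]
variable {B : Type*} [CStarAlgebra B] [PartialOrder B] [StarOrderedRing B]

/-- The convolution product `φ * ψ = (φ ⊗ ψ) ∘ Δ` of two states. -/
def convState (Δ : A →⋆ₐ[ℂ] MinTensor A A) (φ ψ : CState A) : CState A :=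
  ⟨PositiveLinearMap.mk₀ (prodFunctional φ ψ ∘ₗ Δ.toAlgHom.toLinearMap) (by
    intro x hx
    obtain ⟨y, rfl⟩ := CStarAlgebra.nonneg_iff_eq_star_mul_self.mp hx
    change 0 ≤ prodFunctional φ ψ (Δ (star y * y))
    rw [map_mul, map_star]
    exact prodFunctional_nonneg φ ψ (Δ y)), by
    change prodFunctional φ ψ (Δ 1) = 1
    rw [map_one, prodFunctional_one]⟩

/-- The state `φ ∘ Φ`. -/
def pullState (Φ : A →⋆ₐ[ℂ] B) (φ : CState B) : CState A :=
  ⟨PositiveLinearMap.mk₀ (φ.1.toLinearMap ∘ₗ Φ.toAlgHom.toLinearMap) (by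
    intro x hx
    obtain ⟨y, rfl⟩ := CStarAlgebra.nonneg_iff_eq_star_mul_self.mp hx
    change 0 ≤ φ.1 (Φ (star y * y))
    rw [map_mul, map_star]
    exact φ.1.map_nonneg (star_mul_self_nonneg _)), by
    change φ.1 (Φ 1) = 1
    rw [map_one, φ.2]⟩

/-- A compact quantum group in the sense of Woronowicz, with algebra of continuous functions the
unital C⋆-algebra `A` (the order on `A` is the one given by its positive elements): a unital
⋆-homomorphism `Δ : A → A ⊗ A` into the minimal tensor product which is coassociative and satisfies
the cancellation laws.

Product states separate the points of a minimal tensor product, so `(Δ ⊗ id) Δ = (id ⊗ Δ) Δ` means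
that both sides agree under `φ ⊗ ψ ⊗ χ` for all states `φ`, `ψ`, `χ` of `A`, that is, that
`(φ * ψ) * χ = φ * (ψ * χ)`. -/
structure CompactQuantumGroup (A : Type*) [CStarAlgebra A] [PartialOrder A]
    [StarOrderedRing A] where
  comul : A →⋆ₐ[ℂ] MinTensor A A
  coassoc : ∀ φ ψ χ : CState A,
    convState comul (convState comul φ ψ) χ = convState comul φ (convState comul ψ χ)
  cancel_left : Dense (Submodule.span ℂ
    {t : MinTensor A A | ∃ a b : A, t = comul a * toMin A A (b ⊗ₜ 1)} : Set (MinTensor A A))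
  cancel_right : Dense (Submodule.span ℂ
    {t : MinTensor A A | ∃ a b : A, t = comul a * toMin A A (1 ⊗ₜ b)} : Set (MinTensor A A))

/-- A unital ⋆-homomorphism `Φ : A → B` is a morphism of quantum groups, `(Φ ⊗ Φ) Δ_A = Δ_B Φ`. Both
sides are compared under all product states `φ ⊗ ψ` of the minimal tensor product of `B` with
itself: `(φ ∘ Φ) * (ψ ∘ Φ) = (φ * ψ) ∘ Φ`. -/
def IsQuantumGroupHom (𝔾 : CompactQuantumGroup A) (ℍ : CompactQuantumGroup B)
    (Φ : A →⋆ₐ[ℂ] B) : Prop :=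
  ∀ φ ψ : CState B,
    convState 𝔾.comul (pullState Φ φ) (pullState Φ ψ) = pullState Φ (convState ℍ.comul φ ψ)

end CompactQuantumGroup

section GroupAlgebra

variable {G : Type*} [Group G]

/-- The involution of the group algebra: `(∑ c_g g)^* = ∑ conj c_g g⁻¹`. -/
instance : Star (MonoidAlgebra ℂ G) where
  star x := MonoidAlgebra.ofCoeff
    ((x.coeff.mapRange star (star_zero ℂ)).equivMapDomain (Equiv.inv G))

theorem coeff_star (x : MonoidAlgebra ℂ G) (g : G) : (star x).coeff g = star (x.coeff g⁻¹) := rfl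

theorem star_single (g : G) (c : ℂ) :
    star (MonoidAlgebra.single g c) = MonoidAlgebra.single g⁻¹ (star c) := by
  classical
  ext h
  simp only [coeff_star, MonoidAlgebra.coeff_single, Finsupp.single_apply, eq_comm]
  split_ifs <;> simp_all

instance : StarRing (MonoidAlgebra ℂ G) where
  star_involutive x := by ext g; simp [coeff_star]
  star_add x y := by ext g; simp [coeff_star]
  star_mul x y := by
    have hadd : ∀ x y : MonoidAlgebra ℂ G, star (x + y) = star x + star y := fun x y => by
      ext g; simp [coeff_star]
    have hzero : star (0 : MonoidAlgebra ℂ G) = 0 := by ext g; simp [coeff_star]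
    induction x using MonoidAlgebra.induction_linear with
    | zero => simp [hzero]
    | add x x' hx hx' => rw [add_mul, hadd, hadd, mul_add, hx, hx']
    | single g c =>
      induction y using MonoidAlgebra.induction_linear with
      | zero => simp [hzero]
      | add x x' hx hx' => rw [mul_add, hadd, hadd, add_mul, hx, hx']
      | single h d =>
        simp only [MonoidAlgebra.single_mul_single, star_single, mul_inv_rev, star_mul]

instance : StarModule ℂ (MonoidAlgebra ℂ G) where
  star_smul c x := by ext g; simp [coeff_star]

/-- The coefficient functional `x ↦ x(g)` of the group algebra. For `g = 1` it is the canonical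
trace. -/
def coeffAt (g : G) : MonoidAlgebra ℂ G →ₗ[ℂ] ℂ where
  toFun x := x.coeff g
  map_add' _ _ := rfl
  map_smul' _ _ := rfl

/-- The minimal number of elements of `S` needed to write `g` as a product of elements of `S`. -/
def wordLength (S : Set G) (g : G) : ℕ :=
  sInf {k | ∃ l : List G, l.length = k ∧ (∀ s ∈ l, s ∈ S) ∧ l.prod = g}

/-- The Dirac operator of the length function, as a map of the group algebra of a finite group:
multiplication of `x : G → ℂ` by the word length. -/
def dirac [Fintype G] (S : Set G) : MonoidAlgebra ℂ G →ₗ[ℂ] MonoidAlgebra ℂ G where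
  toFun x := ∑ g, MonoidAlgebra.single g ((wordLength S g : ℂ) * x.coeff g)
  map_add' x y := by
    simp only [MonoidAlgebra.coeff_add, Finsupp.add_apply, mul_add, MonoidAlgebra.single_add,
      Finset.sum_add_distrib]
  map_smul' c x := by
    simp only [MonoidAlgebra.coeff_smul, Finsupp.smul_apply, smul_eq_mul, Finset.smul_sum,
      MonoidAlgebra.smul_single, RingHom.id_apply, mul_left_comm]

end GroupAlgebra

section Coactions

variable {G : Type*} [Group G]
variable {A : Type*} [CStarAlgebra A] [PartialOrder A] [StarOrderedRing A]

/-- The slice map `f ⊗ id` on `ℂ[G] ⊗ A` of the coefficient functional at `g`. -/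
def slice (g : G) : MonoidAlgebra ℂ G ⊗[ℂ] A →ₗ[ℂ] A :=
  (TensorProduct.lid ℂ A).toLinearMap ∘ₗ LinearMap.rTensor A (coeffAt g)

/-- `α` is a coaction of the compact quantum group `𝔾` on the group algebra of the finite group `G`,
satisfying the Podleś condition. Since `ℂ[G]` is finite dimensional, the algebraic tensor products
`ℂ[G] ⊗ A` and `ℂ[G] ⊗ (A ⊗ A)` are complete, and convergence in `ℂ[G] ⊗ A` is convergence
of all coefficients. -/
structure IsCoaction (𝔾 : CompactQuantumGroup A)
    (α : MonoidAlgebra ℂ G →⋆ₐ[ℂ] MonoidAlgebra ℂ G ⊗[ℂ] A) : Prop where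
  /-- `(α ⊗ id) α = (id ⊗ Δ) α` in `ℂ[G] ⊗ (A ⊗ A)`. -/
  coassoc : ∀ x,
    LinearMap.lTensor (MonoidAlgebra ℂ G) (toMin A A).toAlgHom.toLinearMap
      (TensorProduct.assoc ℂ (MonoidAlgebra ℂ G) A A
        (LinearMap.rTensor A α.toAlgHom.toLinearMap (α x))) =
    LinearMap.lTensor (MonoidAlgebra ℂ G) 𝔾.comul.toAlgHom.toLinearMap (α x)
  /-- The span of the elements `α(x) (1 ⊗ a)` is dense in `ℂ[G] ⊗ A`. -/
  podles : ∀ (y : MonoidAlgebra ℂ G ⊗[ℂ] A) (ε : ℝ), 0 < ε →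
    ∃ z ∈ Submodule.span ℂ {z : MonoidAlgebra ℂ G ⊗[ℂ] A | ∃ x a, z = α x * (1 ⊗ₜ a)},
      ∀ g : G, ‖slice g (y - z)‖ < ε

/-- The coaction `α` is isometric for the spectral triple `(ℂ[G], ℓ²(G), D)`, where `D` is
multiplication by the word length with respect to `S`. -/
structure IsIsometric [Fintype G] (S : Set G)
    (α : MonoidAlgebra ℂ G →⋆ₐ[ℂ] MonoidAlgebra ℂ G ⊗[ℂ] A) : Prop where
  /-- `(τ ⊗ id) α(x) = τ(x) 1`. -/
  trace : ∀ x, slice 1 (α x) = coeffAt 1 x • (1 : A)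
  /-- `α ∘ D = (D ⊗ id) ∘ α`. -/
  dirac : ∀ x, α (dirac S x) = LinearMap.rTensor A (dirac S) (α x)

end Coactions

/-- The compact quantum group `𝔾` with its coaction `α` is the quantum isometry group of the
spectral triple `(ℂ[G], ℓ²(G), D)` given by the generating set `S`: the universal compact quantum
group coacting isometrically. -/
structure IsQISO {G : Type*} [Group G] [Fintype G] (S : Set G)
    {A : Type u} [CStarAlgebra A] [PartialOrder A] [StarOrderedRing A]
    (𝔾 : CompactQuantumGroup A)
    (α : MonoidAlgebra ℂ G →⋆ₐ[ℂ] MonoidAlgebra ℂ G ⊗[ℂ] A) : Prop where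
  coaction : IsCoaction 𝔾 α
  isometric : IsIsometric S α
  universal : ∀ (B : Type u) [CStarAlgebra B] [PartialOrder B] [StarOrderedRing B]
    (ℍ : CompactQuantumGroup B) (β : MonoidAlgebra ℂ G →⋆ₐ[ℂ] MonoidAlgebra ℂ G ⊗[ℂ] B),
    IsCoaction ℍ β → IsIsometric S β →
    ∃! Φ : A →⋆ₐ[ℂ] B, IsQuantumGroupHom 𝔾 ℍ Φ ∧
      ∀ x, β x = LinearMap.lTensor (MonoidAlgebra ℂ G) Φ.toAlgHom.toLinearMap (α x)

section Doubling

open Module TensorProduct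

variable {H : Type*} [Ring H] [HopfAlgebra ℂ H] [Module.Finite ℂ H]

/-- The product of the dual Hopf algebra `Ĥ` of a finite-dimensional Hopf algebra `H`:
`f * g = (f ⊗ g) ∘ Δ`. -/
def dualMul : Dual ℂ H →ₗ[ℂ] Dual ℂ H →ₗ[ℂ] Dual ℂ H :=
  TensorProduct.curry ((Coalgebra.comul (R := ℂ) (A := H)).dualMap ∘ₗ dualDistrib ℂ H H)

/-- The comultiplication of the dual Hopf algebra `Ĥ`: `(Δ̂ f) (x ⊗ y) = f (x y)`. -/
def dualComul : Dual ℂ H →ₗ[ℂ] Dual ℂ H ⊗[ℂ] Dual ℂ H :=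
  (dualDistribEquiv ℂ H H).symm.toLinearMap ∘ₗ (LinearMap.mul' ℂ H).dualMap

/-- The involution of `Ĥ`: `f^* (x) = conj (f (S(x)^*))`. -/
def dualStar [StarRing H] [StarModule ℂ H] (f : Dual ℂ H) : Dual ℂ H where
  toFun x := star (f (star (HopfAlgebra.antipode ℂ x)))
  map_add' x y := by simp
  map_smul' c x := by simp

variable (H)

/-- The underlying vector space of the crossed product `Ĥ ⋊ ℤ/2`; the pair `(f, g)` stands for
`f + g U`. -/
abbrev Crossed : Type _ := Dual ℂ H × Dual ℂ H

variable {H}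

/-- The product of the crossed product `Ĥ ⋊ ℤ/2`, where `U f U = θ̂(f) = f ∘ θ` and `U² = 1`:
`(f + g U) (u + v U) = (f u + g θ̂(v)) + (f v + g θ̂(u)) U`. -/
def crossedMul (θ : H →ₗ[ℂ] H) : Crossed H →ₗ[ℂ] Crossed H →ₗ[ℂ] Crossed H :=
  LinearMap.mk₂ ℂ
    (fun p q => (dualMul p.1 q.1 + dualMul p.2 (θ.dualMap q.2),
      dualMul p.1 q.2 + dualMul p.2 (θ.dualMap q.1)))
    (fun p p' q => by ext <;> simp <;> ring) (fun c p q => by ext <;> simp)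
    (fun p q q' => by ext <;> simp <;> ring) (fun c p q => by ext <;> simp)

/-- The comultiplication of the crossed product: `Δ̂` on `Ĥ`, and `U ↦ U ⊗ U`. -/
def crossedComul : Crossed H →ₗ[ℂ] Crossed H ⊗[ℂ] Crossed H :=
  LinearMap.coprod
    (TensorProduct.map (LinearMap.inl ℂ _ _) (LinearMap.inl ℂ _ _) ∘ₗ dualComul)
    (TensorProduct.map (LinearMap.inr ℂ _ _) (LinearMap.inr ℂ _ _) ∘ₗ dualComul)

/-- The counit of the crossed product: `f + g U ↦ f(1) + g(1)`. -/
def crossedCounit : Dual ℂ (Crossed H) :=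
  LinearMap.coprod (Dual.eval ℂ H 1) (Dual.eval ℂ H 1)

/-- The antipode of the crossed product: `S(f + g U) = Ŝ(f) + U Ŝ(g)`, with `Ŝ(f) = f ∘ S`. -/
def crossedAntipode (θ : H →ₗ[ℂ] H) (p : Crossed H) : Crossed H :=
  (p.1 ∘ₗ HopfAlgebra.antipode ℂ, θ.dualMap (p.2 ∘ₗ HopfAlgebra.antipode ℂ))

/-- The involution of the crossed product: `(f + g U)^* = f^* + U g^*`. -/
def crossedStar [StarRing H] [StarModule ℂ H] (θ : H →ₗ[ℂ] H) (p : Crossed H) : Crossed H :=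
  (dualStar p.1, θ.dualMap (dualStar p.2))

variable (H)

/-- The underlying vector space of the doubling of a finite-dimensional Hopf algebra `H` with
respect to an automorphism of order two: the dual of the crossed product `Ĥ ⋊ ℤ/2`. -/
abbrev Doubling : Type _ := Dual ℂ (Crossed H)

variable {H}

/-- The product of the doubling, dual to the comultiplication of the crossed product. -/
def doublingMul (ξ η : Doubling H) : Doubling H :=
  dualDistrib ℂ (Crossed H) (Crossed H) (ξ ⊗ₜ η) ∘ₗ crossedComul

/-- The comultiplication of the doubling, dual to the product of the crossed product. -/
def doublingComul (θ : H →ₗ[ℂ] H) (ξ : Doubling H) : Doubling H ⊗[ℂ] Doubling H :=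
  (dualDistribEquiv ℂ (Crossed H) (Crossed H)).symm (ξ ∘ₗ TensorProduct.lift (crossedMul θ))

/-- The involution of the doubling, dual to the Hopf ⋆-algebra structure of the crossed product:
`ξ^*(p) = conj (ξ (S(p)^*))`. -/
def doublingStar [StarRing H] [StarModule ℂ H] (θ : H →ₗ[ℂ] H) (ξ : Doubling H) : Doubling H where
  toFun p := star (ξ (crossedStar θ (crossedAntipode θ p)))
  map_add' p q := by
    rw [← star_add, ← map_add]
    congr 2
    ext <;> simp [crossedStar, crossedAntipode, dualStar]
  map_smul' c p := by
    have : crossedStar θ (crossedAntipode θ (c • p)) =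
        star c • crossedStar θ (crossedAntipode θ p) := by
      ext <;> simp [crossedStar, crossedAntipode, dualStar]
    rw [this, map_smul]
    simp

/-- `Λ` is an isomorphism of the doubling of the finite-dimensional Hopf ⋆-algebra `H` with respect
to `θ` onto the compact quantum group `𝔾`. -/
structure IsDoublingIso [StarRing H] [StarModule ℂ H] (θ : H →ₗ[ℂ] H)
    {A : Type*} [CStarAlgebra A] [PartialOrder A] [StarOrderedRing A]
    (𝔾 : CompactQuantumGroup A) (Λ : Doubling H ≃ₗ[ℂ] A) : Prop where
  map_one : Λ crossedCounit = 1
  map_mul : ∀ ξ η, Λ (doublingMul ξ η) = Λ ξ * Λ η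
  map_star : ∀ ξ, Λ (doublingStar θ ξ) = star (Λ ξ)
  map_comul : ∀ ξ, 𝔾.comul (Λ ξ) =
    toMin A A (TensorProduct.map Λ.toLinearMap Λ.toLinearMap (doublingComul θ ξ))

end Doubling

section SymmetricGroup

/-- The nearest-neighbour transpositions `s_1, …, s_{n-1}` of the symmetric group `S_n`; the
generator `s_{i+1}` has index `i : Fin (n - 1)`, so that `s_j ↦ s_{n-j}` is `Fin.rev` on indices. -/
def transp {n : ℕ} (i : Fin (n - 1)) : Equiv.Perm (Fin n) :=
  Equiv.swap ⟨i, by omega⟩ ⟨i + 1, by omega⟩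

/-- The set of the nearest-neighbour transpositions. -/
abbrev transpSet (n : ℕ) : Set (Equiv.Perm (Fin n)) := Set.range transp

/-- The generators as elements of the group algebra. -/
def sGen {n : ℕ} (i : Fin (n - 1)) : MonoidAlgebra ℂ (Equiv.Perm (Fin n)) :=
  MonoidAlgebra.single (transp i) 1

/-- The generators in the first copy of `ℂ[S_n]` inside `ℂ[S_n] ⊕ ℂ[S_n]`. -/
def sigmaGen {n : ℕ} (i : Fin (n - 1)) :
    MonoidAlgebra ℂ (Equiv.Perm (Fin n)) × MonoidAlgebra ℂ (Equiv.Perm (Fin n)) := (sGen i, 0)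

/-- The generators in the second copy of `ℂ[S_n]` inside `ℂ[S_n] ⊕ ℂ[S_n]`. -/
def tauGen {n : ℕ} (i : Fin (n - 1)) :
    MonoidAlgebra ℂ (Equiv.Perm (Fin n)) × MonoidAlgebra ℂ (Equiv.Perm (Fin n)) := (0, sGen i)

/-- The automorphism of `ℂ[S_n]` with `s_i ↦ s_{n-i}`, given by conjugation with the longest element
`k ↦ n + 1 - k` of `S_n`. -/
def flip (n : ℕ) :
    MonoidAlgebra ℂ (Equiv.Perm (Fin n)) →ₐc[ℂ] MonoidAlgebra ℂ (Equiv.Perm (Fin n)) :=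
  MonoidAlgebra.mapDomainBialgHom ℂ (MulAut.conj (Fin.revPerm : Equiv.Perm (Fin n))).toMonoidHom

theorem flip_sGen {n : ℕ} (i : Fin (n - 1)) : flip n (sGen i) = sGen i.rev := by
  have h : MulAut.conj (Fin.revPerm : Equiv.Perm (Fin n)) (transp i) = transp i.rev := by
    rw [MulAut.conj_apply, transp, Equiv.mul_swap_eq_swap_mul, mul_assoc, mul_inv_cancel, mul_one,
      Equiv.swap_comm]
    congr 1 <;> ext <;> simp [Fin.val_rev] <;> omega
  simp [flip, sGen, h]

/-- The coaction maps the span of the elements of length one into `span ⊗ A`. -/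
def PreservesLengthOne {n : ℕ} {A : Type*} [CStarAlgebra A]
    (α : MonoidAlgebra ℂ (Equiv.Perm (Fin n)) →⋆ₐ[ℂ]
      MonoidAlgebra ℂ (Equiv.Perm (Fin n)) ⊗[ℂ] A) : Prop :=
  ∀ j : Fin (n - 1), ∃ u : Fin (n - 1) → A, α (sGen j) = ∑ i, sGen i ⊗ₜ u i

/-- The coaction preserves the canonical trace on products of two generators:
`(τ ⊗ id) α(s_k s_l)` is `1` if `k = l` and `0` otherwise. -/
def PreservesTraceZeroTwo {n : ℕ} {A : Type*} [CStarAlgebra A]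
    (α : MonoidAlgebra ℂ (Equiv.Perm (Fin n)) →⋆ₐ[ℂ]
      MonoidAlgebra ℂ (Equiv.Perm (Fin n)) ⊗[ℂ] A) : Prop :=
  ∀ k l : Fin (n - 1), slice 1 (α (sGen k * sGen l)) = if k = l then (1 : A) else 0

end SymmetricGroup

end QIso

end

/-! Write `α(s_j) = ∑ s_i ⊗ u i j`. An isometric coaction has this form because it commutes with the
length operator, whose eigenspace for the eigenvalue 1 is spanned by the generators. The entries `u
i j` are self-adjoint, and the trace condition on products of two generators says that the columns
of `u` are orthonormal. These data already force `u` to be supported on the diagonal and the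
antidiagonal.

Positivity does the work of an antipode. The defect `1 - X Xᴴ` of an isometric matrix with
self-adjoint entries is a projection whose diagonal sum vanishes, so the matrix is unitary. The same
trace argument applies to `u ⊗ u`, whose entrywise adjoint only permutes its entries: an invariant
subspace has an invariant complement (`block_diagonal_of_block_triangular`). Hence the column
relations expressing that `α(s_j s_l)` depends only on the group element `s_j s_l` also hold for
rows (`fibreUnitary_of_columns`).

A product `s_i s_k` of adjacent generators determines the ordered pair, and a product of distinct
commuting ones determines it up to order. This turns the relations into `u i j * u k l = 0` unless
adjacency of `i, k` and of `j, l` agree (`FibreUnitary.pathUnitary`), as for a quantum symmetry of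
the path with `n - 1` vertices, but with self-adjoint entries instead of projections. An end of the
path has one neighbour and an interior vertex has two, so the first row vanishes off its two ends;
moving along the path one finds that `u` is diagonal under `p = u o o * u o o` and antidiagonal
under `1 - p`, with `o` the first index. The path relations do not suffice in two places, the path
with three vertices and the central vertex for even `n`; there the braid relation is used
(`braid_coefficient`).

Cutting `α` by `p` and `1 - p` makes it act on group elements by `g ↦ g` and by `g ↦ θ(g)`. So `α`
comes from a homomorphism `Φ` on two copies of the group algebra (`exists_intertwines`), and it is
isometric since `θ` preserves length. As `θ` is nontrivial, `Φ` is unique and respects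
comultiplications. The formulas for `Δ` and the coaction define a compact quantum group on two
copies of the group algebra, which is therefore universal; any other universal object is isomorphic
to it. Biduality identifies it with the dual of the crossed product. -/

noncomputable section

namespace QIso

/-! ### Trace arguments for matrices over a C⋆-algebra -/

section SymmetricMatrices

variable {A : Type*} [CStarAlgebra A]
variable {K : Type*} [Fintype K]

open Matrix

/-- The diagonal sum is not cyclic over a noncommutative algebra. Here the two sums consist of the
products `X a b * X (σ a) (σ b)` and of the same products in reversed order, and reindexing by `σ`
exchanges them. -/
theorem trace_mul_conjTranspose_comm {X : Matrix K K A} {σ : K → K}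
    (hσ : Function.Involutive σ) (hX : ∀ a b, star (X a b) = X (σ a) (σ b)) :
    (X * Xᴴ).trace = (Xᴴ * X).trace := by
  simp only [trace, diag_apply, mul_apply, conjTranspose_apply, hX]
  rw [Finset.sum_comm]
  refine Fintype.sum_equiv hσ.toPerm _ _ fun a => Fintype.sum_equiv hσ.toPerm _ _ fun b => ?_
  simp [hσ a, hσ b]

/-- Averaging over the fibres of a map. -/
def fibreAverage {X : Type*} [DecidableEq X] (π : K → X) : Matrix K K ℂ := fun a b =>
  if π a = π b then ((Finset.univ.filter fun c => π c = π a).card : ℂ)⁻¹ else 0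

theorem fibreAverage_mul_self {X : Type*} [DecidableEq X] (π : K → X) :
    fibreAverage π * fibreAverage π = fibreAverage π := by
  ext a b
  simp only [mul_apply, fibreAverage]
  by_cases hab : π a = π b
  · rw [if_pos hab]
    have : ∀ c, (if π a = π c then ((Finset.univ.filter fun d => π d = π a).card : ℂ)⁻¹ else 0) *
        (if π c = π b then ((Finset.univ.filter fun d => π d = π c).card : ℂ)⁻¹ else 0) =
        if π c = π a then (((Finset.univ.filter fun d => π d = π a).card : ℂ)⁻¹) ^ 2 else 0 := by
      intro c
      by_cases hc : π c = π a
      · simp [hc, hab, sq]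
      · simp [hc, Ne.symm hc]
    rw [Finset.sum_congr rfl fun c _ => this c, ← Finset.sum_filter, Finset.sum_const, nsmul_eq_mul]
    have : ((Finset.univ.filter fun d => π d = π a).card : ℂ) ≠ 0 := by
      rw [Nat.cast_ne_zero, ← Nat.pos_iff_ne_zero, Finset.card_pos]
      exact ⟨a, by simp⟩
    field_simp
  · rw [if_neg hab]
    refine Finset.sum_eq_zero fun c _ => ?_
    by_cases hc : π a = π c
    · rw [if_neg (fun h => hab (hc.trans h)), mul_zero]
    · rw [if_neg hc, zero_mul]

theorem fibreAverage_mul_apply {X : Type*} [DecidableEq X] (π : K → X) (W : Matrix K K A)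
    (a b : K) : ((fibreAverage π).map (algebraMap ℂ A) * W) a b =
      ((Finset.univ.filter fun c => π c = π a).card : ℂ)⁻¹ •
        ∑ c with π c = π a, W c b := by
  simp only [mul_apply, map_apply, fibreAverage, Finset.smul_sum, Finset.sum_filter]
  refine Finset.sum_congr rfl fun c _ => ?_
  by_cases hc : π c = π a
  · simp [hc, Algebra.smul_def]
  · simp [hc, Ne.symm hc]

theorem mul_fibreAverage_apply {X : Type*} [DecidableEq X] (π : K → X) (W : Matrix K K A)
    (a b : K) : (W * (fibreAverage π).map (algebraMap ℂ A)) a b =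
      ((Finset.univ.filter fun c => π c = π b).card : ℂ)⁻¹ •
        ∑ c with π c = π b, W a c := by
  simp only [mul_apply, map_apply, fibreAverage, Finset.smul_sum, Finset.sum_filter]
  refine Finset.sum_congr rfl fun c _ => ?_
  by_cases hc : π c = π b
  · simp [hc, Algebra.smul_def, Algebra.commutes]
  · simp [hc]

theorem fibreAverage_card_ne_zero {X : Type*} [DecidableEq X] (π : K → X) (a : K) :
    ((Finset.univ.filter fun c => π c = π a).card : ℂ) ≠ 0 := by
  rw [Nat.cast_ne_zero, ← Nat.pos_iff_ne_zero, Finset.card_pos]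
  exact ⟨a, by simp⟩

variable [PartialOrder A] [StarOrderedRing A]

/-- The trace is a sum of the positive elements `X a b * star (X a b)`, so each of them vanishes.
This faithfulness is what the two unitarity arguments below rest on. -/
theorem matrix_eq_zero_of_trace_mul_conjTranspose {X : Matrix K K A}
    (h : (X * Xᴴ).trace = 0) : X = 0 := by
  have hnn : ∀ a b, 0 ≤ X a b * star (X a b) := fun a b => mul_star_self_nonneg _
  simp only [trace, diag_apply, mul_apply, conjTranspose_apply] at h
  ext a b
  rw [Finset.sum_eq_zero_iff_of_nonneg fun a _ => Finset.sum_nonneg fun b _ => hnn a b] at h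
  have := h a (Finset.mem_univ _)
  rw [Finset.sum_eq_zero_iff_of_nonneg fun b _ => hnn a b] at this
  exact CStarRing.mul_star_self_eq_zero_iff _ |>.mp (this b (Finset.mem_univ _))

/-- An isometric matrix with self-adjoint entries is unitary. -/
theorem mul_conjTranspose_eq_one_of_selfAdjoint [DecidableEq K] {X : Matrix K K A}
    (hX : ∀ a b, IsSelfAdjoint (X a b)) (h : Xᴴ * X = 1) : X * Xᴴ = 1 := by
  -- The defect of an isometry is a projection, so its trace is the trace of a positive square.
  have hE : (1 - X * Xᴴ) * (1 - X * Xᴴ)ᴴ = 1 - X * Xᴴ := by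
    have : X * Xᴴ * (X * Xᴴ) = X * Xᴴ := by
      rw [Matrix.mul_assoc, ← Matrix.mul_assoc Xᴴ, h, Matrix.one_mul]
    simp only [conjTranspose_sub, conjTranspose_mul, conjTranspose_conjTranspose,
      conjTranspose_one, mul_sub, sub_mul, this, Matrix.mul_one, Matrix.one_mul]
    abel
  have : (1 - X * Xᴴ : Matrix K K A) = 0 := by
    apply matrix_eq_zero_of_trace_mul_conjTranspose
    rw [hE, trace_sub,
      trace_mul_conjTranspose_comm (σ := id) (fun _ => rfl) (fun a b => (hX a b).star_eq), h,
      sub_self]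
  exact (sub_eq_zero.mp this).symm

/-- If a unitary matrix with a reality property is block triangular with respect to a real
projection, then it is block diagonal. -/
theorem block_diagonal_of_block_triangular [DecidableEq K] {W : Matrix K K A}
    (h₁ : Wᴴ * W = 1) (h₂ : W * Wᴴ = 1) {σ : K → K} (hσ : Function.Involutive σ)
    (hW : ∀ a b, star (W a b) = W (σ a) (σ b)) {P : Matrix K K ℂ} (hP : P * P = P)
    (hPt : Pᵀ = P) (hPr : ∀ a b, star (P a b) = P a b)
    (hPσ : ∀ a b, P (σ a) (σ b) = P a b)
    (h : (1 - P.map (algebraMap ℂ A)) * W * P.map (algebraMap ℂ A) = 0) :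
    P.map (algebraMap ℂ A) * W * (1 - P.map (algebraMap ℂ A)) = 0 := by
  set Q : Matrix K K A := P.map (algebraMap ℂ A) with hQ
  have hQQ : Q * Q = Q := by rw [hQ, ← Matrix.map_mul, hP]
  have hQs : ∀ a b, star (Q a b) = Q a b := fun a b => by
    simp only [hQ, map_apply]
    rw [← algebraMap_star_comm, hPr]
  have hQt : Qᴴ = Q := by
    ext a b
    rw [conjTranspose_apply, hQs]
    simp only [hQ, map_apply]
    rw [← transpose_apply P, hPt]
  have hQσ : ∀ a b, Q (σ a) (σ b) = Q a b := fun a b => by simp only [hQ, map_apply, hPσ]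
  have hQc : ∀ a b (x : A), Q a b * x = x * Q a b := fun a b x => Algebra.commutes _ _
  -- The entries of `Q` are real scalars, hence central, so compressing by `Q` preserves the reality
  -- property.
  have hX : ∀ a b, star ((Q * W * Q) a b) = (Q * W * Q) (σ a) (σ b) := fun a b => by
    simp only [mul_apply, star_sum, star_mul, hQs, Finset.sum_mul, hW]
    refine Fintype.sum_equiv hσ.toPerm _ _ fun c => Fintype.sum_equiv hσ.toPerm _ _ fun d => ?_
    simp only [Function.Involutive.coe_toPerm, hQσ]
    rw [hQc, ← hQc a d]
  have hQW : W * Q = Q * W * Q := by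
    rw [sub_mul, sub_mul, sub_eq_zero, Matrix.one_mul] at h
    exact h
  apply matrix_eq_zero_of_trace_mul_conjTranspose
  -- By triangularity the corner `Q * W * Q` is an isometry of the `Q` block (`e₂`). The block that
  -- should vanish measures its failure to be unitary there, and the trace of this failure is zero.
  have e₁ : (Q * W * (1 - Q)) * (Q * W * (1 - Q))ᴴ = Q - (Q * W * Q) * (Q * W * Q)ᴴ := by
    have : (1 - Q) * (1 - Q) = 1 - Q := by
      simp only [mul_sub, sub_mul, hQQ, Matrix.mul_one, Matrix.one_mul]; abel
    have hq : (1 - Q)ᴴ = 1 - Q := by rw [conjTranspose_sub, conjTranspose_one, hQt]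
    calc _ = Q * W * ((1 - Q) * (1 - Q)) * Wᴴ * Q := by
            simp only [conjTranspose_mul, hq, hQt, Matrix.mul_assoc]
      _ = Q * (W * Wᴴ) * Q - Q * W * (Q * Q) * Wᴴ * Q := by
            rw [this, hQQ]
            simp only [Matrix.mul_sub, Matrix.sub_mul, Matrix.mul_one, Matrix.mul_assoc]
      _ = _ := by
            rw [h₂, Matrix.mul_one, hQQ]
            simp only [conjTranspose_mul, hQt, ← Matrix.mul_assoc]
            simp only [Matrix.mul_assoc _ Q Q, hQQ]
  have e₂ : (Q * W * Q)ᴴ * (Q * W * Q) = Q := by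
    calc _ = (W * Q)ᴴ * (W * Q) := by rw [← hQW]
      _ = Q * (Wᴴ * W) * Q := by simp only [conjTranspose_mul, hQt, Matrix.mul_assoc]
      _ = Q := by rw [h₁, Matrix.mul_one, hQQ]
  rw [e₁, trace_sub, trace_mul_conjTranspose_comm hσ hX, e₂, sub_self]

/-- If the sums of a unitary matrix with a reality property over the fibres of `π` in each column
only depend on the fibre of the column, then the same holds with rows and columns exchanged. -/
theorem fibre_row_sums_of_fibre_column_sums [DecidableEq K] {W : Matrix K K A}
    (h₁ : Wᴴ * W = 1) (h₂ : W * Wᴴ = 1) {σ : K → K} (hσ : Function.Involutive σ)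
    (hW : ∀ a b, star (W a b) = W (σ a) (σ b))
    {X : Type*} [DecidableEq X] (π : K → X) (hπ : ∀ a b, π (σ a) = π (σ b) ↔ π a = π b)
    (h : ∀ x b b', π b = π b' → ∑ c with π c = x, W c b = ∑ c with π c = x, W c b')
    (x : X) (a a' : K) (haa : π a = π a') :
    ∑ c with π c = x, W a c = ∑ c with π c = x, W a' c := by
  set Q := fibreAverage π with hQ
  set Q' : Matrix K K A := Q.map (algebraMap ℂ A) with hQ'
  have hcard : ∀ a, (Finset.univ.filter fun c => π c = π (σ a)).card =
      (Finset.univ.filter fun c => π c = π a).card := fun a => by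
    refine Finset.card_bij' (fun c _ => σ c) (fun c _ => σ c) ?_ ?_ ?_ ?_
    · intro c hc
      simp only [Finset.mem_filter, Finset.mem_univ, true_and] at hc ⊢
      rwa [← hπ, hσ c]
    · intro c hc
      simp only [Finset.mem_filter, Finset.mem_univ, true_and] at hc ⊢
      rwa [hπ]
    · exact fun c _ => hσ c
    · exact fun c _ => hσ c
  -- The column hypothesis says that each row of `Q' * W` is constant on fibres, which is block
  -- triangularity.
  have hQW : Q' * W * Q' = Q' * W := by
    ext a b
    rw [hQ', hQ, mul_fibreAverage_apply]
    have : ∀ c ∈ Finset.univ.filter (fun c => π c = π b),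
        ((fibreAverage π).map (algebraMap ℂ A) * W) a c =
          ((fibreAverage π).map (algebraMap ℂ A) * W) a b := fun c hc => by
      rw [fibreAverage_mul_apply, fibreAverage_mul_apply, h _ c b (by simpa using hc)]
    rw [Finset.sum_congr rfl this, Finset.sum_const, ← Nat.cast_smul_eq_nsmul ℂ, smul_smul,
      inv_mul_cancel₀ (fibreAverage_card_ne_zero π b), one_smul]
  have hP : (1 - Q).map (algebraMap ℂ A) = 1 - Q' := by
    rw [Matrix.map_sub _ (map_sub _), Matrix.map_one _ (map_zero _) (map_one _)]
  -- The roles are taken by `1 - Q`: from `Q' * W * (1 - Q') = 0` one gets `(1 - Q') * W * Q' = 0`,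
  -- the row statement.
  have key := block_diagonal_of_block_triangular h₁ h₂ hσ hW (P := 1 - Q)
    (by simp only [mul_sub, sub_mul, hQ, fibreAverage_mul_self, Matrix.mul_one, Matrix.one_mul]
        abel)
    (by
      rw [transpose_sub, transpose_one]
      congr 1
      ext a b
      simp only [hQ, fibreAverage, transpose_apply]
      by_cases hab : π a = π b
      · simp [hab]
      · simp [hab, Ne.symm hab])
    (fun a b => by
      simp only [Matrix.sub_apply, hQ, fibreAverage, Matrix.one_apply, star_sub]
      split_ifs <;> simp)
    (fun a b => by
      simp only [Matrix.sub_apply, hQ, fibreAverage, Matrix.one_apply, hπ, hcard,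
        hσ.injective.eq_iff])
    (by
      rw [hP, sub_sub_cancel, Matrix.mul_sub, Matrix.mul_one, hQW, sub_self])
  rw [hP, sub_sub_cancel, Matrix.sub_mul, Matrix.sub_mul, Matrix.one_mul, sub_eq_zero] at key
  by_cases hx : ∃ b, π b = x
  · obtain ⟨b, rfl⟩ := hx
    have e : (W * Q') a b = (W * Q') a' b := by
      rw [key, Matrix.mul_assoc, hQ', hQ, fibreAverage_mul_apply, fibreAverage_mul_apply, haa]
    rw [hQ', hQ, mul_fibreAverage_apply, mul_fibreAverage_apply] at e
    exact smul_right_injective A (inv_ne_zero (fibreAverage_card_ne_zero π b)) e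
  · push Not at hx
    simp [hx]

end SymmetricMatrices

/-! ### Self-adjoint quantum symmetries of a path -/

section PathUnitary

variable {A : Type*} [CStarAlgebra A] {m : ℕ}

/-- Adjacency of vertices of the path with `m` vertices. -/
def Adjacent (i k : Fin m) : Prop := i.val + 1 = k.val ∨ k.val + 1 = i.val

theorem Adjacent.symm {i k : Fin m} (h : Adjacent i k) : Adjacent k i := Or.symm h

theorem adjacent_rev {i k : Fin m} : Adjacent i.rev k.rev ↔ Adjacent i k := by
  simp only [Adjacent, Fin.val_rev]
  omega

theorem not_adjacent_self (i : Fin m) : ¬ Adjacent i i := by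
  simp [Adjacent]

/-- A matrix with self-adjoint entries whose rows and columns have square sum `1` and whose entries
are orthogonal unless their row indices and their column indices are related in the same way in the
path graph. -/
structure PathUnitary (u : Fin m → Fin m → A) : Prop where
  selfAdjoint : ∀ i j, star (u i j) = u i j
  row_sq : ∀ i, ∑ j, u i j * u i j = 1
  col_sq : ∀ j, ∑ i, u i j * u i j = 1
  orthogonal : ∀ i j k l, ¬ (Adjacent i k ↔ Adjacent j l) → u i j * u k l = 0

theorem mul_self_mul_eq_zero_iff {x y : A} (hx : star x = x) : x * x * y = 0 ↔ x * y = 0 := by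
  refine ⟨fun h => ?_, fun h => by rw [mul_assoc, h, mul_zero]⟩
  rw [← CStarRing.star_mul_self_eq_zero_iff, star_mul, hx, mul_assoc, ← mul_assoc x, h, mul_zero]

theorem mul_eq_zero_symm {x y : A} (hx : star x = x) (hy : star y = y) (h : x * y = 0) :
    y * x = 0 := by
  rw [← hx, ← hy, ← star_mul, h, star_zero]

namespace PathUnitary

variable {u : Fin m → Fin m → A}

theorem transpose (hu : PathUnitary u) : PathUnitary fun i j => u j i where
  selfAdjoint i j := hu.selfAdjoint j i
  row_sq := hu.col_sq
  col_sq := hu.row_sq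
  orthogonal _ _ _ _ h := hu.orthogonal _ _ _ _ fun h' => h h'.symm

theorem reverse (hu : PathUnitary u) : PathUnitary fun i j => u i j.rev where
  selfAdjoint i j := hu.selfAdjoint i _
  row_sq i := by
    rw [← hu.row_sq i]
    exact Fintype.sum_equiv Fin.revPerm _ _ fun j => rfl
  col_sq j := hu.col_sq _
  orthogonal _ _ _ _ h := hu.orthogonal _ _ _ _ (by rwa [adjacent_rev])

theorem swap (hu : PathUnitary u) {i j k l : Fin m} (h : u i j * u k l = 0) : u k l * u i j = 0 :=
  mul_eq_zero_symm (hu.selfAdjoint i j) (hu.selfAdjoint k l) h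

/-- Expanding `1` as the square sum of row `k` leaves a single term. This is how an entry is moved
along the path. -/
theorem eq_mul_row (hu : PathUnitary u) {x : A} {k l : Fin m} (h : ∀ l', l' ≠ l → x * u k l' = 0) :
    x * (u k l * u k l) = x := by
  conv_rhs => rw [← mul_one x, ← hu.row_sq k, Finset.mul_sum]
  rw [Finset.sum_eq_single l]
  · intro l' _ hl
    rw [← mul_assoc, h l' hl, zero_mul]
  · simp

/-- A count of neighbours. The vertex `o` has only the neighbour `1`, so for each neighbour `c` of
`j` the column sum at `c` gives `u o j * u 1 c ^ 2 = u o j`. Row `1` is supported, after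
multiplication by `u o j`, on the two neighbours of `j`, so `u o j = 2 * u o j`. -/
theorem first_interior (hu : PathUnitary u) {o j : Fin m} (ho : o.val = 0) (h₁ : 0 < j.val)
    (h₂ : j.val + 1 < m) :
    u o j = 0 := by
  set i : Fin m := ⟨1, by omega⟩
  set a : Fin m := ⟨j.val - 1, by omega⟩
  set b : Fin m := ⟨j.val + 1, h₂⟩
  have key : ∀ c, Adjacent j c → u o j * (u i c * u i c) = u o j := fun c hc => by
    refine hu.transpose.eq_mul_row (k := c) (l := i) fun k hk => hu.orthogonal _ _ _ _ fun h => ?_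
    have := h.mpr hc
    simp only [Adjacent, ho] at this
    exact hk (Fin.ext (by change k.val = 1; omega))
  have ha : Adjacent j a := Or.inr (by change j.val - 1 + 1 = _; omega)
  have hb : Adjacent j b := Or.inl rfl
  have hab : a ≠ b := fun h => by
    have := congrArg Fin.val h
    change j.val - 1 = j.val + 1 at this
    omega
  have e : u o j = u o j * (u i a * u i a) + u o j * (u i b * u i b) := by
    conv_lhs => rw [← mul_one (u o j), ← hu.row_sq i, Finset.mul_sum]
    refine Fintype.sum_eq_add a b hab fun l hl => ?_
    rw [← mul_assoc, hu.orthogonal, zero_mul]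
    intro h
    have := h.mp (Or.inl (by rw [ho]))
    rcases this with h | h
    · exact hl.2 (Fin.ext h.symm)
    · exact hl.1 (Fin.ext (by change l.val = j.val - 1; omega))
  rw [key a ha, key b hb] at e
  simpa using e

/-- Induction along the path. For `1 < i < j` and `k = i - 1`, the induction hypothesis and
`first_interior` give `u o o = u o o * u k k ^ 2`, and `u k k * u i j = 0` because `k` is adjacent
to `i` but not to `j`. The case `j < i` follows by transposition. -/
theorem first_mul (hu : PathUnitary u) {o : Fin m} (ho : o.val = 0) {i j : Fin m} (hi : 0 < i.val)
    (hj : 0 < j.val) (hij : i ≠ j) : u o o * u i j = 0 := by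
  obtain ⟨d, hd⟩ : ∃ d, d = min i.val j.val := ⟨_, rfl⟩
  induction d using Nat.strong_induction_on generalizing u i j with
  | _ d ih =>
  wlog hlt : i < j generalizing u i j
  · exact this hu.transpose hj hi hij.symm (by rw [hd, min_comm])
      (lt_of_le_of_ne (not_lt.mp hlt) hij.symm)
  have hji : i.val < j.val := hlt
  by_cases hi1 : i.val = 1
  · refine hu.orthogonal _ _ _ _ fun h => ?_
    have := h.mp (Or.inl (by omega))
    simp only [Adjacent] at this
    omega
  set k : Fin m := ⟨i.val - 1, by omega⟩
  have hk : k.val = i.val - 1 := rfl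
  have hz : ∀ l, l ≠ k → u o o * u k l = 0 := fun l hl => by
    by_cases h0 : l.val = 0
    · have : u k l = 0 := hu.transpose.first_interior h0 (by omega) (by omega)
      rw [this, mul_zero]
    · exact ih (min k.val l.val) (by omega) hu (by omega) (by omega) hl.symm rfl
  rw [← hu.eq_mul_row hz, mul_assoc, mul_assoc, hu.orthogonal k k i j, mul_zero, mul_zero]
  simp only [Adjacent]
  omega

/-- Again `u o o = u o o * u 1 1 ^ 2`, and `1` is adjacent to the first vertex but not to the last.
With three vertices it is adjacent to both, and the path relations give nothing. -/
theorem first_mul_first_last (hu : PathUnitary u) {o : Fin m} (ho : o.val = 0) (h1 : 1 < m) (h3 : m ≠ 3) :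
    u o o * u o o.rev = 0 := by
  by_cases h2 : m = 2
  · refine hu.orthogonal _ _ _ _ ?_
    simp only [Adjacent, Fin.val_rev]
    omega
  set k : Fin m := ⟨1, by omega⟩
  have hk : k.val = 1 := rfl
  have hz : ∀ l, l ≠ k → u o o * u k l = 0 := fun l hl => by
    refine hu.orthogonal _ _ _ _ fun h => hl (Fin.ext ?_)
    have := h.mp (Or.inl (by omega))
    simp only [Adjacent] at this
    omega
  rw [← hu.eq_mul_row hz, mul_assoc, mul_assoc, hu.orthogonal k k o o.rev, mul_zero, mul_zero]
  simp only [Adjacent, Fin.val_rev]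
  omega

theorem first_row_sq (hu : PathUnitary u) {o : Fin m} (ho : o.val = 0) (h1 : 1 < m) :
    u o o * u o o + u o o.rev * u o o.rev = 1 := by
  rw [← hu.row_sq o]
  symm
  refine Fintype.sum_eq_add o o.rev ?_ fun l hl => ?_
  · intro h
    have := congrArg Fin.val h
    simp only [Fin.val_rev] at this
    omega
  · rw [hu.first_interior ho, mul_zero]
    · have : l.val ≠ o.val := fun h => hl.1 (Fin.ext h)
      omega
    · have : l.val ≠ o.rev.val := fun h => hl.2 (Fin.ext h)
      rw [Fin.val_rev] at this
      omega

/-- The first row and the first column share the entry `u o o`, so comparing their square sums shows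
that the two corner entries `u o.rev o` and `u o o.rev` have equal squares. -/
theorem first_mul_last_first (hu : PathUnitary u) {o : Fin m} (ho : o.val = 0) (h1 : 1 < m)
    (h : u o o * u o o.rev = 0) : u o o * u o.rev o = 0 := by
  have e₁ := hu.first_row_sq ho h1
  have e₂ := hu.transpose.first_row_sq ho h1
  have e₃ : u o.rev o * u o.rev o = u o o.rev * u o o.rev :=
    add_left_cancel (e₂.trans e₁.symm)
  refine mul_eq_zero_symm (hu.selfAdjoint _ _) (hu.selfAdjoint _ _) ?_
  rw [← mul_self_mul_eq_zero_iff (hu.selfAdjoint _ _), e₃, mul_assoc, hu.swap h, mul_zero]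

theorem first_mul_eq_zero (hu : PathUnitary u) {o : Fin m} (ho : o.val = 0) (h1 : 1 < m)
    (h : u o o * u o o.rev = 0) {i j : Fin m} (hij : i ≠ j) : u o o * u i j = 0 := by
  have aux : ∀ {v : Fin m → Fin m → A} (hv : PathUnitary v) (h : v o o * v o o.rev = 0)
      {i j : Fin m}, i ≠ j → i.val = 0 → v o o * v i j = 0 := fun {v} hv h {i j} hij hi => by
    obtain rfl : i = o := Fin.ext (by omega)
    by_cases hj : j = i.rev
    · rw [hj, h]
    · have h₁ : i.val ≠ j.val := fun h => hij (Fin.ext h)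
      have h₂ : j.val ≠ i.rev.val := fun h => hj (Fin.ext h)
      rw [Fin.val_rev] at h₂
      rw [hv.first_interior (j := j) ho, mul_zero] <;> omega
  by_cases hi : i.val = 0
  · exact aux hu h hij hi
  by_cases hj : j.val = 0
  · exact aux hu.transpose (hu.first_mul_last_first ho h1 h) hij.symm hj
  · exact hu.first_mul ho (by omega) (by omega) hij

theorem last_mul_eq_zero (hu : PathUnitary u) {o : Fin m} (ho : o.val = 0) (h1 : 1 < m)
    (h : u o o * u o o.rev = 0) {i j : Fin m} (hij : j ≠ i.rev) : u o o.rev * u i j = 0 := by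
  have := hu.reverse.first_mul_eq_zero ho h1 (by simpa using hu.swap h) (i := i) (j := j.rev)
    (fun h => hij (by rw [h, Fin.rev_rev]))
  simpa using this

/-- Insert `1 = u o o ^ 2 + u o o.rev ^ 2`: the first summand annihilates everything off the
diagonal, the second everything off the antidiagonal. -/
theorem apply_eq_zero (hu : PathUnitary u) {o : Fin m} (ho : o.val = 0) (h1 : 1 < m)
    (h : u o o * u o o.rev = 0) {i j : Fin m} (hij : i ≠ j) (hij' : j ≠ i.rev) :
    u i j = 0 := by
  rw [← one_mul (u i j), ← hu.first_row_sq ho h1, add_mul, mul_assoc, mul_assoc,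
    hu.first_mul_eq_zero ho h1 h hij, hu.last_mul_eq_zero ho h1 h hij', mul_zero, mul_zero,
    add_zero]

theorem first_sq_idempotent (hu : PathUnitary u) {o : Fin m} (ho : o.val = 0) (h1 : 1 < m)
    (h : u o o * u o o.rev = 0) : u o o * u o o * (u o o * u o o) = u o o * u o o := by
  have e : u o o * u o o * (u o o * u o o + u o o.rev * u o o.rev) = u o o * u o o := by
    rw [hu.first_row_sq ho h1, mul_one]
  rwa [mul_add, mul_assoc (u o o) (u o o) (u o o.rev * u o o.rev), ← mul_assoc (u o o) (u o o.rev),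
    h, zero_mul, mul_zero, add_zero] at e

/-- An off-centre diagonal entry squares to the projection given by the first entry. -/
theorem diagonal_sq (hu : PathUnitary u) {o : Fin m} (ho : o.val = 0) (h1 : 1 < m)
    (h : u o o * u o o.rev = 0) {i : Fin m} (hi : i ≠ i.rev) :
    u i i * u i i = u o o * u o o := by
  have e₁ : u i i * u i i + u i i.rev * u i i.rev = 1 := by
    rw [← hu.row_sq i]
    symm
    exact Fintype.sum_eq_add i i.rev hi fun l hl => by
      rw [hu.apply_eq_zero ho h1 h hl.1.symm hl.2, mul_zero]
  have e₂ := hu.first_row_sq ho h1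
  -- The projection `p = u o o * u o o` satisfies `p * u i i ^ 2 = p`, because `u o o` kills the
  -- antidiagonal entry of row `i`; and `(1 - p) * u i i ^ 2 = 0`, because `u o o.rev` kills `u i
  -- i`.
  have e₃ : u o o * u o o * (u i i * u i i) = u o o * u o o := by
    conv_rhs => rw [← mul_one (u o o * u o o), ← e₁, mul_add]
    rw [mul_assoc (u o o) (u o o) (u i i.rev * _), ← mul_assoc (u o o) (u i i.rev),
      hu.first_mul_eq_zero ho h1 h hi, zero_mul, mul_zero, add_zero]
  rw [← e₃]
  conv_lhs => rw [← one_mul (u i i * u i i), ← e₂, add_mul]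
  rw [mul_assoc (u o o.rev), ← mul_assoc (u o o.rev) (u i i), hu.last_mul_eq_zero ho h1 h hi,
    zero_mul, mul_zero, add_zero]

/-- The projection given by the first entry commutes with all entries, provided that it is reduced
by the central entry. -/
theorem first_sq_commute (hu : PathUnitary u) {o : Fin m} (ho : o.val = 0) (h1 : 1 < m)
    (h : u o o * u o o.rev = 0)
    (hc : ∀ c : Fin m, c = c.rev → u o o * u o o * u c c * (1 - u o o * u o o) = 0)
    (i j : Fin m) : Commute (u o o * u o o) (u i j) := by
  have hp : star (u o o * u o o) = u o o * u o o := by rw [star_mul, hu.selfAdjoint]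
  rw [commute_iff_eq]
  by_cases hij : i = j
  · subst hij
    -- Half of the commutation is enough, since the adjoint of this identity is the other half. Off
    -- the centre, `1 - p = u o o.rev ^ 2` annihilates `u i i`.
    have e : u o o * u o o * u i i = u o o * u o o * u i i * (u o o * u o o) := by
      by_cases hi : i = i.rev
      · have := hc i hi
        rwa [mul_sub, mul_one, sub_eq_zero] at this
      · have : u o o.rev * u i i = 0 := hu.last_mul_eq_zero ho h1 h hi
        conv_lhs => rw [← mul_one (u o o * u o o * u i i), ← hu.first_row_sq ho h1]
        rw [mul_add, mul_assoc _ (u i i) (u o o.rev * _), ← mul_assoc (u i i) (u o o.rev),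
          hu.swap this, zero_mul, mul_zero, add_zero]
    have e' := congrArg star e
    simp only [star_mul, hu.selfAdjoint] at e'
    rw [e, mul_assoc (u o o), mul_assoc (u o o), e', ← mul_assoc, ← mul_assoc]
    simp only [mul_assoc]
  · have := hu.first_mul_eq_zero ho h1 h hij
    rw [mul_assoc, this, mul_zero, ← mul_assoc, hu.swap this, zero_mul]

end PathUnitary

/-- The commutation needed for the central vertex of the path with three vertices. -/
theorem mul_eq_zero_of_separated {x x' y : A} (hx : star x = x)
    (hx' : star x' = x') (hy : star y = y) (hsq : x * x + x' * x' = 1) (hyy : y * y = 1)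
    (h : x * y * x' = 0) : x * x' = 0 := by
  have h' : x' * y * x = 0 := by
    have := congrArg star h
    simpa only [star_mul, hx, hx', hy, star_zero, ← mul_assoc] using this
  have hx1 : x' * x' = 1 - x * x := by rw [← hsq]; abel
  have e₁ : x * x * y * (x' * x') = 0 := by
    rw [show x * x * y * (x' * x') = x * (x * y * x') * x' by simp only [mul_assoc], h]; simp
  have e₂ : x' * x' * y * (x * x) = 0 := by
    rw [show x' * x' * y * (x * x) = x' * (x' * y * x) * x by simp only [mul_assoc], h']; simp
  rw [hx1] at e₁ e₂
  -- Both `x² y (1 - x²)` and `(1 - x²) y x²` vanish, so `x² y` and `y x²` both equal `x² y x²`;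
  -- this does not need `x²` to be a projection.
  have e₃ : x * x * y = y * (x * x) := by
    have a : x * x * y = x * x * y * (x * x) := by
      rwa [mul_sub, mul_one, sub_eq_zero] at e₁
    have b : y * (x * x) = x * x * y * (x * x) := by
      rwa [sub_mul, sub_mul, one_mul, sub_eq_zero] at e₂
    rw [b, ← a]
  rw [e₃, ← hx1, mul_assoc] at e₁
  have e₄ : x * x * (x' * x') = 0 := by
    rw [← one_mul (x * x * (x' * x')), ← hyy, mul_assoc, e₁, mul_zero]
  have e₅ : x * (x' * x') = 0 := by
    rwa [mul_self_mul_eq_zero_iff hx] at e₄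
  rw [← CStarRing.mul_star_self_eq_zero_iff, star_mul, hx, hx', mul_assoc, ← mul_assoc x', 
    ← mul_assoc, e₅, zero_mul]

end PathUnitary

/-! ### Products of two nearest-neighbour transpositions -/

section Transpositions

/-- The map of the natural numbers which exchanges `i` and `i + 1`. -/
def natTransp (i x : ℕ) : ℕ := if x = i then i + 1 else if x = i + 1 then i else x

theorem val_transp {n : ℕ} (i : Fin (n - 1)) (x : Fin n) :
    (transp i x).val = natTransp i.val x.val := by
  simp only [transp, Equiv.swap_apply_def, natTransp, Fin.ext_iff]
  split_ifs <;> simp_all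

/-- The product is a 3-cycle on consecutive points. Its values at the points moved by the two
factors already determine the ordered pair. -/
theorem natTransp_adjacent {i k a b : ℕ} (hik : i + 1 = k ∨ k + 1 = i)
    (h₁ : natTransp i (natTransp k i) = natTransp a (natTransp b i))
    (h₂ : natTransp i (natTransp k (i + 1)) = natTransp a (natTransp b (i + 1)))
    (h₃ : natTransp i (natTransp k k) = natTransp a (natTransp b k))
    (h₄ : natTransp i (natTransp k (k + 1)) = natTransp a (natTransp b (k + 1))) :
    a = i ∧ b = k := by
  unfold natTransp at *
  rcases hik with rfl | rfl <;> grind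

theorem natTransp_far {i k a b : ℕ} (hik : i + 1 < k)
    (h₁ : natTransp i (natTransp k i) = natTransp a (natTransp b i))
    (h₂ : natTransp i (natTransp k (i + 1)) = natTransp a (natTransp b (i + 1)))
    (h₃ : natTransp i (natTransp k k) = natTransp a (natTransp b k))
    (h₄ : natTransp i (natTransp k (k + 1)) = natTransp a (natTransp b (k + 1))) :
    (a = i ∧ b = k) ∨ (a = k ∧ b = i) := by
  have e₁ : natTransp i (natTransp k i) = i + 1 := by unfold natTransp; grind
  have e₂ : natTransp i (natTransp k (i + 1)) = i := by unfold natTransp; grind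
  have e₃ : natTransp i (natTransp k k) = k + 1 := by unfold natTransp; grind
  have e₄ : natTransp i (natTransp k (k + 1)) = k := by unfold natTransp; grind
  rw [e₁] at h₁
  rw [e₂] at h₂
  rw [e₃] at h₃
  rw [e₄] at h₄
  clear e₁ e₂ e₃ e₄
  -- Otherwise `b` either fixes `i` or moves it down to `i - 1`, from where `a` cannot reach `i +
  -- 1`; so `a = i`. The same reasoning at `k` gives `a = k`.
  have hb : b = i ∨ b = k := by
    by_contra! hb
    have hi : natTransp b i = i ∨ (b + 1 = i ∧ natTransp b i = b) := by unfold natTransp; grind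
    have hk : natTransp b k = k ∨ (b + 1 = k ∧ natTransp b k = b) := by unfold natTransp; grind
    have hai : a = i := by
      rcases hi with h | ⟨h, h'⟩
      · rw [h] at h₁; unfold natTransp at h₁; grind
      · rw [h'] at h₁; unfold natTransp at h₁; grind
    have hak : a = k := by
      rcases hk with h | ⟨h, h'⟩
      · rw [h] at h₃; unfold natTransp at h₃; grind
      · rw [h'] at h₃; unfold natTransp at h₃; grind
    omega
  rcases hb with rfl | rfl
  · right
    have : natTransp b k = k := by unfold natTransp; grind
    rw [this] at h₃
    unfold natTransp at h₃
    grind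
  · left
    have : natTransp b i = i := by unfold natTransp; grind
    rw [this] at h₁
    unfold natTransp at h₁
    grind

theorem natTransp_eq_of_transp_mul_eq {n : ℕ} {i k a b : Fin (n - 1)}
    (h : transp i * transp k = transp a * transp b) {x : ℕ} (hx : x < n) :
    natTransp i (natTransp k x) = natTransp a (natTransp b x) := by
  have := congrArg Fin.val (DFunLike.congr_fun h (⟨x, hx⟩ : Fin n))
  simpa only [Equiv.Perm.mul_apply, val_transp] using this

/-- Multiplication of pairs of generators. -/
def pairProd (n : ℕ) (a : Fin (n - 1) × Fin (n - 1)) : Equiv.Perm (Fin n) :=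
  transp a.1 * transp a.2

theorem pairProd_eq_of_adjacent {n : ℕ} {i k : Fin (n - 1)} (hik : Adjacent i k)
    (a : Fin (n - 1) × Fin (n - 1)) : pairProd n a = pairProd n (i, k) ↔ a = (i, k) := by
  refine ⟨fun h => ?_, fun h => h ▸ rfl⟩
  have h' : ∀ x < n, _ := fun x hx =>
    natTransp_eq_of_transp_mul_eq (i := i) (k := k) (a := a.1) (b := a.2) h.symm (x := x) hx
  obtain ⟨h₁, h₂⟩ := natTransp_adjacent hik (h' i (by omega)) (h' (i + 1) (by omega))
    (h' k (by omega)) (h' (k + 1) (by omega))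
  exact Prod.ext (Fin.ext h₁) (Fin.ext h₂)

theorem transp_mul_comm {n : ℕ} {i k : Fin (n - 1)} (hik : ¬ Adjacent i k) :
    transp i * transp k = transp k * transp i := by
  ext x
  simp only [Equiv.Perm.mul_apply, val_transp]
  simp only [Adjacent] at hik
  unfold natTransp
  grind

theorem pairProd_eq_of_not_adjacent {n : ℕ} {i k : Fin (n - 1)} (hik : ¬ Adjacent i k)
    (hne : i ≠ k) (a : Fin (n - 1) × Fin (n - 1)) :
    pairProd n a = pairProd n (i, k) ↔ a = (i, k) ∨ a = (k, i) := by
  constructor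
  · intro h
    wlog hlt : i.val < k.val generalizing i k
    · have hlt' : k.val < i.val := by
        have := fun h => hne (Fin.ext h)
        omega
      refine (this (fun h => hik h.symm) hne.symm ?_ hlt').symm
      rw [h]
      exact transp_mul_comm hik
    have h' : ∀ x < n, _ := fun x hx =>
      natTransp_eq_of_transp_mul_eq (i := i) (k := k) (a := a.1) (b := a.2) h.symm (x := x) hx
    have hik' : i.val + 1 < k.val := by simp only [Adjacent] at hik; omega
    rcases natTransp_far hik' (h' i (by omega)) (h' (i + 1) (by omega))
      (h' k (by omega)) (h' (k + 1) (by omega)) with ⟨h₁, h₂⟩ | ⟨h₁, h₂⟩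
    · exact Or.inl (Prod.ext (Fin.ext h₁) (Fin.ext h₂))
    · exact Or.inr (Prod.ext (Fin.ext h₁) (Fin.ext h₂))
  · rintro (rfl | rfl)
    · rfl
    · exact transp_mul_comm fun h => hik h.symm

theorem transp_mul_self {n : ℕ} (i : Fin (n - 1)) : transp i * transp i = 1 :=
  Equiv.swap_mul_self _ _

theorem transp_injective {n : ℕ} : Function.Injective (transp : Fin (n - 1) → _) := by
  intro i k h
  have h' : ∀ x : Fin n, natTransp i x.val = natTransp k x.val := fun x => by
    rw [← val_transp, ← val_transp, h]
  have h₁ := h' ⟨i, by omega⟩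
  have h₂ := h' ⟨i + 1, by omega⟩
  ext
  unfold natTransp at h₁ h₂
  grind

/-- Generators are involutions, so reversing a pair inverts its product. Hence swapping permutes the
fibres of `pairProd`, as the trace argument for `u ⊗ u` requires. -/
theorem pairProd_swap {n : ℕ} (a b : Fin (n - 1) × Fin (n - 1)) :
    pairProd n a.swap = pairProd n b.swap ↔ pairProd n a = pairProd n b := by
  have h : ∀ a : Fin (n - 1) × Fin (n - 1), pairProd n a.swap = (pairProd n a)⁻¹ := fun a => by
    simp [pairProd, transp, mul_inv_rev]
  rw [h, h, inv_inj]

end Transpositions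

/-! ### From relations on pairs of generators to the path relations -/

section FibreUnitary

variable {A : Type*} [CStarAlgebra A] {n : ℕ}

/-- The relations between the coefficients of a linear action on the generators which extends to an
action on products of two generators. They are symmetric under transposition. -/
structure FibreUnitary (u : Fin (n - 1) → Fin (n - 1) → A) : Prop where
  selfAdjoint : ∀ i j, star (u i j) = u i j
  row : ∀ i k, ∑ j, u i j * u k j = if i = k then 1 else 0
  col : ∀ j l, ∑ i, u i j * u i l = if j = l then 1 else 0
  row_fibre : ∀ x a a', pairProd n a = pairProd n a' →
    ∑ c with pairProd n c = x, u a.1 c.1 * u a.2 c.2 =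
      ∑ c with pairProd n c = x, u a'.1 c.1 * u a'.2 c.2
  col_fibre : ∀ x b b', pairProd n b = pairProd n b' →
    ∑ c with pairProd n c = x, u c.1 b.1 * u c.2 b.2 =
      ∑ c with pairProd n c = x, u c.1 b'.1 * u c.2 b'.2

namespace FibreUnitary

variable {u : Fin (n - 1) → Fin (n - 1) → A}

theorem transpose (hu : FibreUnitary u) : FibreUnitary fun i j => u j i where
  selfAdjoint i j := hu.selfAdjoint j i
  row := hu.col
  col := hu.row
  row_fibre := hu.col_fibre
  col_fibre := hu.row_fibre

theorem col_fibre_adjacent (hu : FibreUnitary u) {i k : Fin (n - 1)} (hik : Adjacent i k)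
    {b b' : Fin (n - 1) × Fin (n - 1)} (h : pairProd n b = pairProd n b') :
    u i b.1 * u k b.2 = u i b'.1 * u k b'.2 := by
  have := hu.col_fibre (pairProd n (i, k)) b b' h
  simpa only [pairProd_eq_of_adjacent hik, Finset.filter_eq', Finset.mem_univ, if_true,
    Finset.sum_singleton] using this

theorem col_fibre_far (hu : FibreUnitary u) {i k : Fin (n - 1)} (hik : ¬ Adjacent i k)
    (hne : i ≠ k) {b b' : Fin (n - 1) × Fin (n - 1)} (h : pairProd n b = pairProd n b') :
    u i b.1 * u k b.2 + u k b.1 * u i b.2 = u i b'.1 * u k b'.2 + u k b'.1 * u i b'.2 := by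
  have := hu.col_fibre (pairProd n (i, k)) b b' h
  have e : (Finset.univ.filter fun c => pairProd n c = pairProd n (i, k)) = {(i, k), (k, i)} := by
    ext c
    simp [pairProd_eq_of_not_adjacent hik hne]
  rw [e, Finset.sum_pair, Finset.sum_pair] at this
  · exact this
  · exact fun h => hne (congrArg Prod.fst h)
  · exact fun h => hne (congrArg Prod.fst h)

theorem pairProd_diag (j l : Fin (n - 1)) : pairProd n (j, j) = pairProd n (l, l) := by
  simp only [pairProd, transp_mul_self]

theorem eq_zero_of_const {m : ℕ} {f : Fin m → A} (h : ∀ j l, f j = f l) (hs : ∑ j, f j = 0)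
    (j : Fin m) : f j = 0 := by
  rw [Finset.sum_congr rfl fun l _ => h l j, Finset.sum_const, Finset.card_univ, Fintype.card_fin,
    ← Nat.cast_smul_eq_nsmul ℂ] at hs
  refine (smul_eq_zero.mp hs).resolve_left ?_
  rw [Nat.cast_eq_zero]
  have := j.isLt
  omega

/-- All `s_j ^ 2` are equal, so the product does not depend on `j`; its sum over `j` is an
off-diagonal row relation and vanishes. -/
theorem col_adjacent (hu : FibreUnitary u) {i k : Fin (n - 1)} (hik : Adjacent i k)
    (j : Fin (n - 1)) : u i j * u k j = 0 :=
  eq_zero_of_const (f := fun j => u i j * u k j)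
    (fun j l => hu.col_fibre_adjacent hik (pairProd_diag j l))
    ((hu.row i k).trans (if_neg (by rintro rfl; exact not_adjacent_self _ hik))) j

theorem col_far (hu : FibreUnitary u) {i k : Fin (n - 1)} (hik : ¬ Adjacent i k)
    (hne : i ≠ k) (j : Fin (n - 1)) : u i j * u k j + u k j * u i j = 0 :=
  eq_zero_of_const (f := fun j => u i j * u k j + u k j * u i j)
    (fun j l => hu.col_fibre_far hik hne (pairProd_diag j l))
    (by
      rw [Finset.sum_add_distrib, hu.row, hu.row, if_neg hne, if_neg hne.symm, add_zero]) j

/-- For distinct commuting `s_j`, `s_l` the columns can be exchanged: `u i j * u k l = u i l * u k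
j`. Multiply by `u i j` on the left: since `u i j` and `u i l` anticommute, the factor `u i j * u k
j = 0` appears. The C⋆-identity removes the additional `u i j`. -/
theorem orthogonal_of_adjacent (hu : FibreUnitary u) {i k j l : Fin (n - 1)} (hik : Adjacent i k)
    (hjl : ¬ Adjacent j l) : u i j * u k l = 0 := by
  by_cases h : j = l
  · rw [h, hu.col_adjacent hik]
  · have e₁ : u i j * u k l = u i l * u k j := hu.col_fibre_adjacent hik (b := (j, l))
      (b' := (l, j)) (transp_mul_comm hjl)
    have e₂ : u i j * u i l = - (u i l * u i j) := by
      rw [eq_neg_iff_add_eq_zero]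
      exact hu.transpose.col_far hjl h i
    rw [← mul_self_mul_eq_zero_iff (hu.selfAdjoint i j), mul_assoc, e₁, ← mul_assoc, e₂, neg_mul,
      mul_assoc, hu.col_adjacent hik, mul_zero, neg_zero]

theorem pathUnitary (hu : FibreUnitary u) : PathUnitary u where
  selfAdjoint := hu.selfAdjoint
  row_sq i := by simpa using hu.row i i
  col_sq j := by simpa using hu.col j j
  orthogonal i j k l h := by
    by_cases hik : Adjacent i k
    · exact hu.orthogonal_of_adjacent hik fun hjl => h ⟨fun _ => hjl, fun _ => hik⟩
    · by_cases hjl : Adjacent j l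
      · exact hu.transpose.orthogonal_of_adjacent hjl hik
      · exact absurd ⟨fun h => absurd h hik, fun h => absurd h hjl⟩ h

end FibreUnitary

/-- The relations between columns imply the relations between rows. -/
theorem fibreUnitary_of_columns [PartialOrder A] [StarOrderedRing A]
    {u : Fin (n - 1) → Fin (n - 1) → A}
    (hs : ∀ i j, star (u i j) = u i j)
    (hc : ∀ j l, ∑ i, u i j * u i l = if j = l then 1 else 0)
    (hf : ∀ x b b', pairProd n b = pairProd n b' →
      ∑ c with pairProd n c = x, u c.1 b.1 * u c.2 b.2 =
        ∑ c with pairProd n c = x, u c.1 b'.1 * u c.2 b'.2) : FibreUnitary u := by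
  have hr : ∀ i k, ∑ j, u i j * u k j = if i = k then 1 else 0 := by
    have := mul_conjTranspose_eq_one_of_selfAdjoint (X := Matrix.of u) hs (by
      ext j l
      simp only [Matrix.mul_apply, Matrix.conjTranspose_apply, Matrix.of_apply, hs, hc,
        Matrix.one_apply])
    intro i k
    have := congrFun (congrFun this i) k
    simpa only [Matrix.mul_apply, Matrix.conjTranspose_apply, Matrix.of_apply, hs,
      Matrix.one_apply] using this
  refine ⟨hs, hr, hc, ?_, hf⟩
  -- The matrix `u ⊗ u` describes `α` on words of length two. Taking adjoints reverses a product of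
  -- self-adjoint entries, so its reality involution is the swap.
  let W : Matrix (Fin (n - 1) × Fin (n - 1)) (Fin (n - 1) × Fin (n - 1)) A :=
    Matrix.of fun a b => u a.1 b.1 * u a.2 b.2
  refine fibre_row_sums_of_fibre_column_sums (W := W) ?_ ?_ (σ := Prod.swap) Prod.swap_swap ?_
    (pairProd n) pairProd_swap hf
  · ext b b'
    simp only [Matrix.mul_apply, Matrix.conjTranspose_apply, W, Matrix.of_apply, star_mul, hs,
      Fintype.sum_prod_type, Matrix.one_apply]
    rw [Finset.sum_comm]
    have : ∀ k, ∑ i, u k b.2 * u i b.1 * (u i b'.1 * u k b'.2) =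
        if b.1 = b'.1 then u k b.2 * u k b'.2 else 0 := fun k => by
      have : ∀ i, u k b.2 * u i b.1 * (u i b'.1 * u k b'.2) =
        u k b.2 * (u i b.1 * u i b'.1) * u k b'.2 := fun i => by simp only [mul_assoc]
      rw [Finset.sum_congr rfl fun i _ => this i, ← Finset.sum_mul, ← Finset.mul_sum, hc]
      split_ifs <;> simp
    rw [Finset.sum_congr rfl fun k _ => this k]
    by_cases h₁ : b.1 = b'.1
    · simp only [h₁, if_true, hc, Prod.ext_iff, true_and]
    · simp [h₁, Prod.ext_iff]
  · ext a a'
    simp only [Matrix.mul_apply, Matrix.conjTranspose_apply, W, Matrix.of_apply, star_mul, hs,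
      Fintype.sum_prod_type, Matrix.one_apply]
    have : ∀ j, ∑ l, u a.1 j * u a.2 l * (u a'.2 l * u a'.1 j) =
        if a.2 = a'.2 then u a.1 j * u a'.1 j else 0 := fun j => by
      have : ∀ l, u a.1 j * u a.2 l * (u a'.2 l * u a'.1 j) =
        u a.1 j * (u a.2 l * u a'.2 l) * u a'.1 j := fun l => by simp only [mul_assoc]
      rw [Finset.sum_congr rfl fun l _ => this l, ← Finset.sum_mul, ← Finset.mul_sum, hr]
      split_ifs <;> simp
    rw [Finset.sum_congr rfl fun j _ => this j]
    by_cases h₁ : a.2 = a'.2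
    · simp only [h₁, if_true, hr, Prod.ext_iff, and_true]
    · simp [h₁, Prod.ext_iff]
  · intro a b
    simp only [W, Matrix.of_apply, star_mul, hs, Prod.fst_swap, Prod.snd_swap]

end FibreUnitary

/-! ### Homomorphisms and slice maps of group algebras -/

section GroupAlgebraTools

variable {G : Type*} [Group G]

/-- The element of the group algebra given by a group element. -/
abbrev grp (g : G) : MonoidAlgebra ℂ G := MonoidAlgebra.single g 1

theorem grp_mul (g h : G) : grp g * grp h = grp (g * h) := by
  simp [MonoidAlgebra.single_mul_single]

theorem grp_one : grp (1 : G) = 1 := rfl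

theorem star_grp (g : G) : star (grp g) = grp g⁻¹ := by simp [star_single]

theorem linearMap_ext_grp {V : Type*} [AddCommMonoid V] [Module ℂ V]
    {f f' : MonoidAlgebra ℂ G →ₗ[ℂ] V} (h : ∀ g, f (grp g) = f' (grp g)) : f = f' := by
  refine LinearMap.ext fun x => ?_
  induction x using MonoidAlgebra.induction_linear with
  | zero => simp
  | add x y hx hy => rw [map_add, map_add, hx, hy]
  | single g c =>
    have : MonoidAlgebra.single g c = c • grp g := by simp
    rw [this, map_smul, map_smul, h]

section Lift

variable {B : Type*} [Ring B] [StarRing B] [Algebra ℂ B]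

theorem starAlgHom_ext_grp {f f' : MonoidAlgebra ℂ G →⋆ₐ[ℂ] B}
    (h : ∀ g, f (grp g) = f' (grp g)) : f = f' := by
  ext x
  exact LinearMap.congr_fun
    (linearMap_ext_grp (f := f.toAlgHom.toLinearMap) (f' := f'.toAlgHom.toLinearMap) h) x

/-- The extension of a unitary representation to the group algebra. -/
def groupLift [StarModule ℂ B] (f : G →* B) (hf : ∀ g, star (f g) = f g⁻¹) :
    MonoidAlgebra ℂ G →⋆ₐ[ℂ] B where
  __ := MonoidAlgebra.lift ℂ B G f
  map_star' x := by
    change MonoidAlgebra.lift ℂ B G f (star x) = star (MonoidAlgebra.lift ℂ B G f x)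
    induction x using MonoidAlgebra.induction_linear with
    | zero => simp
    | add x y hx hy => rw [star_add, map_add, map_add, star_add, hx, hy]
    | single g c => simp [star_single, MonoidAlgebra.lift_single, hf]

theorem groupLift_grp [StarModule ℂ B] (f : G →* B) (hf : ∀ g, star (f g) = f g⁻¹) (g : G) :
    groupLift f hf (grp g) = f g := by
  change MonoidAlgebra.lift ℂ B G f (grp g) = f g
  simp [MonoidAlgebra.lift_single]

end Lift

/-- The counit of the group algebra. -/
def trivialRep (G : Type*) [Group G] : MonoidAlgebra ℂ G →⋆ₐ[ℂ] ℂ :=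
  groupLift (1 : G →* ℂ) fun g => by simp

theorem trivialRep_grp (g : G) : trivialRep G (grp g) = 1 := groupLift_grp _ _ g

/-- The map of group algebras induced by a group homomorphism. -/
def twist (θ : G →* G) : MonoidAlgebra ℂ G →⋆ₐ[ℂ] MonoidAlgebra ℂ G :=
  groupLift ((MonoidAlgebra.of ℂ G).comp θ) fun g => by simp [star_single]

theorem twist_grp (θ : G →* G) (g : G) : twist θ (grp g) = grp (θ g) := groupLift_grp _ _ g

theorem twist_twist {θ : G →* G} (hθ : ∀ g, θ (θ g) = g) (x : MonoidAlgebra ℂ G) :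
    twist θ (twist θ x) = x :=
  DFunLike.congr_fun (f := (twist θ).comp (twist θ)) (g := StarAlgHom.id ℂ _)
    (starAlgHom_ext_grp fun g => by
      change twist θ (twist θ (grp g)) = grp g
      rw [twist_grp, twist_grp, hθ]) x

section Slices

variable {A : Type*} [CStarAlgebra A]

theorem slice_tmul (g : G) (x : MonoidAlgebra ℂ G) (a : A) :
    slice g (x ⊗ₜ a) = x.coeff g • a := rfl

theorem slice_grp_tmul [DecidableEq G] (g h : G) (a : A) :
    slice g (grp h ⊗ₜ a) = if h = g then a else 0 := by
  rw [slice_tmul, MonoidAlgebra.coeff_single, Finsupp.single_apply]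
  split_ifs <;> simp

theorem eq_sum_slice [Fintype G] (t : MonoidAlgebra ℂ G ⊗[ℂ] A) :
    t = ∑ g, grp g ⊗ₜ slice g t := by
  classical
  induction t using TensorProduct.induction_on with
  | zero => simp
  | add s t hs ht =>
    simp only [map_add, TensorProduct.tmul_add, Finset.sum_add_distrib]
    rw [← hs, ← ht]
  | tmul x a =>
    have hx : x = ∑ g, x.coeff g • grp g := by
      ext h
      rw [MonoidAlgebra.coeff_sum]
      simp
    conv_lhs => rw [hx, TensorProduct.sum_tmul]
    refine Finset.sum_congr rfl fun g _ => ?_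
    rw [slice_tmul, TensorProduct.smul_tmul]

theorem slice_ext [Fintype G] {s t : MonoidAlgebra ℂ G ⊗[ℂ] A}
    (h : ∀ g, slice g s = slice g t) : s = t := by
  rw [eq_sum_slice s, eq_sum_slice t]
  exact Finset.sum_congr rfl fun g _ => by rw [h]

variable (G A)

/-- The map `ε ⊗ id` given by the counit of the group algebra. -/
def counitSlice : MonoidAlgebra ℂ G ⊗[ℂ] A →⋆ₐ[ℂ] A where
  __ := Algebra.TensorProduct.lift
    ((Algebra.ofId ℂ A).comp (trivialRep G).toAlgHom)
    (AlgHom.id ℂ A) (fun _ _ => Algebra.commutes _ _)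
  map_star' t := by
    induction t using TensorProduct.induction_on with
    | zero => simp
    | add s t hs ht => simp_all
    | tmul x a =>
      simp only [TensorProduct.star_tmul]
      change algebraMap ℂ A (trivialRep G (star x)) * star a =
        star (algebraMap ℂ A (trivialRep G x) * a)
      rw [star_mul, map_star, ← algebraMap_star_comm, Algebra.commutes]

variable {G A}

theorem counitSlice_grp_tmul (g : G) (a : A) : counitSlice G A (grp g ⊗ₜ a) = a := by
  change algebraMap ℂ A (trivialRep G (grp g)) * a = a
  rw [trivialRep_grp, map_one, one_mul]

end Slices

end GroupAlgebraTools

/-! ### Homomorphisms on two copies of the group algebra -/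

section PairHom

variable {G : Type*} [Group G] (θ : G →* G)
variable {B : Type*} [Ring B] [StarRing B] [Algebra ℂ B]

/-- Two copies of the group algebra. -/
abbrev DoubleAlg (G : Type*) [Group G] : Type _ := MonoidAlgebra ℂ G × MonoidAlgebra ℂ G

/-- The unital ⋆-homomorphism `(x, y) ↦ r(x) p + r(θ(y)) (1 - p)` on two copies of the group
algebra. -/
def pairHom (r : MonoidAlgebra ℂ G →⋆ₐ[ℂ] B) (p : B) (hs : star p = p) (hp : p * p = p)
    (hc : ∀ x, Commute p (r x)) : DoubleAlg G →⋆ₐ[ℂ] B where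
  toFun x := r x.1 * p + r (twist θ x.2) * (1 - p)
  map_one' := by simp
  map_mul' x y := by
    have hq : (1 - p) * (1 - p) = 1 - p := by simp only [mul_sub, sub_mul, hp, mul_one, one_mul,
      sub_self, sub_zero]
    have hpq : p * (1 - p) = 0 := by rw [mul_sub, mul_one, hp, sub_self]
    have hqp : (1 - p) * p = 0 := by rw [sub_mul, one_mul, hp, sub_self]
    have hc' : ∀ x, Commute (1 - p) (r x) := fun x => (Commute.one_left _).sub_left (hc x)
    have e : ∀ {a b c d : B}, Commute b c → a * b * (c * d) = a * c * (b * d) := fun {a b c d} h => by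
      rw [mul_assoc, ← mul_assoc b, h.eq]; simp only [mul_assoc]
    simp only [Prod.fst_mul, Prod.snd_mul, map_mul, mul_add, add_mul]
    rw [e (hc _), e (hc' _), e (hc _), e (hc' _), hp, hq, hpq, hqp]
    simp
  map_zero' := by simp
  map_add' x y := by simp only [Prod.fst_add, Prod.snd_add, map_add, add_mul]; abel
  commutes' c := by
    simp only [Algebra.algebraMap_eq_smul_one, Prod.smul_fst, Prod.smul_snd, Prod.fst_one,
      Prod.snd_one, map_smul, map_one, smul_mul_assoc, one_mul, ← smul_add, add_sub_cancel]
  map_star' x := by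
    have hc' : ∀ x, Commute (1 - p) (r x) := fun x => (Commute.one_left _).sub_left (hc x)
    simp only [Prod.fst_star, Prod.snd_star, map_star, star_add, star_mul, star_sub, star_one, hs]
    rw [← map_star, ← map_star, ← map_star, (hc _).eq, (hc' _).eq]

theorem pairHom_apply (r : MonoidAlgebra ℂ G →⋆ₐ[ℂ] B) (p : B) (hs : star p = p) (hp : p * p = p)
    (hc : ∀ x, Commute p (r x)) (x : DoubleAlg G) :
    pairHom θ r p hs hp hc x = r x.1 * p + r (twist θ x.2) * (1 - p) := rfl

variable {θ}

/-- A ⋆-homomorphism on two copies of the group algebra is determined by its values on the elements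
`(g, θ(g))` and on the first central projection. -/
theorem doubleAlg_hom_ext (hθ : ∀ g, θ (θ g) = g) {F F' : DoubleAlg G →⋆ₐ[ℂ] B}
    (h : ∀ g, F (grp g, grp (θ g)) = F' (grp g, grp (θ g))) (h1 : F (1, 0) = F' (1, 0)) :
    F = F' := by
  have h2 : F (0, 1) = F' (0, 1) := by
    have e : ((0, 1) : DoubleAlg G) = 1 - (1, 0) := by ext1 <;> simp
    rw [e, map_sub, map_sub, map_one, map_one, h1]
  have e₁ : ∀ g, F (grp g, 0) = F' (grp g, 0) := fun g => by
    have e : ((grp g, 0) : DoubleAlg G) = (grp g, grp (θ g)) * (1, 0) := by ext1 <;> simp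
    rw [e, map_mul, map_mul, h, h1]
  have e₂ : ∀ g, F (0, grp g) = F' (0, grp g) := fun g => by
    have e : ((0, grp g) : DoubleAlg G) = (grp (θ g), grp (θ (θ g))) * (0, 1) := by
      rw [hθ]; ext1 <;> simp
    rw [e, map_mul, map_mul, h, h2]
  have l₁ := linearMap_ext_grp (f := F.toAlgHom.toLinearMap ∘ₗ LinearMap.inl ℂ _ _)
    (f' := F'.toAlgHom.toLinearMap ∘ₗ LinearMap.inl ℂ _ _) e₁
  have l₂ := linearMap_ext_grp (f := F.toAlgHom.toLinearMap ∘ₗ LinearMap.inr ℂ _ _)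
    (f' := F'.toAlgHom.toLinearMap ∘ₗ LinearMap.inr ℂ _ _) e₂
  ext x
  have := LinearMap.congr_fun (LinearMap.prod_ext l₁ l₂) x
  exact this

end PairHom

/-! ### The coefficients of an action on the generators -/

section LengthOne

variable {n : ℕ} {A : Type*} [CStarAlgebra A]
variable {α : MonoidAlgebra ℂ (Equiv.Perm (Fin n)) →⋆ₐ[ℂ]
  MonoidAlgebra ℂ (Equiv.Perm (Fin n)) ⊗[ℂ] A} {u : Fin (n - 1) → Fin (n - 1) → A}

theorem star_sGen (i : Fin (n - 1)) : star (sGen i : MonoidAlgebra ℂ (Equiv.Perm (Fin n))) =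
    sGen i := by
  rw [sGen, star_single, star_one]
  exact congrArg (fun g => MonoidAlgebra.single g 1) (Equiv.swap_inv _ _)

theorem sGen_mul_sGen (j l : Fin (n - 1)) :
    sGen j * sGen l = grp (pairProd n (j, l)) := grp_mul _ _

theorem slice_sum_sGen (v : Fin (n - 1) → A) (i : Fin (n - 1)) :
    slice (transp i) (∑ k, sGen k ⊗ₜ[ℂ] v k) = v i := by
  rw [map_sum, Finset.sum_eq_single i]
  · rw [sGen, slice_grp_tmul, if_pos rfl]
  · intro k _ hk
    rw [sGen, slice_grp_tmul, if_neg fun h => hk (transp_injective h)]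
  · simp

theorem coefficient_selfAdjoint (h : ∀ j, α (sGen j) = ∑ i, sGen i ⊗ₜ u i j)
    (i j : Fin (n - 1)) : star (u i j) = u i j := by
  have e : star (α (sGen j)) = α (sGen j) := by rw [← map_star, star_sGen]
  rw [h, star_sum] at e
  simp only [TensorProduct.star_tmul, star_sGen] at e
  rw [← slice_sum_sGen (fun i => star (u i j)) i, e, slice_sum_sGen]

theorem slice_sGen_mul_sGen (h : ∀ j, α (sGen j) = ∑ i, sGen i ⊗ₜ u i j)
    (x : Equiv.Perm (Fin n)) (b : Fin (n - 1) × Fin (n - 1)) :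
    slice x (α (sGen b.1 * sGen b.2)) =
      ∑ c with pairProd n c = x, u c.1 b.1 * u c.2 b.2 := by
  rw [map_mul, h, h, Finset.sum_mul_sum, ← Fintype.sum_prod_type', map_sum, Finset.sum_filter]
  refine Finset.sum_congr rfl fun c _ => ?_
  rw [Algebra.TensorProduct.tmul_mul_tmul, sGen_mul_sGen, slice_grp_tmul]

/-- Orthonormality of the columns is the trace condition, since `s_i s_k = 1` only for `i = k`. The
fibre relations hold because `α(s_j s_l)` sees only the group element. -/
theorem fibreUnitary_of_preserves [PartialOrder A] [StarOrderedRing A]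
    (h : ∀ j, α (sGen j) = ∑ i, sGen i ⊗ₜ u i j) (ht : PreservesTraceZeroTwo α) :
    FibreUnitary u := by
  refine fibreUnitary_of_columns (coefficient_selfAdjoint h) (fun j l => ?_) fun x b b' hb => ?_
  · rw [← ht j l]
    refine Eq.trans ?_ (slice_sGen_mul_sGen h 1 (j, l)).symm
    have e : (Finset.univ.filter fun c => pairProd n c = 1) =
        Finset.univ.map ⟨fun i : Fin (n - 1) => (i, i), fun i j h => congrArg Prod.fst h⟩ := by
      ext c
      simp only [Finset.mem_filter, Finset.mem_univ, true_and, Finset.mem_map]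
      constructor
      · intro hc
        refine ⟨c.1, Prod.ext rfl (transp_injective ?_)⟩
        rw [pairProd, mul_eq_one_iff_eq_inv, transp, transp, Equiv.swap_inv] at hc
        exact hc
      · rintro ⟨i, rfl⟩
        exact transp_mul_self i
    rw [e, Finset.sum_map]
    rfl
  · rw [← slice_sGen_mul_sGen h, ← slice_sGen_mul_sGen h, sGen_mul_sGen, sGen_mul_sGen]
    exact congrArg _ (congrArg _ (congrArg _ hb))

theorem transp_braid {i k : Fin (n - 1)} (hik : Adjacent i k) :
    transp i * transp k * transp i = transp k * transp i * transp k := by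
  ext x
  simp only [Equiv.Perm.mul_apply, val_transp]
  simp only [Adjacent] at hik
  unfold natTransp
  grind

/-- The coefficient of a product of three consecutive generators in the braid relation. -/
theorem braid_coefficient (h : ∀ j, α (sGen j) = ∑ i, sGen i ⊗ₜ u i j) {i k l : Fin (n - 1)}
    (hk : k.val = i.val + 1) (hl : l.val = i.val + 2)
    (hi : ∀ a, a ≠ i → a ≠ l → u a i = 0) (hk' : ∀ a, a ≠ k → u a k = 0) :
    u i i * u k k * u l i = 0 := by
  have hil : i ≠ l := fun h => by have := congrArg Fin.val h; omega
  have e₁ : α (sGen i) = grp (transp i) ⊗ₜ u i i + grp (transp l) ⊗ₜ u l i := by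
    rw [h]
    exact Fintype.sum_eq_add i l hil fun a ha => by rw [hi a ha.1 ha.2, TensorProduct.tmul_zero]
  have e₂ : α (sGen k) = grp (transp k) ⊗ₜ u k k := by
    rw [h]
    exact Finset.sum_eq_single k (fun a _ ha => by rw [hk' a ha, TensorProduct.tmul_zero]) (by simp)
  have e : sGen i * sGen k * sGen i = sGen k * sGen i * sGen k := by
    simp only [sGen, MonoidAlgebra.single_mul_single, transp_braid (Or.inl hk.symm : Adjacent i k)]
  have e' := congrArg (fun x => slice (transp i * transp k * transp l) (α x)) e
  have hx : i.val + 3 < n := by omega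
  -- The word `s_i s_k s_l` sends `i + 3` to `i`. None of the other five words in the expanded braid
  -- relation does, so its coefficient stands alone.
  have ne : ∀ {g : Equiv.Perm (Fin n)}, (g ⟨i.val + 3, hx⟩).val ≠ i.val →
      g ≠ transp i * transp k * transp l := by
    rintro g hg rfl
    apply hg
    simp only [Equiv.Perm.mul_apply, val_transp, hk, hl]
    unfold natTransp
    grind
  simp only [map_mul, e₁, e₂, add_mul, mul_add, Algebra.TensorProduct.tmul_mul_tmul, grp_mul,
    map_add, slice_grp_tmul, if_true] at e'
  rw [if_neg, if_neg, if_neg, if_neg, if_neg] at e'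
  · simpa using e'
  all_goals
    apply ne
    simp only [Equiv.Perm.mul_apply, val_transp, hk, hl]
    unfold natTransp
    grind

end LengthOne

/-! ### Use of the braid relation -/

section Decomposition

variable {n : ℕ} {A : Type*} [CStarAlgebra A] [PartialOrder A] [StarOrderedRing A]
variable {α : MonoidAlgebra ℂ (Equiv.Perm (Fin n)) →⋆ₐ[ℂ]
  MonoidAlgebra ℂ (Equiv.Perm (Fin n)) ⊗[ℂ] A} {u : Fin (n - 1) → Fin (n - 1) → A}

theorem first_mul_first_last_of_preserves (h : ∀ j, α (sGen j) = ∑ i, sGen i ⊗ₜ u i j)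
    (ht : PreservesTraceZeroTwo α) {o : Fin (n - 1)} (ho : o.val = 0) (h1 : 1 < n - 1) :
    u o o * u o o.rev = 0 := by
  have hu := (fibreUnitary_of_preserves h ht).pathUnitary
  by_cases h3 : n - 1 = 3
  · set k : Fin (n - 1) := ⟨1, h1⟩
    have hk : k.val = 1 := rfl
    have hl : o.rev.val = 2 := by rw [Fin.val_rev]; omega
    have hcol : ∀ a, a ≠ k → u a k = 0 := fun a ha => by
      have ha' : a.val ≠ k.val := fun h => ha (Fin.ext h)
      by_cases h0 : a.val = 0
      · exact hu.first_interior h0 (by omega) (by omega)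
      · have e : a = o.rev := Fin.ext (by omega)
        rw [e]
        exact hu.transpose.reverse.transpose.first_interior (o := o) (j := k) ho (by omega)
          (by omega)
    have hb := braid_coefficient h (i := o) (k := k) (l := o.rev) (by omega) (by omega)
      (fun a ha ha' => hu.transpose.first_interior (o := o) (j := a) ho
        (by have : a.val ≠ o.val := fun h => ha (Fin.ext h)
            omega)
        (by have : a.val ≠ o.rev.val := fun h => ha' (Fin.ext h)
            omega)) hcol
    have hyy : u k k * u k k = 1 := by
      rw [← hu.col_sq k]
      symm
      exact Finset.sum_eq_single k (fun a _ ha => by rw [hcol a ha, mul_zero]) (by simp)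
    -- For three vertices the middle entry `y = u k k` has square `1`, and the braid relation
    -- separates the two nonzero entries of the first column by `y`. The result for the column is
    -- then transferred to the row.
    have hz := mul_eq_zero_of_separated (hu.selfAdjoint _ _) (hu.selfAdjoint _ _)
      (hu.selfAdjoint _ _) (hu.transpose.first_row_sq ho h1) hyy hb
    exact hu.transpose.first_mul_last_first ho h1 hz
  · exact hu.first_mul_first_last ho h1 h3

/-- Only a central vertex `c` is in doubt. For its neighbours `a` and `a.rev` the braid relation
gives `u a a * u c c * u a.rev a = 0`, and the outer factors have squares `p` and `1 - p`. -/
theorem first_sq_commute_of_preserves (h : ∀ j, α (sGen j) = ∑ i, sGen i ⊗ₜ u i j)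
    (ht : PreservesTraceZeroTwo α) {o : Fin (n - 1)} (ho : o.val = 0) (h1 : 1 < n - 1)
    (i j : Fin (n - 1)) : Commute (u o o * u o o) (u i j) := by
  have hu := (fibreUnitary_of_preserves h ht).pathUnitary
  have h0 := first_mul_first_last_of_preserves h ht ho h1
  refine hu.first_sq_commute ho h1 h0 (fun c hc => ?_) i j
  have hc' : c.val = n - 1 - (c.val + 1) := by
    conv_lhs => rw [hc, Fin.val_rev]
  set a : Fin (n - 1) := ⟨c.val - 1, by omega⟩
  have ha : a.val = c.val - 1 := rfl
  have har : a.rev.val = c.val + 1 := by rw [Fin.val_rev]; omega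
  have hne : a ≠ a.rev := fun h => by
    have := congrArg Fin.val h
    omega
  have hb := braid_coefficient h (i := a) (k := c) (l := a.rev) (by omega) (by omega)
    (fun b hb hb' => hu.apply_eq_zero ho h1 h0 hb fun h => hb' (by rw [h, Fin.rev_rev]))
    (fun b hb => hu.apply_eq_zero ho h1 h0 hb fun h => hb (by rw [hc, h, Fin.rev_rev]))
  have e₁ := hu.diagonal_sq ho h1 h0 hne
  have e₂ : u a a * u a a + u a.rev a * u a.rev a = 1 := by
    rw [← hu.col_sq a]
    symm
    exact Fintype.sum_eq_add a a.rev hne fun b hb => by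
      rw [hu.apply_eq_zero ho h1 h0 hb.1 fun h => hb.2 (by rw [h, Fin.rev_rev]), mul_zero]
  have e₃ : 1 - u o o * u o o = u a.rev a * u a.rev a := by rw [← e₁, ← e₂]; abel
  rw [e₃, ← e₁]
  calc u a a * u a a * u c c * (u a.rev a * u a.rev a)
      = u a a * (u a a * u c c * u a.rev a) * u a.rev a := by simp only [mul_assoc]
    _ = 0 := by rw [hb, mul_zero, zero_mul]

end Decomposition

/-! ### Splitting an action by a projection -/

section PairHomOfGenerators

variable {G : Type*} [Group G] {A : Type*} [CStarAlgebra A]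

/-- The homomorphism `Φ` turns the coaction of the doubling into `α`. -/
def Intertwines (θ : G →* G) (α : MonoidAlgebra ℂ G →⋆ₐ[ℂ] MonoidAlgebra ℂ G ⊗[ℂ] A)
    (Φ : DoubleAlg G →⋆ₐ[ℂ] A) : Prop :=
  ∀ g, α (grp g) = grp g ⊗ₜ Φ (grp g, 0) + grp (θ g) ⊗ₜ Φ (0, grp (θ g))

/-- With `r = (ε ⊗ id) α`, the conditions say that `α` is `g ⊗ r(g)` under `p` and `θ(g) ⊗ r(g)`
under `1 - p`. They are multiplicative in `g` because `p` commutes with the image, so they pass from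
generators to the group. -/
theorem exists_intertwines_of_generators {θ : G →* G} (hθ : ∀ g, θ (θ g) = g)
    (α : MonoidAlgebra ℂ G →⋆ₐ[ℂ] MonoidAlgebra ℂ G ⊗[ℂ] A) {S : Set G}
    (hS : Submonoid.closure S = ⊤) {p : A} (hs : star p = p) (hp : p * p = p)
    (h₁ : ∀ s ∈ S, α (grp s) * (1 ⊗ₜ p) = grp s ⊗ₜ (counitSlice G A (α (grp s)) * p))
    (h₂ : ∀ s ∈ S, α (grp s) * (1 ⊗ₜ (1 - p)) =
      grp (θ s) ⊗ₜ (counitSlice G A (α (grp s)) * (1 - p)))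
    (hc : ∀ s ∈ S, Commute (1 ⊗ₜ p) (α (grp s))) :
    ∃ Φ : DoubleAlg G →⋆ₐ[ℂ] A, Intertwines θ α Φ := by
  have hq : (1 - p) * (1 - p) = 1 - p := by
    simp only [mul_sub, sub_mul, hp, mul_one, one_mul, sub_self, sub_zero]
  have hpp : ((1 : MonoidAlgebra ℂ G) ⊗ₜ[ℂ] p) * (1 ⊗ₜ p) = 1 ⊗ₜ p := by
    rw [Algebra.TensorProduct.tmul_mul_tmul, mul_one, hp]
  have hqq : ((1 : MonoidAlgebra ℂ G) ⊗ₜ[ℂ] (1 - p)) * (1 ⊗ₜ (1 - p)) = 1 ⊗ₜ (1 - p) := by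
    rw [Algebra.TensorProduct.tmul_mul_tmul, mul_one, hq]
  have h1p : (1 : MonoidAlgebra ℂ G) ⊗ₜ[ℂ] (1 - p) = 1 - 1 ⊗ₜ p := by
    rw [TensorProduct.tmul_sub, Algebra.TensorProduct.one_def]
  have hmul : ∀ {x y P : MonoidAlgebra ℂ G ⊗[ℂ] A}, P * P = P → Commute P y →
      x * y * P = x * P * (y * P) := fun {x y P} hP h => by
    rw [mul_assoc x P, ← mul_assoc P, h.eq, mul_assoc y, hP, mul_assoc]
  have hcA : ∀ {x : MonoidAlgebra ℂ G ⊗[ℂ] A}, Commute (1 ⊗ₜ p) x →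
      Commute p (counitSlice G A x) := fun {x} h => by
    have := congrArg (counitSlice G A) h.eq
    rwa [map_mul, map_mul, ← grp_one, counitSlice_grp_tmul] at this
  let T : Submonoid G :=
    { carrier := {g | α (grp g) * (1 ⊗ₜ p) = grp g ⊗ₜ (counitSlice G A (α (grp g)) * p) ∧
        α (grp g) * (1 ⊗ₜ (1 - p)) = grp (θ g) ⊗ₜ (counitSlice G A (α (grp g)) * (1 - p)) ∧
        Commute (1 ⊗ₜ p) (α (grp g))}
      one_mem' := by
        simp only [Set.mem_ofPred_eq, grp_one, map_one, one_mul, true_and]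
        exact Commute.one_right _
      mul_mem' := by
        rintro g h ⟨g₁, g₂, g₃⟩ ⟨k₁, k₂, k₃⟩
        have k₃' : Commute (1 ⊗ₜ (1 - p)) (α (grp h)) := by
          rw [h1p]
          exact (Commute.one_left _).sub_left k₃
        have c₁ := hcA k₃
        have c₂ : Commute (1 - p) (counitSlice G A (α (grp h))) := (Commute.one_left _).sub_left c₁
        refine ⟨?_, ?_, ?_⟩
        · rw [← grp_mul, map_mul, hmul hpp k₃, g₁, k₁, Algebra.TensorProduct.tmul_mul_tmul, grp_mul,
            map_mul, mul_assoc _ p, ← mul_assoc p, c₁.eq, mul_assoc _ p p, hp, ← mul_assoc]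
        · rw [← grp_mul, map_mul, hmul hqq k₃', g₂, k₂, Algebra.TensorProduct.tmul_mul_tmul, grp_mul,
            map_mul, map_mul, mul_assoc _ (1 - p), ← mul_assoc (1 - p), c₂.eq,
            mul_assoc _ (1 - p) (1 - p), hq, ← mul_assoc]
        · rw [← grp_mul, map_mul]
          exact g₃.mul_right k₃ }
  have hT : ∀ g, g ∈ T := fun g => by
    have : Submonoid.closure S ≤ T :=
      Submonoid.closure_le.mpr fun s hsS => ⟨h₁ s hsS, h₂ s hsS, hc s hsS⟩
    exact this (hS ▸ Submonoid.mem_top g)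
  let r : MonoidAlgebra ℂ G →⋆ₐ[ℂ] A := (counitSlice G A).comp α
  have hr : ∀ x, Commute p (r x) := fun x => by
    induction x using MonoidAlgebra.induction_linear with
    | zero => rw [map_zero]; exact Commute.zero_right p
    | add x y hx hy => rw [map_add]; exact hx.add_right hy
    | single g c =>
      have : MonoidAlgebra.single g c = c • grp g := by simp
      rw [this, map_smul]
      exact (hcA (hT g).2.2).smul_right c
  refine ⟨pairHom θ r p hs hp hr, fun g => ?_⟩
  rw [pairHom_apply, pairHom_apply]
  simp only [map_zero, zero_mul, add_zero, zero_add, twist_grp, hθ]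
  change _ = grp g ⊗ₜ (counitSlice G A (α (grp g)) * p) +
    grp (θ g) ⊗ₜ (counitSlice G A (α (grp g)) * (1 - p))
  rw [← (hT g).1, ← (hT g).2.1, ← mul_add, ← TensorProduct.tmul_add, add_sub_cancel,
    ← Algebra.TensorProduct.one_def, mul_one]

end PairHomOfGenerators

/-! ### Factorization of actions of the symmetric group algebra -/

section SymmetricGroupDecomposition

/-- Conjugation by the longest element of the symmetric group. -/
def revConj (n : ℕ) : Equiv.Perm (Fin n) →* Equiv.Perm (Fin n) :=
  (MulAut.conj (Fin.revPerm : Equiv.Perm (Fin n))).toMonoidHom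

theorem revConj_revConj {n : ℕ} (g : Equiv.Perm (Fin n)) : revConj n (revConj n g) = g := by
  ext x
  simp [revConj, MulAut.conj_apply, Equiv.Perm.mul_apply, Equiv.Perm.inv_def]

theorem flip_eq_twist {n : ℕ} (x : MonoidAlgebra ℂ (Equiv.Perm (Fin n))) :
    flip n x = twist (revConj n) x := by
  refine LinearMap.congr_fun (linearMap_ext_grp (f := (flip n : _ →ₗ[ℂ] _))
    (f' := (twist (revConj n)).toAlgHom.toLinearMap) fun g => ?_) x
  change flip n (grp g) = twist (revConj n) (grp g)
  rw [twist_grp]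
  simp [flip, revConj]

theorem revConj_transp {n : ℕ} (i : Fin (n - 1)) : revConj n (transp i) = transp i.rev := by
  have h := flip_sGen i
  rw [flip_eq_twist, sGen, twist_grp, sGen] at h
  exact MonoidAlgebra.single_left_injective one_ne_zero h

theorem closure_transpSet (n : ℕ) : Submonoid.closure (transpSet n) = ⊤ := by
  cases n with
  | zero =>
    rw [eq_top_iff]
    intro x _
    rw [Subsingleton.elim x 1]
    exact Submonoid.one_mem _
  | succ n => exact Equiv.Perm.mclosure_swap_castSucc_succ n

variable {n : ℕ} {A : Type*} [CStarAlgebra A] [PartialOrder A] [StarOrderedRing A]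

theorem exists_intertwines (hn : 3 ≤ n)
    {α : MonoidAlgebra ℂ (Equiv.Perm (Fin n)) →⋆ₐ[ℂ]
      MonoidAlgebra ℂ (Equiv.Perm (Fin n)) ⊗[ℂ] A}
    (hl : PreservesLengthOne α) (ht : PreservesTraceZeroTwo α) :
    ∃ Φ : DoubleAlg (Equiv.Perm (Fin n)) →⋆ₐ[ℂ] A, Intertwines (revConj n) α Φ := by
  choose v hv using hl
  set u : Fin (n - 1) → Fin (n - 1) → A := fun i j => v j i with hu
  have h : ∀ j, α (sGen j) = ∑ i, sGen i ⊗ₜ u i j := hv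
  set o : Fin (n - 1) := ⟨0, by omega⟩
  have ho : o.val = 0 := rfl
  have h1 : 1 < n - 1 := by omega
  have hp := (fibreUnitary_of_preserves h ht).pathUnitary
  have h0 := first_mul_first_last_of_preserves h ht ho h1
  have hcomm := first_sq_commute_of_preserves h ht ho h1
  have hr : ∀ j, counitSlice _ A (α (sGen j)) = ∑ i, u i j := fun j => by
    rw [h, map_sum]
    exact Finset.sum_congr rfl fun i _ => counitSlice_grp_tmul _ _
  set p := u o o * u o o with hpdef
  -- Under `p` only the diagonal of `u` survives, and under `1 - p` only the antidiagonal; in each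
  -- case `r(s_j)` reduces to a single entry.
  have z₁ : ∀ i j, i ≠ j → u i j * p = 0 := fun i j hij => by
    rw [hpdef, ← mul_assoc, hp.swap (hp.first_mul_eq_zero ho h1 h0 hij), zero_mul]
  have z₂ : ∀ i j, i ≠ j.rev → u i j * (1 - p) = 0 := fun i j hij => by
    have : 1 - p = u o o.rev * u o o.rev := by rw [← hp.first_row_sq ho h1]; abel
    rw [this, ← mul_assoc, hp.swap (hp.last_mul_eq_zero ho h1 h0 fun h => hij (by
      rw [h, Fin.rev_rev])), zero_mul]
  refine exists_intertwines_of_generators revConj_revConj α (closure_transpSet n) (p := p)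
    (by rw [hpdef, star_mul, hp.selfAdjoint]) (hp.first_sq_idempotent ho h1 h0) ?_ ?_ ?_
  · rintro _ ⟨j, rfl⟩
    change α (sGen j) * _ = sGen j ⊗ₜ (counitSlice _ A (α (sGen j)) * p)
    rw [hr, h, Finset.sum_mul, Finset.sum_mul, TensorProduct.tmul_sum]
    refine Finset.sum_congr rfl fun i _ => ?_
    rw [Algebra.TensorProduct.tmul_mul_tmul, mul_one]
    by_cases hij : i = j
    · rw [hij]
    · rw [z₁ i j hij, TensorProduct.tmul_zero, TensorProduct.tmul_zero]
  · rintro _ ⟨j, rfl⟩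
    rw [revConj_transp]
    change α (sGen j) * _ = sGen j.rev ⊗ₜ (counitSlice _ A (α (sGen j)) * (1 - p))
    rw [hr, h, Finset.sum_mul, Finset.sum_mul, TensorProduct.tmul_sum]
    refine Finset.sum_congr rfl fun i _ => ?_
    rw [Algebra.TensorProduct.tmul_mul_tmul, mul_one]
    by_cases hij : i = j.rev
    · rw [hij]
    · rw [z₂ i j hij, TensorProduct.tmul_zero, TensorProduct.tmul_zero]
  · rintro _ ⟨j, rfl⟩
    change Commute _ (α (sGen j))
    rw [h]
    refine Commute.sum_right _ _ _ fun i _ => ?_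
    rw [commute_iff_eq, Algebra.TensorProduct.tmul_mul_tmul, Algebra.TensorProduct.tmul_mul_tmul,
      one_mul, mul_one, (hcomm i j).eq]

end SymmetricGroupDecomposition

/-! ### Word length, the Dirac operator and isometric actions -/

section Isometric

variable {n : ℕ} {A : Type*} [CStarAlgebra A]
variable {α : MonoidAlgebra ℂ (Equiv.Perm (Fin n)) →⋆ₐ[ℂ]
  MonoidAlgebra ℂ (Equiv.Perm (Fin n)) ⊗[ℂ] A}

theorem dirac_grp {G : Type*} [Group G] [Fintype G] (S : Set G) (g : G) :
    dirac S (grp g) = (wordLength S g : ℂ) • grp g := by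
  classical
  change ∑ h, MonoidAlgebra.single h ((wordLength S h : ℂ) * (grp g).coeff h) = _
  rw [Finset.sum_eq_single g]
  · simp
  · intro h _ hg
    simp [Ne.symm hg]
  · simp

theorem wordLength_eq_one_iff {G : Type*} [Group G] {S : Set G} (h1 : 1 ∉ S) (g : G) :
    wordLength S g = 1 ↔ g ∈ S := by
  constructor
  · intro h
    have hne : {k | ∃ l : List G, l.length = k ∧ (∀ s ∈ l, s ∈ S) ∧ l.prod = g}.Nonempty := by
      -- The infimum of the empty set is `0`, so the value `1` means that `g` really is a product of
      -- elements of `S`.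
      by_contra hne
      rw [Set.not_nonempty_iff_eq_empty] at hne
      rw [wordLength, hne, Nat.sInf_empty] at h
      exact zero_ne_one h
    obtain ⟨l, hl, hs, rfl⟩ := Nat.sInf_mem hne
    rw [wordLength] at h
    rw [h, List.length_eq_one_iff] at hl
    obtain ⟨a, rfl⟩ := hl
    simpa using hs
  · intro h
    refine le_antisymm (Nat.sInf_le ⟨[g], rfl, by simpa using h, by simp⟩) ?_
    refine le_csInf ⟨1, [g], rfl, by simpa using h, by simp⟩ ?_
    rintro k ⟨l, rfl, -, hl⟩
    rw [Nat.one_le_iff_ne_zero]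
    intro h0
    rw [List.length_eq_zero_iff] at h0
    rw [h0, List.prod_nil] at hl
    exact h1 (hl ▸ h)

theorem slice_rTensor_dirac {G : Type*} [Group G] [Fintype G] (S : Set G) (g : G)
    (t : MonoidAlgebra ℂ G ⊗[ℂ] A) :
    slice g (LinearMap.rTensor A (dirac S) t) = (wordLength S g : ℂ) • slice g t := by
  classical
  rw [eq_sum_slice t]
  simp only [map_sum, LinearMap.rTensor_tmul, dirac_grp, ← TensorProduct.smul_tmul', map_smul,
    slice_grp_tmul]
  rw [Finset.smul_sum]
  refine Finset.sum_congr rfl fun h _ => ?_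
  split_ifs with hg
  · rw [hg]
  · rw [smul_zero, smul_zero]

theorem one_notMem_transpSet : (1 : Equiv.Perm (Fin n)) ∉ transpSet n := by
  rintro ⟨i, hi⟩
  have := congrArg Fin.val (DFunLike.congr_fun hi ⟨i.val, by omega⟩)
  rw [val_transp] at this
  simp [natTransp] at this

/-- Comparing coefficients in `α ∘ D = (D ⊗ id) ∘ α` at `s_j` kills those at every `g` whose length
is not `1`. -/
theorem preservesLengthOne_of_isIsometric [PartialOrder A] [StarOrderedRing A]
    (h : IsIsometric (transpSet n) α) : PreservesLengthOne α := by
  intro j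
  refine ⟨fun i => slice (transp i) (α (sGen j)), ?_⟩
  have hd := h.dirac (sGen j)
  rw [sGen, dirac_grp, (wordLength_eq_one_iff one_notMem_transpSet _).mpr ⟨j, rfl⟩, Nat.cast_one,
    one_smul] at hd
  refine slice_ext fun g => ?_
  by_cases hg : g ∈ transpSet n
  · obtain ⟨i, rfl⟩ := hg
    rw [slice_sum_sGen]
  · have e := congrArg (slice g) hd
    rw [slice_rTensor_dirac] at e
    have hw : (wordLength (transpSet n) g : ℂ) - 1 ≠ 0 := by
      rw [sub_ne_zero]
      exact_mod_cast fun h => hg ((wordLength_eq_one_iff one_notMem_transpSet g).mp h)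
    have : slice g (α (sGen j)) = 0 := by
      refine (smul_eq_zero.mp ?_).resolve_left hw
      rw [sub_smul, one_smul, sub_eq_zero]
      exact e.symm
    rw [this, map_sum]
    refine (Finset.sum_eq_zero fun i _ => ?_).symm
    rw [sGen, slice_grp_tmul, if_neg fun h => hg ⟨i, h⟩]

theorem preservesTraceZeroTwo_of_isIsometric [PartialOrder A] [StarOrderedRing A]
    (h : IsIsometric (transpSet n) α) : PreservesTraceZeroTwo α := by
  intro k l
  rw [h.trace, sGen_mul_sGen]
  change (grp (pairProd n (k, l))).coeff 1 • (1 : A) = _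
  have : pairProd n (k, l) = 1 ↔ k = l := by
    rw [pairProd, mul_eq_one_iff_eq_inv, transp, transp, Equiv.swap_inv]
    exact transp_injective.eq_iff
  simp only [MonoidAlgebra.coeff_single, Finsupp.single_apply, this]
  split_ifs <;> simp

theorem wordLength_hom_le {G : Type*} [Group G] {S : Set G} (hS : Submonoid.closure S = ⊤)
    {θ : G →* G} (hθS : ∀ s ∈ S, θ s ∈ S) (g : G) : wordLength S (θ g) ≤ wordLength S g := by
  have hne : {k | ∃ l : List G, l.length = k ∧ (∀ s ∈ l, s ∈ S) ∧ l.prod = g}.Nonempty := by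
    obtain ⟨l, hl, hg⟩ := Submonoid.exists_list_of_mem_closure
      (hS ▸ Submonoid.mem_top g : g ∈ Submonoid.closure S)
    exact ⟨_, l, rfl, hl, hg⟩
  obtain ⟨l, hl, hs, hg⟩ := Nat.sInf_mem hne
  refine Nat.sInf_le ⟨l.map θ, ?_, ?_, ?_⟩
  · rw [List.length_map, hl]; rfl
  · intro s hs'
    obtain ⟨t, ht, rfl⟩ := List.mem_map.mp hs'
    exact hθS t (hs t ht)
  · rw [← map_list_prod, hg]

/-- Since `θ` is an involution mapping `S` into itself, `g` and `θ g` have equal length, and `θ g =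
1` only for `g = 1`; these are the only group elements occurring in `α(g)`. -/
theorem isIsometric_of_intertwines {G : Type*} [Group G] [Fintype G] {S : Set G}
    (hS : Submonoid.closure S = ⊤) {θ : G →* G} (hθ : ∀ g, θ (θ g) = g)
    (hθS : ∀ s ∈ S, θ s ∈ S) [PartialOrder A] [StarOrderedRing A]
    {α : MonoidAlgebra ℂ G →⋆ₐ[ℂ] MonoidAlgebra ℂ G ⊗[ℂ] A} {Φ : DoubleAlg G →⋆ₐ[ℂ] A}
    (h : Intertwines θ α Φ) : IsIsometric S α where
  trace x := by
    classical
    refine LinearMap.congr_fun (linearMap_ext_grp (f := slice 1 ∘ₗ α.toAlgHom.toLinearMap)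
      (f' := (coeffAt 1).smulRight (1 : A)) fun g => ?_) x
    change slice 1 (α (grp g)) = (grp g).coeff 1 • (1 : A)
    rw [h, map_add, slice_grp_tmul, slice_grp_tmul, MonoidAlgebra.coeff_single,
      Finsupp.single_apply]
    by_cases hg : g = 1
    · subst hg
      rw [map_one, if_pos rfl, if_pos rfl, if_pos rfl, ← map_add, one_smul, ← map_one Φ]
      congr 1
      ext1 <;> simp [grp_one]
    · have : θ g ≠ 1 := fun hg' => hg (by rw [← hθ g, hg', map_one])
      rw [if_neg hg, if_neg this, if_neg hg, add_zero, zero_smul]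
  dirac x := by
    refine LinearMap.congr_fun (linearMap_ext_grp (f := α.toAlgHom.toLinearMap ∘ₗ QIso.dirac S)
      (f' := LinearMap.rTensor A (QIso.dirac S) ∘ₗ α.toAlgHom.toLinearMap) fun g => ?_) x
    change α (QIso.dirac S (grp g)) = LinearMap.rTensor A (QIso.dirac S) (α (grp g))
    have hw : wordLength S (θ g) = wordLength S g := by
      refine le_antisymm (wordLength_hom_le hS hθS g) ?_
      conv_lhs => rw [← hθ g]
      exact wordLength_hom_le hS hθS _
    rw [dirac_grp, map_smul, h, map_add, LinearMap.rTensor_tmul, LinearMap.rTensor_tmul, dirac_grp,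
      dirac_grp, hw, smul_add, TensorProduct.smul_tmul', TensorProduct.smul_tmul']

theorem revConj_mem_transpSet (s : Equiv.Perm (Fin n)) (hs : s ∈ transpSet n) :
    revConj n s ∈ transpSet n := by
  obtain ⟨i, rfl⟩ := hs
  exact ⟨i.rev, (revConj_transp i).symm⟩

end Isometric

/-! ### The comultiplication on two copies of the group algebra -/

section DoubleComul

variable {G : Type*} [Group G]

theorem doubleAlg_mem_submodule {M : Submodule ℂ (DoubleAlg G)} (h₁ : ∀ g, (grp g, 0) ∈ M)
    (h₂ : ∀ g, (0, grp g) ∈ M) (x : DoubleAlg G) : x ∈ M := by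
  have e₁ : M.mkQ ∘ₗ LinearMap.inl ℂ _ _ = 0 := linearMap_ext_grp fun g =>
    (Submodule.Quotient.mk_eq_zero M).mpr (h₁ g)
  have e₂ : M.mkQ ∘ₗ LinearMap.inr ℂ _ _ = 0 := linearMap_ext_grp fun g =>
    (Submodule.Quotient.mk_eq_zero M).mpr (h₂ g)
  have : M.mkQ = 0 := LinearMap.prod_ext e₁ e₂
  exact (Submodule.Quotient.mk_eq_zero M).mp (LinearMap.congr_fun this x)

theorem doubleAlg_linearMap_ext {V : Type*} [AddCommMonoid V] [Module ℂ V]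
    {f f' : DoubleAlg G →ₗ[ℂ] V} (h₁ : ∀ g, f (grp g, 0) = f' (grp g, 0))
    (h₂ : ∀ g, f (0, grp g) = f' (0, grp g)) : f = f' :=
  LinearMap.prod_ext (linearMap_ext_grp h₁) (linearMap_ext_grp h₂)

theorem doubleAlg_one : (1 : DoubleAlg G) = (1, 0) + (0, 1) := by ext1 <;> simp

variable (θ : G →* G)

/-- The unitary representation underlying the comultiplication of the doubling. -/
def comulRep : G →* DoubleAlg G ⊗[ℂ] DoubleAlg G where
  -- This is the intended value of `Δ` at `(g, θ(g))`. These elements form a copy of the group,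
  -- which generates both summands together with the projection `(1, 0)`.
  toFun g := (grp g, grp (θ g)) ⊗ₜ (grp g, 0) + (grp (θ g), grp g) ⊗ₜ (0, grp (θ g))
  map_one' := by
    simp only [map_one, grp_one]
    rw [← TensorProduct.tmul_add, ← doubleAlg_one]
    rfl
  map_mul' g h := by
    simp only [map_mul, add_mul, mul_add, Algebra.TensorProduct.tmul_mul_tmul, Prod.mk_mul_mk,
      grp_mul, mul_zero, zero_mul, Prod.mk_zero_zero, TensorProduct.tmul_zero, add_zero, zero_add]

/-- The image of the first central projection under the comultiplication of the doubling. -/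
def comulProj (G : Type*) [Group G] : DoubleAlg G ⊗[ℂ] DoubleAlg G :=
  (1, 0) ⊗ₜ (1, 0) + (0, 1) ⊗ₜ (0, 1)

theorem one_sub_comulProj :
    1 - comulProj G = (1, 0) ⊗ₜ (0, 1) + (0, 1) ⊗ₜ (1, 0) := by
  rw [Algebra.TensorProduct.one_def, comulProj, sub_eq_iff_eq_add]
  conv_lhs => rw [doubleAlg_one]
  simp only [TensorProduct.add_tmul, TensorProduct.tmul_add]
  abel

theorem star_comulRep (g : G) : star (comulRep θ g) = comulRep θ g⁻¹ := by
  have h : ∀ x y : MonoidAlgebra ℂ G, star ((x, y) : DoubleAlg G) = (star x, star y) :=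
    fun _ _ => rfl
  simp only [comulRep, MonoidHom.coe_mk, OneHom.coe_mk, star_add, TensorProduct.star_tmul, h,
    star_grp, star_zero, map_inv]

theorem commute_comulProj (x : MonoidAlgebra ℂ G) :
    Commute (comulProj G) (groupLift (comulRep θ) (star_comulRep θ) x) := by
  have : LinearMap.mulLeft ℂ (comulProj G) ∘ₗ
        (groupLift (comulRep θ) (star_comulRep θ)).toAlgHom.toLinearMap =
      LinearMap.mulRight ℂ (comulProj G) ∘ₗ
        (groupLift (comulRep θ) (star_comulRep θ)).toAlgHom.toLinearMap := by
    refine linearMap_ext_grp fun g => ?_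
    change comulProj G * groupLift (comulRep θ) (star_comulRep θ) (grp g) =
      groupLift (comulRep θ) (star_comulRep θ) (grp g) * comulProj G
    rw [groupLift_grp]
    simp only [comulRep, MonoidHom.coe_mk, OneHom.coe_mk, comulProj, add_mul, mul_add,
      Algebra.TensorProduct.tmul_mul_tmul, Prod.mk_mul_mk, mul_zero, zero_mul, mul_one, one_mul,
      Prod.mk_zero_zero, TensorProduct.tmul_zero, add_zero, zero_add]
  exact LinearMap.congr_fun this x

theorem star_comulProj : star (comulProj G) = comulProj G := by
  have h : ∀ x y : MonoidAlgebra ℂ G, star ((x, y) : DoubleAlg G) = (star x, star y) :=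
    fun _ _ => rfl
  simp only [comulProj, star_add, TensorProduct.star_tmul, h, star_one, star_zero]

theorem comulProj_mul_self : comulProj G * comulProj G = comulProj G := by
  simp only [comulProj, add_mul, mul_add, Algebra.TensorProduct.tmul_mul_tmul, Prod.mk_mul_mk,
    mul_one, mul_zero, Prod.mk_zero_zero, TensorProduct.tmul_zero, add_zero, zero_add]

/-- The comultiplication of the doubling, on two copies of the group algebra. -/
def doubleComul : DoubleAlg G →⋆ₐ[ℂ] DoubleAlg G ⊗[ℂ] DoubleAlg G :=
  pairHom θ (groupLift (comulRep θ) (star_comulRep θ)) (comulProj G) star_comulProj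
    comulProj_mul_self (commute_comulProj θ)

theorem doubleComul_apply (x : DoubleAlg G) : doubleComul θ x =
    groupLift (comulRep θ) (star_comulRep θ) x.1 * comulProj G +
      groupLift (comulRep θ) (star_comulRep θ) (twist θ x.2) * (1 - comulProj G) := rfl

theorem doubleComul_inl (g : G) : doubleComul θ (grp g, 0) =
    (grp g, 0) ⊗ₜ (grp g, 0) + (0, grp g) ⊗ₜ (0, grp (θ g)) := by
  rw [doubleComul_apply]
  simp only [map_zero, zero_mul, add_zero, groupLift_grp]
  simp only [comulRep, MonoidHom.coe_mk, OneHom.coe_mk, comulProj, add_mul, mul_add,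
    Algebra.TensorProduct.tmul_mul_tmul, Prod.mk_mul_mk, mul_one, mul_zero,
    Prod.mk_zero_zero, TensorProduct.tmul_zero, add_zero, zero_add]

variable {θ}

theorem doubleComul_inr (hθ : ∀ g, θ (θ g) = g) (g : G) : doubleComul θ (0, grp g) =
    (grp g, 0) ⊗ₜ (0, grp g) + (0, grp g) ⊗ₜ (grp (θ g), 0) := by
  rw [doubleComul_apply]
  simp only [map_zero, zero_mul, zero_add, groupLift_grp, twist_grp, one_sub_comulProj]
  simp only [comulRep, MonoidHom.coe_mk, OneHom.coe_mk, add_mul, mul_add, hθ,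
    Algebra.TensorProduct.tmul_mul_tmul, Prod.mk_mul_mk, mul_one, mul_zero,
    Prod.mk_zero_zero, TensorProduct.tmul_zero, add_zero, zero_add]

end DoubleComul

/-! ### Transport of the comultiplication along a homomorphism -/

section PushComul

variable {G : Type*} [Group G]

/-- The ⋆-homomorphism `Φ ⊗ Φ`. -/
def tensorHom {C : Type*} [Ring C] [StarRing C] [Algebra ℂ C] [StarModule ℂ C]
    {B : Type*} [Ring B] [StarRing B] [Algebra ℂ B] [StarModule ℂ B]
    (Φ : C →⋆ₐ[ℂ] B) : C ⊗[ℂ] C →⋆ₐ[ℂ] B ⊗[ℂ] B where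
  __ := Algebra.TensorProduct.map Φ.toAlgHom Φ.toAlgHom
  map_star' t := by
    change TensorProduct.map Φ.toAlgHom.toLinearMap Φ.toAlgHom.toLinearMap (star t) =
      star (TensorProduct.map Φ.toAlgHom.toLinearMap Φ.toAlgHom.toLinearMap t)
    induction t using TensorProduct.induction_on with
    | zero => simp
    | add s t hs ht => rw [star_add, map_add, map_add, star_add, hs, ht]
    | tmul x y =>
      simp only [TensorProduct.star_tmul, TensorProduct.map_tmul]
      exact congrArg₂ _ (map_star Φ x) (map_star Φ y)

theorem tensorHom_tmul {C : Type*} [Ring C] [StarRing C] [Algebra ℂ C] [StarModule ℂ C]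
    {B : Type*} [Ring B] [StarRing B] [Algebra ℂ B] [StarModule ℂ B]
    (Φ : C →⋆ₐ[ℂ] B) (x y : C) : tensorHom Φ (x ⊗ₜ y) = Φ x ⊗ₜ Φ y := rfl

variable (θ : G →* G) {B : Type*} [CStarAlgebra B] [PartialOrder B] [StarOrderedRing B]

/-- The map `(Φ ⊗ Φ) Δ`, with values in the minimal tensor product. -/
def pushComul (Φ : DoubleAlg G →⋆ₐ[ℂ] B) : DoubleAlg G →⋆ₐ[ℂ] MinTensor B B :=
  (toMin B B).comp ((tensorHom Φ).comp (doubleComul θ))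

theorem pushComul_apply (Φ : DoubleAlg G →⋆ₐ[ℂ] B) (x : DoubleAlg G) :
    pushComul θ Φ x = toMin B B (tensorHom Φ (doubleComul θ x)) := rfl

theorem pushComul_inl (Φ : DoubleAlg G →⋆ₐ[ℂ] B) (g : G) : pushComul θ Φ (grp g, 0) =
    toMin B B (Φ (grp g, 0) ⊗ₜ Φ (grp g, 0) + Φ (0, grp g) ⊗ₜ Φ (0, grp (θ g))) := by
  rw [pushComul_apply, doubleComul_inl, map_add, tensorHom_tmul, tensorHom_tmul]

variable {θ}

theorem pushComul_inr (hθ : ∀ g, θ (θ g) = g) (Φ : DoubleAlg G →⋆ₐ[ℂ] B) (g : G) :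
    pushComul θ Φ (0, grp g) =
      toMin B B (Φ (grp g, 0) ⊗ₜ Φ (0, grp g) + Φ (0, grp g) ⊗ₜ Φ (grp (θ g), 0)) := by
  rw [pushComul_apply, doubleComul_inr hθ, map_add, tensorHom_tmul, tensorHom_tmul]

theorem prodFunctional_pullState {C : Type*} [CStarAlgebra C] [PartialOrder C] [StarOrderedRing C]
    (Φ : C →⋆ₐ[ℂ] B) (φ ψ : CState B) (t : C ⊗[ℂ] C) :
    prodFunctional (pullState Φ φ) (pullState Φ ψ) (toMin C C t) =
      prodFunctional φ ψ (toMin B B (tensorHom Φ t)) := by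
  induction t using TensorProduct.induction_on with
  | zero => simp
  | add s t hs ht => simp only [map_add, hs, ht]
  | tmul x y => rw [tensorHom_tmul, prodFunctional_toMin, prodFunctional_toMin]; rfl

end PushComul

/-! ### Uniqueness of the intertwiner and compatibility with comultiplications -/

section Intertwiners

variable {G : Type*} [Group G] {θ : G →* G} {B : Type*} [CStarAlgebra B]
variable {β : MonoidAlgebra ℂ G →⋆ₐ[ℂ] MonoidAlgebra ℂ G ⊗[ℂ] B} {Φ : DoubleAlg G →⋆ₐ[ℂ] B}

theorem Intertwines.slice_eq (h : Intertwines θ β Φ) {g : G} (hg : θ g ≠ g) :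
    slice g (β (grp g)) = Φ (grp g, 0) := by
  classical
  rw [h, map_add, slice_grp_tmul, slice_grp_tmul, if_pos rfl, if_neg hg, add_zero]

theorem Intertwines.counitSlice_eq (h : Intertwines θ β Φ) (g : G) :
    counitSlice G B (β (grp g)) = Φ (grp g, grp (θ g)) := by
  rw [h, map_add, counitSlice_grp_tmul, counitSlice_grp_tmul, ← map_add]
  congr 1
  ext1 <;> simp

/-- For nontrivial `θ`, the homomorphism `Φ` is determined by the coaction. -/
theorem Intertwines.unique (hθ : ∀ g, θ (θ g) = g) {s : G} (hs : θ s ≠ s)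
    {Φ' : DoubleAlg G →⋆ₐ[ℂ] B} (h : Intertwines θ β Φ) (h' : Intertwines θ β Φ') : Φ = Φ' := by
  have hs' : θ s⁻¹ ≠ s⁻¹ := fun h => hs (by rwa [map_inv, inv_inj] at h)
  refine doubleAlg_hom_ext hθ (fun g => ?_) ?_
  · rw [← h.counitSlice_eq, ← h'.counitSlice_eq]
  · have : ((1, 0) : DoubleAlg G) = (grp s, 0) * (grp s⁻¹, 0) := by
      rw [Prod.mk_mul_mk, grp_mul, mul_inv_cancel, mul_zero, grp_one]
    rw [this, map_mul, map_mul, ← h.slice_eq hs, ← h'.slice_eq hs, ← h.slice_eq hs',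
      ← h'.slice_eq hs']

variable [PartialOrder B] [StarOrderedRing B]

/-- The left hand side of the coaction identity, on group elements. -/
theorem Intertwines.coassoc_left (h : Intertwines θ β Φ) (hθ : ∀ g, θ (θ g) = g) (g : G) :
    LinearMap.lTensor (MonoidAlgebra ℂ G) (toMin B B).toAlgHom.toLinearMap
      (TensorProduct.assoc ℂ (MonoidAlgebra ℂ G) B B
        (LinearMap.rTensor B β.toAlgHom.toLinearMap (β (grp g)))) =
      grp g ⊗ₜ pushComul θ Φ (grp g, 0) + grp (θ g) ⊗ₜ pushComul θ Φ (0, grp (θ g)) := by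
  have hβ : ∀ g, β.toAlgHom.toLinearMap (grp g) =
    grp g ⊗ₜ Φ (grp g, 0) + grp (θ g) ⊗ₜ Φ (0, grp (θ g)) := h
  have hm : ∀ t, (toMin B B).toAlgHom.toLinearMap t = toMin B B t := fun _ => rfl
  rw [h g]
  simp only [map_add, LinearMap.rTensor_tmul, hβ, TensorProduct.add_tmul, hθ,
    TensorProduct.assoc_tmul, LinearMap.lTensor_tmul, hm, pushComul_inl, pushComul_inr hθ,
    TensorProduct.tmul_add]
  abel

/-- The coaction identity controls only a sum of two terms. Applying the counit gives agreement at
`(g, θ(g))`, slicing at an `s` moved by `θ` gives it at `(1, 0)`, and these elements determine a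
homomorphism. -/
theorem Intertwines.comul_comp (hθ : ∀ g, θ (θ g) = g) {s : G} (hs : θ s ≠ s)
    {ℍ : CompactQuantumGroup B} (h : Intertwines θ β Φ) (hβ : IsCoaction ℍ β) :
    ℍ.comul.comp Φ = pushComul θ Φ := by
  classical
  have key : ∀ g, grp g ⊗ₜ pushComul θ Φ (grp g, 0) + grp (θ g) ⊗ₜ pushComul θ Φ (0, grp (θ g)) =
      grp g ⊗ₜ[ℂ] ℍ.comul (Φ (grp g, 0)) + grp (θ g) ⊗ₜ ℍ.comul (Φ (0, grp (θ g))) := fun g => by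
    rw [← h.coassoc_left hθ, hβ.coassoc, h, map_add, LinearMap.lTensor_tmul, LinearMap.lTensor_tmul]
    rfl
  have ks : ∀ {s}, θ s ≠ s → ℍ.comul (Φ (grp s, 0)) = pushComul θ Φ (grp s, 0) := fun {s} hs => by
    have := congrArg (slice s) (key s)
    rw [map_add, map_add, slice_grp_tmul, slice_grp_tmul, slice_grp_tmul, slice_grp_tmul,
      if_pos rfl, if_neg hs, if_pos rfl, if_neg hs, add_zero, add_zero] at this
    exact this.symm
  have hs' : θ s⁻¹ ≠ s⁻¹ := fun h => hs (by rwa [map_inv, inv_inj] at h)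
  refine doubleAlg_hom_ext hθ (fun g => ?_) ?_
  · have := congrArg (counitSlice G (MinTensor B B)) (key g)
    rw [map_add, map_add, counitSlice_grp_tmul, counitSlice_grp_tmul, counitSlice_grp_tmul,
      counitSlice_grp_tmul, ← map_add, ← map_add, ← map_add] at this
    have e : ((grp g, 0) + (0, grp (θ g)) : DoubleAlg G) = (grp g, grp (θ g)) := by ext1 <;> simp
    rw [e] at this
    exact this.symm
  · have : ((1, 0) : DoubleAlg G) = (grp s, 0) * (grp s⁻¹, 0) := by
      rw [Prod.mk_mul_mk, grp_mul, mul_inv_cancel, mul_zero, grp_one]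
    rw [this, map_mul, map_mul]
    exact congrArg₂ _ (ks hs) (ks hs')

end Intertwiners

/-! ### The coaction on the group algebra -/

section DoublingCoaction

variable {G : Type*} [Group G] {θ : G →* G}

/-- The underlying ⋆-homomorphism of a ⋆-isomorphism. -/
def equivHom {C D : Type*} [Ring C] [Algebra ℂ C] [Star C] [Ring D] [Algebra ℂ D] [Star D]
    (e : C ≃⋆ₐ[ℂ] D) : C →⋆ₐ[ℂ] D where
  toFun := e
  map_one' := map_one e
  map_mul' := map_mul e
  map_zero' := map_zero e
  map_add' := map_add e
  commutes' c := by
    rw [Algebra.algebraMap_eq_smul_one, map_smul, map_one, Algebra.algebraMap_eq_smul_one]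
  map_star' := map_star e

theorem equivHom_apply {C D : Type*} [Ring C] [Algebra ℂ C] [Star C] [Ring D] [Algebra ℂ D]
    [Star D] (e : C ≃⋆ₐ[ℂ] D) (x : C) : equivHom e x = e x := rfl

/-- The group representation underlying the coaction of the doubling. -/
def coactionRep (θ : G →* G) {B : Type*} [CStarAlgebra B] (Φ : DoubleAlg G →⋆ₐ[ℂ] B) :
    G →* MonoidAlgebra ℂ G ⊗[ℂ] B where
  toFun g := grp g ⊗ₜ Φ (grp g, 0) + grp (θ g) ⊗ₜ Φ (0, grp (θ g))
  map_one' := by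
    rw [map_one, ← TensorProduct.tmul_add, ← map_add, grp_one, ← doubleAlg_one, map_one]
    rfl
  map_mul' g h := by
    simp only [map_mul θ, add_mul, mul_add, Algebra.TensorProduct.tmul_mul_tmul, ← map_mul Φ,
      Prod.mk_mul_mk, grp_mul, mul_zero, zero_mul, Prod.mk_zero_zero, map_zero,
      TensorProduct.tmul_zero, add_zero, zero_add]

/-- The coaction of the doubling on the group algebra. -/
def coactionOf (θ : G →* G) {B : Type*} [CStarAlgebra B] (Φ : DoubleAlg G →⋆ₐ[ℂ] B) :
    MonoidAlgebra ℂ G →⋆ₐ[ℂ] MonoidAlgebra ℂ G ⊗[ℂ] B :=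
  groupLift (coactionRep θ Φ) fun g => by
    have h : ∀ x y : MonoidAlgebra ℂ G, star ((x, y) : DoubleAlg G) = (star x, star y) :=
      fun _ _ => rfl
    simp only [coactionRep, MonoidHom.coe_mk, OneHom.coe_mk, star_add, TensorProduct.star_tmul,
      ← map_star, h, star_grp, star_zero, map_inv]

theorem intertwines_coactionOf (θ : G →* G) {B : Type*} [CStarAlgebra B]
    (Φ : DoubleAlg G →⋆ₐ[ℂ] B) : Intertwines θ (coactionOf θ Φ) Φ := fun g => groupLift_grp _ _ g

variable {A B : Type*} [CStarAlgebra A] [CStarAlgebra B] (e : DoubleAlg G ≃⋆ₐ[ℂ] A)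

theorem equiv_zero_zero : e (0, 0) = 0 := map_zero e

theorem Intertwines.eq_lTensor {β : MonoidAlgebra ℂ G →⋆ₐ[ℂ] MonoidAlgebra ℂ G ⊗[ℂ] B}
    {Φ : DoubleAlg G →⋆ₐ[ℂ] B} (h : Intertwines θ β Φ) (x : MonoidAlgebra ℂ G) :
    β x = LinearMap.lTensor (MonoidAlgebra ℂ G) (Φ.comp (equivHom e.symm)).toAlgHom.toLinearMap
      (coactionOf θ (equivHom e) x) := by
  refine LinearMap.congr_fun (linearMap_ext_grp (f := β.toAlgHom.toLinearMap)
    (f' := LinearMap.lTensor (MonoidAlgebra ℂ G)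
      (Φ.comp (equivHom e.symm)).toAlgHom.toLinearMap ∘ₗ
        (coactionOf θ (equivHom e)).toAlgHom.toLinearMap) fun g => ?_) x
  change β (grp g) = LinearMap.lTensor (MonoidAlgebra ℂ G) _ (coactionOf θ (equivHom e) (grp g))
  rw [h, intertwines_coactionOf, map_add, LinearMap.lTensor_tmul, LinearMap.lTensor_tmul]
  change _ = grp g ⊗ₜ Φ (e.symm (e (grp g, 0))) + grp (θ g) ⊗ₜ Φ (e.symm (e (0, grp (θ g))))
  rw [e.symm_apply_apply, e.symm_apply_apply]

theorem intertwines_of_eq_lTensor {β : MonoidAlgebra ℂ G →⋆ₐ[ℂ] MonoidAlgebra ℂ G ⊗[ℂ] B}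
    {α : MonoidAlgebra ℂ G →⋆ₐ[ℂ] MonoidAlgebra ℂ G ⊗[ℂ] A} {Φ : DoubleAlg G →⋆ₐ[ℂ] A}
    (hα : Intertwines θ α Φ) (Ψ : A →⋆ₐ[ℂ] B)
    (h : ∀ x, β x = LinearMap.lTensor (MonoidAlgebra ℂ G) Ψ.toAlgHom.toLinearMap (α x)) :
    Intertwines θ β (Ψ.comp Φ) := fun g => by
  rw [h, hα, map_add, LinearMap.lTensor_tmul, LinearMap.lTensor_tmul]
  rfl

end DoublingCoaction

/-! ### The compact quantum group structure -/

section DoublingQuantumGroup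

variable {G : Type*} [Group G] {θ : G →* G}

theorem dense_of_toMin_mem {A B : Type*} [CStarAlgebra A] [PartialOrder A] [StarOrderedRing A]
    [CStarAlgebra B] [PartialOrder B] [StarOrderedRing B] {M : Submodule ℂ (MinTensor A B)}
    (h : ∀ a b, toMin A B (a ⊗ₜ b) ∈ M) : Dense (M : Set (MinTensor A B)) := by
  refine Dense.mono ?_ (denseRange_toMin (A := A) (B := B))
  rintro _ ⟨t, rfl⟩
  induction t using TensorProduct.induction_on with
  | zero => rw [map_zero]; exact M.zero_mem
  | add s t hs ht => rw [map_add]; exact M.add_mem hs ht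
  | tmul a b => exact h a b

variable {A : Type*} [CStarAlgebra A] [PartialOrder A] [StarOrderedRing A]
variable (e : DoubleAlg G ≃⋆ₐ[ℂ] A)

theorem toMin_mem_of_basis {M : Submodule ℂ (MinTensor A A)}
    (h₁ : ∀ g h, toMin A A (e (grp g, 0) ⊗ₜ e (grp h, 0)) ∈ M)
    (h₂ : ∀ g h, toMin A A (e (grp g, 0) ⊗ₜ e (0, grp h)) ∈ M)
    (h₃ : ∀ g h, toMin A A (e (0, grp g) ⊗ₜ e (grp h, 0)) ∈ M)
    (h₄ : ∀ g h, toMin A A (e (0, grp g) ⊗ₜ e (0, grp h)) ∈ M) (a b : A) :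
    toMin A A (a ⊗ₜ b) ∈ M := by
  obtain ⟨x, rfl⟩ := e.surjective a
  obtain ⟨y, rfl⟩ := e.surjective b
  let f : DoubleAlg G →ₗ[ℂ] DoubleAlg G →ₗ[ℂ] MinTensor A A :=
    (TensorProduct.mk ℂ A A).compr₂ (toMin A A).toAlgHom.toLinearMap |>.compl₁₂
      (equivHom e).toAlgHom.toLinearMap (equivHom e).toAlgHom.toLinearMap
  have hx : ∀ g y, (f (grp g, 0)) y ∈ M ∧ (f (0, grp g)) y ∈ M := fun g y =>
    ⟨doubleAlg_mem_submodule (M := M.comap (f (grp g, 0))) (h₁ g) (h₂ g) y,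
      doubleAlg_mem_submodule (M := M.comap (f (0, grp g))) (h₃ g) (h₄ g) y⟩
  exact doubleAlg_mem_submodule (M := M.comap (f.flip y)) (fun g => (hx g y).1)
    (fun g => (hx g y).2) x

/-- The comultiplication of the doubling, transported along a ⋆-isomorphism. -/
def doublingMap (θ : G →* G) : A →⋆ₐ[ℂ] MinTensor A A :=
  (pushComul θ (equivHom e)).comp (equivHom e.symm)

theorem doublingMap_apply (x : DoubleAlg G) :
    doublingMap e θ (e x) = pushComul θ (equivHom e) x := by
  change pushComul θ (equivHom e) (e.symm (e x)) = _
  rw [e.symm_apply_apply]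

theorem doublingMap_inl (g : G) : doublingMap e θ (e (grp g, 0)) =
    toMin A A (e (grp g, 0) ⊗ₜ e (grp g, 0) + e (0, grp g) ⊗ₜ e (0, grp (θ g))) := by
  rw [doublingMap_apply, pushComul_inl]
  rfl

theorem doublingMap_inr (hθ : ∀ g, θ (θ g) = g) (g : G) : doublingMap e θ (e (0, grp g)) =
    toMin A A (e (grp g, 0) ⊗ₜ e (0, grp g) + e (0, grp g) ⊗ₜ e (grp (θ g), 0)) := by
  rw [doublingMap_apply, pushComul_inr hθ]
  rfl

theorem convState_apply (Δ : A →⋆ₐ[ℂ] MinTensor A A) (φ ψ : CState A) (a : A) :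
    (convState Δ φ ψ).1 a = prodFunctional φ ψ (Δ a) := rfl

theorem convState_doublingMap_inl (φ ψ : CState A) (g : G) :
    (convState (doublingMap e θ) φ ψ).1 (e (grp g, 0)) =
      φ.1 (e (grp g, 0)) * ψ.1 (e (grp g, 0)) +
        φ.1 (e (0, grp g)) * ψ.1 (e (0, grp (θ g))) := by
  rw [convState_apply, doublingMap_inl, map_add, map_add, prodFunctional_toMin,
    prodFunctional_toMin]

theorem convState_doublingMap_inr (hθ : ∀ g, θ (θ g) = g) (φ ψ : CState A) (g : G) :
    (convState (doublingMap e θ) φ ψ).1 (e (0, grp g)) =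
      φ.1 (e (grp g, 0)) * ψ.1 (e (0, grp g)) +
        φ.1 (e (0, grp g)) * ψ.1 (e (grp (θ g), 0)) := by
  rw [convState_apply, doublingMap_inr e hθ, map_add, map_add, prodFunctional_toMin,
    prodFunctional_toMin]

theorem cstate_ext {φ ψ : CState A} (h₁ : ∀ g, φ.1 (e (grp g, 0)) = ψ.1 (e (grp g, 0)))
    (h₂ : ∀ g, φ.1 (e (0, grp g)) = ψ.1 (e (0, grp g))) : φ = ψ := by
  refine Subtype.ext (DFunLike.ext _ _ fun a => ?_)
  obtain ⟨x, rfl⟩ := e.surjective a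
  exact LinearMap.congr_fun (doubleAlg_linearMap_ext
    (f := φ.1.toLinearMap ∘ₗ (equivHom e).toAlgHom.toLinearMap)
    (f' := ψ.1.toLinearMap ∘ₗ (equivHom e).toAlgHom.toLinearMap) h₁ h₂) x

/-- The doubling of the group algebra, as a compact quantum group on a C⋆-algebra isomorphic to two
copies of the group algebra. -/
def doublingGroup (hθ : ∀ g, θ (θ g) = g) : CompactQuantumGroup A where
  comul := doublingMap e θ
  coassoc φ ψ χ := by
    -- States are determined on the basis, where both convolutions become the same polynomial in
    -- complex numbers.
    refine cstate_ext e (fun g => ?_) fun g => ?_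
    · simp only [convState_doublingMap_inl, convState_doublingMap_inr e hθ, hθ]
      ring
    · simp only [convState_doublingMap_inl, convState_doublingMap_inr e hθ, hθ]
      ring
  cancel_left := by
    -- Every basis tensor is a single `Δ(a) (b ⊗ 1)`: choosing `b` in one summand of the algebra
    -- kills one of the two terms of `Δ(a)`.
    refine dense_of_toMin_mem (toMin_mem_of_basis e (fun g h => ?_) (fun g h => ?_)
      (fun g h => ?_) fun g h => ?_)
    · refine Submodule.subset_span ⟨e (grp h, 0), e (grp (h⁻¹ * g), 0), ?_⟩
      rw [doublingMap_inl, ← map_mul, add_mul, Algebra.TensorProduct.tmul_mul_tmul,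
        Algebra.TensorProduct.tmul_mul_tmul, ← map_mul, ← map_mul]
      simp [equiv_zero_zero]
    · refine Submodule.subset_span ⟨e (0, grp h), e (grp (h⁻¹ * g), 0), ?_⟩
      rw [doublingMap_inr e hθ, ← map_mul, add_mul, Algebra.TensorProduct.tmul_mul_tmul,
        Algebra.TensorProduct.tmul_mul_tmul, ← map_mul, ← map_mul]
      simp [equiv_zero_zero]
    · refine Submodule.subset_span ⟨e (0, grp (θ h)), e (0, grp ((θ h)⁻¹ * g)), ?_⟩
      rw [doublingMap_inr e hθ, ← map_mul, add_mul, Algebra.TensorProduct.tmul_mul_tmul,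
        Algebra.TensorProduct.tmul_mul_tmul, ← map_mul, ← map_mul]
      simp [equiv_zero_zero, hθ]
    · refine Submodule.subset_span ⟨e (grp (θ h), 0), e (0, grp ((θ h)⁻¹ * g)), ?_⟩
      rw [doublingMap_inl, ← map_mul, add_mul, Algebra.TensorProduct.tmul_mul_tmul,
        Algebra.TensorProduct.tmul_mul_tmul, ← map_mul, ← map_mul]
      simp [equiv_zero_zero, hθ]
  cancel_right := by
    refine dense_of_toMin_mem (toMin_mem_of_basis e (fun g h => ?_) (fun g h => ?_)
      (fun g h => ?_) fun g h => ?_)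
    · refine Submodule.subset_span ⟨e (grp g, 0), e (grp (g⁻¹ * h), 0), ?_⟩
      rw [doublingMap_inl, ← map_mul, add_mul, Algebra.TensorProduct.tmul_mul_tmul,
        Algebra.TensorProduct.tmul_mul_tmul, ← map_mul, ← map_mul]
      simp [equiv_zero_zero]
    · refine Submodule.subset_span ⟨e (0, grp g), e (0, grp (g⁻¹ * h)), ?_⟩
      rw [doublingMap_inr e hθ, ← map_mul, add_mul, Algebra.TensorProduct.tmul_mul_tmul,
        Algebra.TensorProduct.tmul_mul_tmul, ← map_mul, ← map_mul]
      simp [equiv_zero_zero]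
    · refine Submodule.subset_span ⟨e (0, grp g), e (grp ((θ g)⁻¹ * h), 0), ?_⟩
      rw [doublingMap_inr e hθ, ← map_mul, add_mul, Algebra.TensorProduct.tmul_mul_tmul,
        Algebra.TensorProduct.tmul_mul_tmul, ← map_mul, ← map_mul]
      simp [equiv_zero_zero]
    · refine Submodule.subset_span ⟨e (grp g, 0), e (0, grp ((θ g)⁻¹ * h)), ?_⟩
      rw [doublingMap_inl, ← map_mul, add_mul, Algebra.TensorProduct.tmul_mul_tmul,
        Algebra.TensorProduct.tmul_mul_tmul, ← map_mul, ← map_mul]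
      simp [equiv_zero_zero]

theorem isCoaction_doubling [Fintype G] (hθ : ∀ g, θ (θ g) = g) :
    IsCoaction (doublingGroup e hθ) (coactionOf θ (equivHom e)) where
  coassoc x := by
    have hi := intertwines_coactionOf θ (equivHom e)
    refine LinearMap.congr_fun (linearMap_ext_grp
      (f := LinearMap.lTensor (MonoidAlgebra ℂ G) (toMin A A).toAlgHom.toLinearMap ∘ₗ
        (TensorProduct.assoc ℂ (MonoidAlgebra ℂ G) A A).toLinearMap ∘ₗ
        LinearMap.rTensor A (coactionOf θ (equivHom e)).toAlgHom.toLinearMap ∘ₗ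
        (coactionOf θ (equivHom e)).toAlgHom.toLinearMap)
      (f' := LinearMap.lTensor (MonoidAlgebra ℂ G)
          (doublingGroup e hθ).comul.toAlgHom.toLinearMap ∘ₗ
        (coactionOf θ (equivHom e)).toAlgHom.toLinearMap) fun g => ?_) x
    refine (hi.coassoc_left hθ g).trans ?_
    change _ = LinearMap.lTensor (MonoidAlgebra ℂ G) _ (coactionOf θ (equivHom e) (grp g))
    rw [hi, map_add, LinearMap.lTensor_tmul, LinearMap.lTensor_tmul]
    change _ = grp g ⊗ₜ doublingMap e θ (e (grp g, 0)) +
      grp (θ g) ⊗ₜ doublingMap e θ (e (0, grp (θ g)))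
    rw [doublingMap_apply, doublingMap_apply]
  podles y ε hε := by
    have hi := intertwines_coactionOf θ (equivHom e)
    -- The span is all of the tensor product, so no approximation is needed: `h ⊗ a` is split by the
    -- central projections, and its halves come from `α(h)` and from `α(θ(h))`.
    refine ⟨y, ?_, fun g => by rw [sub_self, map_zero, norm_zero]; exact hε⟩
    rw [eq_sum_slice y]
    refine Submodule.sum_mem _ fun h _ => ?_
    set a := slice h y
    have hz : e (0, 0) = 0 := map_zero e
    have e₁ : coactionOf θ (equivHom e) (grp h) * (1 ⊗ₜ (e (grp h⁻¹, 0) * a)) =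
        grp h ⊗ₜ (e (1, 0) * a) := by
      rw [hi]
      simp only [equivHom_apply, add_mul, Algebra.TensorProduct.tmul_mul_tmul, mul_one, ← mul_assoc,
        ← map_mul, Prod.mk_mul_mk, grp_mul, mul_inv_cancel, mul_zero, zero_mul, hz,
        TensorProduct.tmul_zero, add_zero, grp_one]
    have e₂ : coactionOf θ (equivHom e) (grp (θ h)) * (1 ⊗ₜ (e (0, grp h⁻¹) * a)) =
        grp h ⊗ₜ (e (0, 1) * a) := by
      rw [hi]
      simp only [equivHom_apply, add_mul, Algebra.TensorProduct.tmul_mul_tmul, mul_one, ← mul_assoc,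
        ← map_mul, Prod.mk_mul_mk, grp_mul, mul_inv_cancel, mul_zero, zero_mul, hz, hθ,
        TensorProduct.tmul_zero, zero_add, grp_one]
    have e₃ : grp h ⊗ₜ[ℂ] a = grp h ⊗ₜ (e (1, 0) * a) + grp h ⊗ₜ (e (0, 1) * a) := by
      rw [← TensorProduct.tmul_add, ← add_mul, ← map_add, ← doubleAlg_one, map_one, one_mul]
    rw [e₃, ← e₁, ← e₂]
    exact Submodule.add_mem _ (Submodule.subset_span ⟨_, _, rfl⟩)
      (Submodule.subset_span ⟨_, _, rfl⟩)

variable {B : Type*} [CStarAlgebra B] [PartialOrder B] [StarOrderedRing B]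

theorem isQuantumGroupHom_of_intertwines (hθ : ∀ g, θ (θ g) = g) {s : G} (hs : θ s ≠ s)
    {ℍ : CompactQuantumGroup B} {β : MonoidAlgebra ℂ G →⋆ₐ[ℂ] MonoidAlgebra ℂ G ⊗[ℂ] B}
    {Φ : DoubleAlg G →⋆ₐ[ℂ] B} (h : Intertwines θ β Φ) (hβ : IsCoaction ℍ β) :
    IsQuantumGroupHom (doublingGroup e hθ) ℍ (Φ.comp (equivHom e.symm)) := by
  intro φ ψ
  refine Subtype.ext (DFunLike.ext _ _ fun a => ?_)
  obtain ⟨x, rfl⟩ := e.surjective a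
  have h₁ : tensorHom (Φ.comp (equivHom e.symm)) (tensorHom (equivHom e) (doubleComul θ x)) =
      tensorHom Φ (doubleComul θ x) := by
    induction doubleComul θ x using TensorProduct.induction_on with
    | zero => simp
    | add s t hs ht => rw [map_add, map_add, hs, ht, map_add]
    | tmul x y =>
      simp only [tensorHom_tmul, StarAlgHom.comp_apply, equivHom_apply, e.symm_apply_apply]
  change prodFunctional _ _ (doublingMap e θ (e x)) =
    prodFunctional φ ψ ((ℍ.comul.comp Φ) (e.symm (e x)))
  rw [doublingMap_apply, pushComul_apply, prodFunctional_pullState, h₁, e.symm_apply_apply,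
    h.comul_comp hθ hs hβ, pushComul_apply]

end DoublingQuantumGroup

/-! ### The universal property -/

section Universality

variable {n : ℕ}

theorem exists_revConj_ne (hn : 3 ≤ n) : ∃ s : Equiv.Perm (Fin n), revConj n s ≠ s := by
  refine ⟨transp (⟨0, by omega⟩ : Fin (n - 1)), fun h => ?_⟩
  rw [revConj_transp] at h
  have := congrArg Fin.val (transp_injective h)
  rw [Fin.val_rev] at this
  simp only at this
  omega

theorem isQISO_doubling {A : Type u} [CStarAlgebra A] [PartialOrder A] [StarOrderedRing A]
    (hn : 3 ≤ n) (e : DoubleAlg (Equiv.Perm (Fin n)) ≃⋆ₐ[ℂ] A) :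
    IsQISO (transpSet n) (doublingGroup e revConj_revConj)
      (coactionOf (revConj n) (equivHom e)) where
  coaction := isCoaction_doubling e revConj_revConj
  isometric := isIsometric_of_intertwines (closure_transpSet n) revConj_revConj
    revConj_mem_transpSet (intertwines_coactionOf _ _)
  universal B _ _ _ ℍ β hβ hi := by
    obtain ⟨s, hs⟩ := exists_revConj_ne hn
    obtain ⟨Φ, hΦ⟩ := exists_intertwines hn (preservesLengthOne_of_isIsometric hi)
      (preservesTraceZeroTwo_of_isIsometric hi)
    refine ⟨Φ.comp (equivHom e.symm),
      ⟨isQuantumGroupHom_of_intertwines e revConj_revConj hs hΦ hβ, hΦ.eq_lTensor e⟩, ?_⟩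
    rintro Ψ ⟨-, hΨ⟩
    have := hΦ.unique revConj_revConj hs
      (intertwines_of_eq_lTensor (intertwines_coactionOf _ (equivHom e)) Ψ hΨ)
    ext a
    rw [this]
    change Ψ a = Ψ (e (e.symm a))
    rw [e.apply_symm_apply]

end Universality

/-! ### Realization as a C⋆-algebra -/

section Realization

variable {G : Type*} [Group G] [DecidableEq G]

/-- The permutation matrices of the left regular representation. -/
def regularMatrix (I : Type*) (ι : G ≃ I) (g : G) : CStarMatrix I I ℂ :=
  CStarMatrix.ofMatrix fun x y => if ι.symm x = g * ι.symm y then 1 else 0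

theorem regularMatrix_apply (I : Type*) (ι : G ≃ I) (g : G) (x y : I) :
    regularMatrix I ι g x y = if ι.symm x = g * ι.symm y then 1 else 0 := rfl

/-- The left regular representation of a finite group, as matrices over an index type equivalent to
the group. -/
def regularHom (I : Type*) [Fintype I] [DecidableEq I] (ι : G ≃ I) : G →* CStarMatrix I I ℂ where
  toFun := regularMatrix I ι
  map_one' := by
    ext x y
    simp only [regularMatrix_apply, CStarMatrix.one_apply, one_mul, ι.symm.injective.eq_iff]
  map_mul' g h := by
    ext x y
    rw [CStarMatrix.mul_apply, Finset.sum_eq_single (ι (h * ι.symm y))]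
    · simp only [regularMatrix_apply, ι.symm_apply_apply, mul_assoc, if_true, mul_one]
    · intro z _ hz
      rw [regularMatrix_apply I ι h, if_neg, mul_zero]
      rintro hz'
      exact hz (by rw [← hz', ι.apply_symm_apply])
    · simp

theorem star_regularHom (I : Type*) [Fintype I] [DecidableEq I] (ι : G ≃ I) (g : G) :
    star (regularMatrix I ι g) = regularMatrix I ι g⁻¹ := by
  ext x y
  have h : ι.symm x = g⁻¹ * ι.symm y ↔ ι.symm y = g * ι.symm x := by
    rw [eq_inv_mul_iff_mul_eq, eq_comm]
  simp only [CStarMatrix.star_apply, regularMatrix_apply, h]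
  split_ifs <;> simp

/-- The left regular representation of the group algebra. -/
def regularRep (I : Type*) [Fintype I] [DecidableEq I] (ι : G ≃ I) :
    MonoidAlgebra ℂ G →⋆ₐ[ℂ] CStarMatrix I I ℂ :=
  groupLift (regularHom I ι) (star_regularHom I ι)

/-- The coefficient at `g` is the matrix entry in row `ι g` and column `ι 1`. -/
theorem regularRep_injective (I : Type*) [Fintype I] [DecidableEq I] (ι : G ≃ I) :
    Function.Injective (regularRep I ι) := by
  have h : ∀ (x : MonoidAlgebra ℂ G) (g : G), regularRep I ι x (ι g) (ι 1) = x.coeff g := by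
    intro x g
    induction x using MonoidAlgebra.induction_linear with
    | zero => rw [map_zero]; rfl
    | add x y hx hy => rw [map_add, CStarMatrix.add_apply, hx, hy]; rfl
    | single k c =>
      have e : MonoidAlgebra.single k c = c • grp k := by simp
      have hk : regularRep I ι (grp k) = regularMatrix I ι k := groupLift_grp _ _ k
      rw [e, map_smul, CStarMatrix.smul_apply, hk]
      rw [regularMatrix_apply]
      simp [Finsupp.single_apply, eq_comm]
  intro x y hxy
  ext g
  rw [← h, ← h, hxy]

open Classical in
/-- Two copies of the group algebra of a finite group form a C⋆-algebra, in every universe. -/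
theorem exists_realization (G : Type) [Group G] [Fintype G] :
    ∃ (A : Type u) (_ : CStarAlgebra A) (_ : PartialOrder A) (_ : StarOrderedRing A),
      Nonempty (DoubleAlg G ≃⋆ₐ[ℂ] A) := by
  -- Indexing the matrices by a lifted copy of the group puts the algebra in the required universe.
  -- Its C⋆-norm comes from the closed, finite-dimensional range in the matrices.
  let ρ := regularRep (G := G) (ULift.{u} G) Equiv.ulift.symm
  let F := (ρ.comp (StarAlgHom.fst ℂ (MonoidAlgebra ℂ G) (MonoidAlgebra ℂ G))).prod
    (ρ.comp (StarAlgHom.snd ℂ (MonoidAlgebra ℂ G) (MonoidAlgebra ℂ G)))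
  have hF : Function.Injective F := by
    rintro ⟨x, y⟩ ⟨x', y'⟩ h
    exact Prod.ext (regularRep_injective _ _ (congrArg Prod.fst h))
      (regularRep_injective _ _ (congrArg Prod.snd h))
  have hc : IsClosed (F.range : Set (CStarMatrix (ULift.{u} G) (ULift.{u} G) ℂ ×
      CStarMatrix (ULift.{u} G) (ULift.{u} G) ℂ)) := by
    have := Submodule.closed_of_finiteDimensional (LinearMap.range F.toAlgHom.toLinearMap)
    exact this
  let _ : CStarAlgebra F.range := haveI := hc; inferInstance
  let _ : PartialOrder F.range := CStarAlgebra.spectralOrder _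
  exact ⟨F.range, inferInstance, inferInstance, CStarAlgebra.spectralOrderedRing _,
    ⟨StarAlgEquiv.ofBijective F.rangeRestrict
      ⟨fun x y h => hF (congrArg Subtype.val h), F.rangeRestrict_surjective⟩⟩⟩

end Realization

/-! ### Every quantum isometry group is the model -/

section QuantumIsometryGroup

theorem IsQuantumGroupHom.comp {A B C : Type*} [CStarAlgebra A] [PartialOrder A]
    [StarOrderedRing A] [CStarAlgebra B] [PartialOrder B] [StarOrderedRing B] [CStarAlgebra C]
    [PartialOrder C] [StarOrderedRing C] {𝔾 : CompactQuantumGroup A} {ℍ : CompactQuantumGroup B}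
    {𝕂 : CompactQuantumGroup C} {Φ : A →⋆ₐ[ℂ] B} {Ψ : B →⋆ₐ[ℂ] C}
    (hΨ : IsQuantumGroupHom ℍ 𝕂 Ψ) (hΦ : IsQuantumGroupHom 𝔾 ℍ Φ) :
    IsQuantumGroupHom 𝔾 𝕂 (Ψ.comp Φ) := fun φ ψ =>
  (hΦ (pullState Ψ φ) (pullState Ψ ψ)).trans (congrArg (pullState Φ) (hΨ φ ψ))

theorem isQuantumGroupHom_id {A : Type*} [CStarAlgebra A] [PartialOrder A] [StarOrderedRing A]
    (𝔾 : CompactQuantumGroup A) : IsQuantumGroupHom 𝔾 𝔾 (StarAlgHom.id ℂ A) := fun φ ψ => by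
  have h : ∀ φ : CState A, pullState (StarAlgHom.id ℂ A) φ = φ := fun φ =>
    Subtype.ext (DFunLike.ext _ _ fun _ => rfl)
  rw [h, h, h]

variable {n : ℕ}

theorem isQISO_exists_equiv {A : Type u} [CStarAlgebra A] [PartialOrder A] [StarOrderedRing A]
    (hn : 3 ≤ n) {𝔾 : CompactQuantumGroup A}
    {α : MonoidAlgebra ℂ (Equiv.Perm (Fin n)) →⋆ₐ[ℂ]
      MonoidAlgebra ℂ (Equiv.Perm (Fin n)) ⊗[ℂ] A} (h : IsQISO (transpSet n) 𝔾 α) :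
    ∃ F : DoubleAlg (Equiv.Perm (Fin n)) ≃⋆ₐ[ℂ] A, Intertwines (revConj n) α (equivHom F) ∧
      𝔾.comul.comp (equivHom F) = pushComul (revConj n) (equivHom F) := by
  obtain ⟨s, hs⟩ := exists_revConj_ne hn
  obtain ⟨Φ, hΦ⟩ := exists_intertwines hn (preservesLengthOne_of_isIsometric h.isometric)
    (preservesTraceZeroTwo_of_isIsometric h.isometric)
  have hΔ := hΦ.comul_comp revConj_revConj hs h.coaction
  obtain ⟨A₀, _, _, _, ⟨e⟩⟩ := exists_realization.{u} (Equiv.Perm (Fin n))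
  have hi := intertwines_coactionOf (revConj n) (equivHom e)
  have h₀ := isQISO_doubling hn e
  obtain ⟨Ψ, ⟨hΨ, hΨα⟩, -⟩ := h.universal A₀ _ _ h₀.coaction h₀.isometric
  have hΨΦ : Ψ.comp Φ = equivHom e :=
    Intertwines.unique revConj_revConj hs (intertwines_of_eq_lTensor hΦ Ψ hΨα) hi
  -- The round trip through the model preserves `α` and the comultiplication, so by uniqueness it is
  -- the identity; `hΨΦ` gives the other composite.
  set Θ : A →⋆ₐ[ℂ] A := (Φ.comp (equivHom e.symm)).comp Ψ with hΘ
  have hhom := isQuantumGroupHom_of_intertwines e revConj_revConj hs hΦ h.coaction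
  have hΘα : ∀ x, α x = LinearMap.lTensor (MonoidAlgebra ℂ (Equiv.Perm (Fin n)))
      Θ.toAlgHom.toLinearMap (α x) := fun x => by
    have e₁ := hΦ.eq_lTensor e x
    rw [hΨα x, ← LinearMap.comp_apply, ← LinearMap.lTensor_comp] at e₁
    exact e₁
  have hΘ1 : Θ = StarAlgHom.id ℂ A :=
    (h.universal A 𝔾 α h.coaction h.isometric).unique
      ⟨hhom.comp hΨ, hΘα⟩
      ⟨isQuantumGroupHom_id 𝔾, fun x => (LinearMap.congr_fun (LinearMap.lTensor_id _ _) (α x)).symm⟩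
  have hb : Function.Bijective Φ := by
    refine ⟨fun x y hxy => e.injective ?_, fun a => ⟨e.symm (Ψ a), ?_⟩⟩
    · have := DFunLike.congr_fun hΨΦ
      exact (this x).symm.trans ((congrArg Ψ hxy).trans (this y))
    · exact DFunLike.congr_fun hΘ1 a
  exact ⟨StarAlgEquiv.ofBijective Φ hb, hΦ, hΔ⟩

end QuantumIsometryGroup

/-! ### Identification with the dual of the crossed product -/

section DoublingDual

open Module TensorProduct

section DualDistrib

variable {V W V' W' : Type*} [AddCommGroup V] [Module ℂ V] [AddCommGroup W] [Module ℂ W]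
variable [AddCommGroup V'] [Module ℂ V'] [AddCommGroup W'] [Module ℂ W']

theorem dualDistrib_tmul_map (f : V →ₗ[ℂ] V') (g : W →ₗ[ℂ] W') (ξ : Dual ℂ V') (η : Dual ℂ W')
    (t : V ⊗[ℂ] W) :
    dualDistrib ℂ V' W' (ξ ⊗ₜ η) (TensorProduct.map f g t) =
      dualDistrib ℂ V W ((ξ ∘ₗ f) ⊗ₜ (η ∘ₗ g)) t := by
  induction t using TensorProduct.induction_on with
  | zero => simp
  | add s t hs ht => simp only [map_add, hs, ht]
  | tmul x y => rfl

theorem dualDistrib_eval_tmul_eval (x : V) (y : W) (t : Dual ℂ V ⊗[ℂ] Dual ℂ W) :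
    dualDistrib ℂ (Dual ℂ V) (Dual ℂ W) (Dual.eval ℂ V x ⊗ₜ Dual.eval ℂ W y) t =
      dualDistrib ℂ V W t (x ⊗ₜ y) := by
  induction t using TensorProduct.induction_on with
  | zero => simp
  | add s t hs ht => simp only [map_add, hs, ht, LinearMap.add_apply]
  | tmul f g => rfl

theorem dualDistribEquiv_apply [Module.Finite ℂ V] [Module.Finite ℂ W]
    (t : Dual ℂ V ⊗[ℂ] Dual ℂ W) : dualDistribEquiv ℂ V W t = dualDistrib ℂ V W t := rfl

end DualDistrib

variable {H : Type*} [Ring H] [HopfAlgebra ℂ H] [Module.Finite ℂ H]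

theorem dualDistrib_dualComul (f : Dual ℂ H) (x y : H) :
    dualDistrib ℂ H H (dualComul f) (x ⊗ₜ y) = f (x * y) := by
  rw [← dualDistribEquiv_apply, dualComul, LinearMap.comp_apply, LinearEquiv.coe_coe,
    LinearEquiv.apply_symm_apply]
  rfl

variable (H) in
/-- Two copies of `H`, identified with the doubling through the bidual. -/
def bidual : (H × H) ≃ₗ[ℂ] Doubling H :=
  (evalEquiv ℂ H).prodCongr (evalEquiv ℂ H) ≪≫ₗ dualProdDualEquivDual ℂ (Dual ℂ H) (Dual ℂ H)

theorem bidual_apply (x : H × H) (p : Crossed H) : bidual H x p = p.1 x.1 + p.2 x.2 := rfl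

theorem bidual_one : bidual H 1 = crossedCounit := rfl

/-- The comultiplication of the crossed product maps each of the summands `Ĥ` and `Ĥ U` into its own
tensor square, so the dual product is componentwise, without any twist. -/
theorem doublingMul_bidual (x y : H × H) :
    doublingMul (bidual H x) (bidual H y) = bidual H (x * y) := by
  refine LinearMap.ext fun p => ?_
  change dualDistrib ℂ _ _ (bidual H x ⊗ₜ bidual H y)
    (TensorProduct.map (LinearMap.inl ℂ _ _) (LinearMap.inl ℂ _ _) (dualComul p.1) +
      TensorProduct.map (LinearMap.inr ℂ _ _) (LinearMap.inr ℂ _ _) (dualComul p.2)) = _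
  have h₁ : ∀ x : H × H, bidual H x ∘ₗ LinearMap.inl ℂ _ _ = Dual.eval ℂ H x.1 := fun x =>
    LinearMap.ext fun f => by simp [bidual_apply]
  have h₂ : ∀ x : H × H, bidual H x ∘ₗ LinearMap.inr ℂ _ _ = Dual.eval ℂ H x.2 := fun x =>
    LinearMap.ext fun f => by simp [bidual_apply]
  rw [map_add, dualDistrib_tmul_map, dualDistrib_tmul_map, h₁, h₁, h₂, h₂,
    dualDistrib_eval_tmul_eval, dualDistrib_eval_tmul_eval, dualDistrib_dualComul,
    dualDistrib_dualComul]
  rfl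

section GroupAlgebra

variable {G : Type*} [Group G]

theorem antipode_grp (g : G) :
    HopfAlgebra.antipode ℂ (grp g : MonoidAlgebra ℂ G) = grp g⁻¹ := by
  simp

theorem antipode_star_antipode (x : MonoidAlgebra ℂ G) :
    HopfAlgebra.antipode ℂ (star (HopfAlgebra.antipode ℂ x)) = star x := by
  induction x using MonoidAlgebra.induction_linear with
  | zero => simp
  | add x y hx hy => simp only [map_add, star_add, hx, hy]
  | single g c =>
    have e : MonoidAlgebra.single g c = c • grp g := by simp
    simp only [e, map_smul, star_smul, antipode_grp, star_grp, inv_inv]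

theorem antipode_twist (θ : G →* G) (x : MonoidAlgebra ℂ G) :
    HopfAlgebra.antipode ℂ (twist θ x) = twist θ (HopfAlgebra.antipode ℂ x) := by
  refine LinearMap.congr_fun (linearMap_ext_grp
    (f := HopfAlgebra.antipode ℂ ∘ₗ (twist θ).toAlgHom.toLinearMap)
    (f' := (twist θ).toAlgHom.toLinearMap ∘ₗ HopfAlgebra.antipode ℂ) fun g => ?_) x
  change HopfAlgebra.antipode ℂ (twist θ (grp g)) = twist θ (HopfAlgebra.antipode ℂ (grp g))
  rw [antipode_grp, twist_grp, twist_grp, antipode_grp, map_inv]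

theorem dualMul_apply_grp (f f' : Dual ℂ (MonoidAlgebra ℂ G)) (g : G) :
    dualMul f f' (grp g) = f (grp g) * f' (grp g) := by
  change dualDistrib ℂ _ _ (f ⊗ₜ f') (Coalgebra.comul (grp g)) = _
  rw [MonoidAlgebra.comul_single]
  simp [dualDistrib_apply]

variable [Finite G] {θ : G →* G} {T : MonoidAlgebra ℂ G →ₗ[ℂ] MonoidAlgebra ℂ G}

/-- The involution and the antipode of the crossed product each contribute one `θ` on the second
summand. They cancel because `θ` is involutive, and the antipodes cancel around the star. -/
theorem doublingStar_bidual (hθ : ∀ g, θ (θ g) = g) (hT : ∀ x, T x = twist θ x) (x : DoubleAlg G) :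
    doublingStar T (bidual _ x) = bidual _ (star x) := by
  refine LinearMap.ext fun p => ?_
  change star (star (p.1 (HopfAlgebra.antipode ℂ (star (HopfAlgebra.antipode ℂ x.1)))) +
    star (p.2 (HopfAlgebra.antipode ℂ (T (star (HopfAlgebra.antipode ℂ (T x.2))))))) =
      p.1 (star x.1) + p.2 (star x.2)
  rw [hT, hT, antipode_twist, antipode_twist, ← map_star (twist θ), antipode_twist, twist_twist hθ,
    antipode_star_antipode, antipode_star_antipode, star_add, star_star, star_star]

/-- Test on `p ⊗ q` at group elements. These are group-like, so the dual product is pointwise there,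
and the twist in the crossed product becomes the `θ` in the second tensor factor of `Δ`. -/
theorem doublingComul_bidual (hθ : ∀ g, θ (θ g) = g) (hT : ∀ x, T x = twist θ x)
    (x : DoubleAlg G) :
    doublingComul T (bidual _ x) = TensorProduct.map (bidual (MonoidAlgebra ℂ G)).toLinearMap
      (bidual (MonoidAlgebra ℂ G)).toLinearMap (doubleComul θ x) := by
  rw [doublingComul, LinearEquiv.symm_apply_eq]
  refine LinearMap.congr_fun (doubleAlg_linearMap_ext
    (f := (TensorProduct.lift (crossedMul T)).dualMap ∘ₗ
      (bidual (MonoidAlgebra ℂ G)).toLinearMap)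
    (f' := (dualDistribEquiv ℂ _ _).toLinearMap ∘ₗ
      TensorProduct.map (bidual (MonoidAlgebra ℂ G)).toLinearMap
        (bidual (MonoidAlgebra ℂ G)).toLinearMap ∘ₗ (doubleComul θ).toAlgHom.toLinearMap)
    (fun g => TensorProduct.ext' fun p q => ?_) fun g => TensorProduct.ext' fun p q => ?_) x
  · change bidual _ (grp g, 0) (crossedMul T p q) =
      dualDistrib ℂ _ _ (TensorProduct.map _ _ (doubleComul θ (grp g, 0))) (p ⊗ₜ q)
    rw [doubleComul_inl]
    simp [bidual_apply, crossedMul, dualMul_apply_grp, hT, twist_grp]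
  · change bidual _ (0, grp g) (crossedMul T p q) =
      dualDistrib ℂ _ _ (TensorProduct.map _ _ (doubleComul θ (0, grp g))) (p ⊗ₜ q)
    rw [doubleComul_inr hθ]
    simp [bidual_apply, crossedMul, dualMul_apply_grp, hT, twist_grp]

theorem isDoublingIso_of_equiv {A : Type*} [CStarAlgebra A] [PartialOrder A] [StarOrderedRing A]
    {𝔾 : CompactQuantumGroup A} (hθ : ∀ g, θ (θ g) = g) (hT : ∀ x, T x = twist θ x)
    (F : DoubleAlg G ≃⋆ₐ[ℂ] A) (hF : 𝔾.comul.comp (equivHom F) = pushComul θ (equivHom F)) :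
    IsDoublingIso T 𝔾 ((bidual (MonoidAlgebra ℂ G)).symm ≪≫ₗ
      LinearEquiv.ofBijective (equivHom F).toAlgHom.toLinearMap F.bijective) := by
  set Λ := (bidual (MonoidAlgebra ℂ G)).symm ≪≫ₗ
      LinearEquiv.ofBijective (equivHom F).toAlgHom.toLinearMap F.bijective with hΛ
  have h : ∀ x, Λ (bidual _ x) = F x := fun x => by
    change F ((bidual _).symm (bidual _ x)) = F x
    rw [LinearEquiv.symm_apply_apply]
  constructor
  · rw [← bidual_one, h, map_one]
  · intro ξ η
    obtain ⟨x, rfl⟩ := (bidual _).surjective ξ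
    obtain ⟨y, rfl⟩ := (bidual _).surjective η
    rw [doublingMul_bidual, h, h, h, map_mul]
  · intro ξ
    obtain ⟨x, rfl⟩ := (bidual _).surjective ξ
    rw [doublingStar_bidual hθ hT, h, h, map_star]
  · intro ξ
    obtain ⟨x, rfl⟩ := (bidual _).surjective ξ
    rw [doublingComul_bidual hθ hT, h]
    refine (DFunLike.congr_fun hF x).trans ?_
    rw [pushComul_apply]
    congr 1
    induction doubleComul θ x using TensorProduct.induction_on with
    | zero => simp
    | add s t hs ht => simp only [map_add, hs, ht]
    | tmul y z =>
      rw [tensorHom_tmul, TensorProduct.map_tmul, TensorProduct.map_tmul]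
      exact congrArg₂ _ (h y).symm (h z).symm

end GroupAlgebra

end DoublingDual

end QIso

end

/-! ### The theorem -/

theorem theorem1p1 (n : ℕ) (hn : 3 ≤ n) :
    (∃ (A : Type u) (_ : CStarAlgebra A) (_ : PartialOrder A) (_ : StarOrderedRing A)
      (𝔾 : QIso.CompactQuantumGroup A)
      (α : MonoidAlgebra ℂ (Equiv.Perm (Fin n)) →⋆ₐ[ℂ]
        MonoidAlgebra ℂ (Equiv.Perm (Fin n)) ⊗[ℂ] A),
      QIso.IsQISO (QIso.transpSet n) 𝔾 α) ∧
    (∀ (A : Type u) [CStarAlgebra A] [PartialOrder A] [StarOrderedRing A]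
      (𝔾 : QIso.CompactQuantumGroup A)
      (α : MonoidAlgebra ℂ (Equiv.Perm (Fin n)) →⋆ₐ[ℂ]
        MonoidAlgebra ℂ (Equiv.Perm (Fin n)) ⊗[ℂ] A),
      QIso.IsQISO (QIso.transpSet n) 𝔾 α →
      (∃ Λ : QIso.Doubling (MonoidAlgebra ℂ (Equiv.Perm (Fin n))) ≃ₗ[ℂ] A,
        QIso.IsDoublingIso (QIso.flip n : MonoidAlgebra ℂ (Equiv.Perm (Fin n)) →ₗ[ℂ] _) 𝔾 Λ) ∧
      (∃ Ψ : (MonoidAlgebra ℂ (Equiv.Perm (Fin n)) × MonoidAlgebra ℂ (Equiv.Perm (Fin n)))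
          ≃⋆ₐ[ℂ] A, ∀ i : Fin (n - 1),
        𝔾.comul (Ψ (QIso.sigmaGen i)) = QIso.toMin A A
          (Ψ (QIso.sigmaGen i) ⊗ₜ Ψ (QIso.sigmaGen i) +
            Ψ (QIso.tauGen i) ⊗ₜ Ψ (QIso.tauGen i.rev)) ∧
        𝔾.comul (Ψ (QIso.tauGen i)) = QIso.toMin A A
          (Ψ (QIso.sigmaGen i) ⊗ₜ Ψ (QIso.tauGen i) +
            Ψ (QIso.tauGen i) ⊗ₜ Ψ (QIso.sigmaGen i.rev)) ∧
        α (QIso.sGen i) = QIso.sGen i ⊗ₜ Ψ (QIso.sigmaGen i) +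
          QIso.sGen i.rev ⊗ₜ Ψ (QIso.tauGen i.rev))) ∧
    (∀ (A : Type u) [CStarAlgebra A] [PartialOrder A] [StarOrderedRing A]
      (𝔾 : QIso.CompactQuantumGroup A)
      (α : MonoidAlgebra ℂ (Equiv.Perm (Fin n)) →⋆ₐ[ℂ]
        MonoidAlgebra ℂ (Equiv.Perm (Fin n)) ⊗[ℂ] A),
      QIso.IsCoaction 𝔾 α → QIso.PreservesLengthOne α → QIso.PreservesTraceZeroTwo α →
      QIso.IsIsometric (QIso.transpSet n) α) := by
  refine ⟨?_, fun A _ _ _ 𝔾 α h => ?_, fun A _ _ _ 𝔾 α _ hl ht => ?_⟩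
  · obtain ⟨A, _, _, _, ⟨e⟩⟩ := QIso.exists_realization.{u} (Equiv.Perm (Fin n))
    exact ⟨A, _, _, _, _, _, QIso.isQISO_doubling hn e⟩
  · obtain ⟨F, hα, hΔ⟩ := QIso.isQISO_exists_equiv hn h
    refine ⟨⟨_, QIso.isDoublingIso_of_equiv QIso.revConj_revConj QIso.flip_eq_twist F hΔ⟩,
      F, fun i => ⟨?_, ?_, ?_⟩⟩
    · have := (DFunLike.congr_fun hΔ (QIso.sigmaGen i)).trans
        (QIso.pushComul_inl _ (QIso.equivHom F) (QIso.transp i))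
      rw [QIso.revConj_transp] at this
      exact this
    · have := (DFunLike.congr_fun hΔ (QIso.tauGen i)).trans
        (QIso.pushComul_inr QIso.revConj_revConj (QIso.equivHom F) (QIso.transp i))
      rw [QIso.revConj_transp] at this
      exact this
    · have := hα (QIso.transp i)
      rw [QIso.revConj_transp] at this
      exact this
  · obtain ⟨Φ, hΦ⟩ := QIso.exists_intertwines hn hl ht
    exact QIso.isIsometric_of_intertwines (QIso.closure_transpSet n) QIso.revConj_revConj
      QIso.revConj_mem_transpSet hΦ
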